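/- \textbf{Theorem.} Let $d\ge 1$, $\lambda>0$, $\theta>0$. \emph{Set-up.} Let $f$ be a positive continuous probability density on $\mathbb R^d$ with $f(\mathbf z)\sim f_*(n_D(\mathbf z))$ as $\|\mathbf z\|\to\infty$. Here $D$ is a bounded open star-shaped set containing the origin whose gauge function $n_D$ is continuous, $f_*(r)=L(r)/r^{\lambda+d}$ is continuous and decreasing on $[0,\infty)$, and $L$ varies slowly at infinity. Assume that all univariate marginal densities of $f$ are equal to one positive continuous symmetric density $f_0$ with distribution function (df) $F_0$. Let $g_0$ be a continuous, positive, symmetric probability density on $\mathbb R$ with df $G_0$ such that $g_0(s)\sim e^{-\psi(s)}$ as $s\to\infty$. Here $\psi$ is, near infinity, a $C^2$ function with positive derivative, $\psi(s)\to\infty$, $(1/\psi')'(s)\to0$, and $\psi$ varies regularly at infinity with exponent $\theta$. Put $K_0=F_0^{-1}\circ G_0$ and $K(x_1,\dots,x_d)=(K_0(x_1),\dots,K_0(x_d))$. \emph{Excess measures.} An excess measure with exponent $\lambda$ is an infinite Borel measure $\rho$ on $\mathbb R^d\setminus\{\mathbf 0\}$, finite on complements of centered balls, with $\rho(rA)=\rho(A)/r^{\lambda}$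 for all $r>0$ and all Borel sets $A$. Let $\rho$ be the excess measure of $f$: if $c_n>0$ and $1-F_0(c_n)\sim 1/n$, then for $\mathbf Z$ with density $f$ the measures $n\,\mathbb P\{\mathbf Z/c_n\in\cdot\}$ converge to $\rho$ weakly on the complement of centered balls. Assume that $\rho$ does not charge the coordinate planes $\{w_i=0\}$. Let $\tilde\rho$ be an excess measure with exponent $\lambda$ whose univariate marginals on $\mathbb R\setminus\{0\}$ have density $\lambda/|t|^{\lambda+1}$, and assume that for every $\delta\in\{-1,1\}^d$ the restrictions of $\tilde\rho$ and $\rho$ to the orthant $Q_\delta=\{\mathbf w\mid \delta_iw_i>0,\ i=1,\dots,d\}$ have the same univariate marginals. \emph{Conclusion.} There exists a df $\tilde F$ on $\mathbb R^d$ such that: (1) Its marginals $\tilde F_j$ are continuous, strictly increasing and tail asymptotic to $F_0$, that is, $\tilde F_j(-t)/F_0(-t)\to1$ and $(1-\tilde F_j(t))/(1-F_0(t))\to1$ as $t\to\infty$. (2) For every sequence $c_n>0$ with $1-F_0(c_n)\sim1/n$, the sample clouds $\{\mathbf Z_1/c_n,\dots,\mathbf Z_n/c_n\}$ of independent observations from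 $\tilde F$ converge in distribution, weakly on the complement of centered balls, to the Poisson point process on $\mathbb R^d\setminus\{\mathbf 0\}$ with mean measure $\tilde\rho$. (3) $\tilde G=\tilde F\circ K$ is a df on $\mathbb R^d$, and for every sequence $b_n>0$ with $-\log(1-G_0(b_n))\sim\log n$ the sample clouds $M_n=\{\mathbf X_1/b_n,\dots,\mathbf X_n/b_n\}$ of independent observations from $\tilde G$ converge onto the compact set $$E_{\lambda,\theta}=\{\mathbf u\in\mathbb R^d\mid |u_1|^\theta+\cdots+|u_d|^\theta+\lambda\ge(\lambda+d)\|\mathbf u\|_\infty^\theta\}.$$ This means that $\mathbb P\{M_n(U^c)>0\}\to0$ for every open $U\supset E_{\lambda,\theta}$, and $\mathbb P\{M_n(\mathbf p+\epsilon B)>m\}\to1$ for all $m\ge1$, $\epsilon>0$ and $\mathbf p\in E_{\lambda,\theta}$, where $M_n(A)$ is the number of points of $M_n$ in $A$ and $B$ is the open Euclidean unit ball. -/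

import Mathlib

open Set Filter Topology MeasureTheory ProbabilityTheory Asymptotics
open scoped BoundedContinuousFunction NNReal ENNReal Pointwise

noncomputable section

/-! ### Regular variation and densities -/

/-- `u` varies regularly at infinity with exponent `θ`. -/
def RegularlyVarying (u : ℝ → ℝ) (θ : ℝ) : Prop :=
  ∀ x : ℝ, 0 < x → Tendsto (fun s => u (x * s) / u s) atTop (𝓝 (x ^ θ))

/-- `L` varies slowly at infinity. -/
def SlowlyVarying (L : ℝ → ℝ) : Prop := RegularlyVarying L 0

/-- A positive continuous probability density. -/
structure IsPosContDensity {X : Type*} [MeasureSpace X] [TopologicalSpace X] (f : X → ℝ) :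
    Prop where
  pos : ∀ x, 0 < f x
  continuous : Continuous f
  integrable : Integrable f
  integral_eq_one : ∫ x, f x = 1

/-- The measure with density `f` with respect to Lebesgue measure. -/
def densityLaw {X : Type*} [MeasureSpace X] (f : X → ℝ) : Measure X :=
  volume.withDensity (fun x => ENNReal.ofReal (f x))

/-- The class `𝓕_λ` of heavy-tailed densities on `ℝᵈ`: positive continuous densities asymptotic
to `f_*(n_D(z))`, where `f_*(r) = L(r) / r ^ (λ + d)` is continuous and decreasing on `[0, ∞)`,
`L` varies slowly, and `n_D` is the gauge of a bounded open star-shaped set `D` containing the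
origin, whose boundary is continuous (that is, whose gauge function is continuous). -/
def HeavyTailedClass (d : ℕ) (lam : ℝ) (f : EuclideanSpace ℝ (Fin d) → ℝ) : Prop :=
  IsPosContDensity f ∧
  ∃ (D : Set (EuclideanSpace ℝ (Fin d))) (fstar L : ℝ → ℝ),
    IsOpen D ∧ Bornology.IsBounded D ∧ (0 : EuclideanSpace ℝ (Fin d)) ∈ D ∧ StarConvex ℝ 0 D ∧
    Continuous (gauge D) ∧
    ContinuousOn fstar (Ici 0) ∧ AntitoneOn fstar (Ici 0) ∧
    (∀ r : ℝ, 0 < r → fstar r = L r / r ^ (lam + d)) ∧ SlowlyVarying L ∧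
    Tendsto (fun z => f z / fstar (gauge D z)) (cocompact _) (𝓝 1)

/-- `e^{-ψ}` is a von Mises function: near infinity `ψ` is `C²` with positive derivative,
`ψ → ∞`, and the scale function `a = 1 / ψ'` satisfies `a' → 0`. -/
structure IsVonMisesExponent (ψ : ℝ → ℝ) : Prop where
  smooth : ∃ s₀ : ℝ, ContDiffOn ℝ 2 ψ (Ioi s₀) ∧ ∀ s, s₀ < s → 0 < deriv ψ s
  tendsto : Tendsto ψ atTop atTop
  scale : Tendsto (deriv (fun s => 1 / deriv ψ s)) atTop (𝓝 0)

/-- The `i`-th univariate marginal of a measure on `ℝᵈ`. -/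
def marginal {d : ℕ} (π : Measure (EuclideanSpace ℝ (Fin d))) (i : Fin d) : Measure ℝ :=
  π.map (fun z => z i)

/-- The standard set-up: `f ∈ 𝓕_λ` has all its marginal densities equal to the positive continuous
symmetric density `f₀`; the density `g₀` is continuous, positive, symmetric and asymptotic to the
von Mises function `e^{-ψ}`, with `ψ` regularly varying with exponent `θ`. -/
structure StandardSetup (d : ℕ) (lam θ : ℝ) (f : EuclideanSpace ℝ (Fin d) → ℝ)
    (f₀ g₀ ψ : ℝ → ℝ) : Prop where
  lam_pos : 0 < lam
  theta_pos : 0 < θ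
  heavy : HeavyTailedClass d lam f
  f₀_density : IsPosContDensity f₀
  f₀_symm : ∀ t, f₀ (-t) = f₀ t
  marginals : ∀ i, marginal (densityLaw f) i = densityLaw f₀
  g₀_density : IsPosContDensity g₀
  g₀_symm : ∀ s, g₀ (-s) = g₀ s
  vonMises : IsVonMisesExponent ψ
  g₀_asymp : Tendsto (fun s => g₀ s / Real.exp (-ψ s)) atTop (𝓝 1)
  psi_rv : RegularlyVarying ψ θ

/-! ### The meta transformation -/

/-- The quantile function (inverse df) of `F`. -/
def quantile (F : ℝ → ℝ) (p : ℝ) : ℝ := sInf {t | p ≤ F t}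

/-- `K₀ = F₀⁻¹ ∘ G₀`. -/
def metaComponent (F₀ G₀ : ℝ → ℝ) (s : ℝ) : ℝ := quantile F₀ (G₀ s)

/-- The meta transformation `K : (x₁, …, x_d) ↦ (K₀(x₁), …, K₀(x_d))`. -/
def metaMap {d : ℕ} (F₀ G₀ : ℝ → ℝ) (x : EuclideanSpace ℝ (Fin d)) :
    EuclideanSpace ℝ (Fin d) :=
  WithLp.toLp 2 (fun i => metaComponent F₀ G₀ (x i))

/-- The multivariate distribution function of a measure on `ℝᵈ`. -/
def jointCDF {d : ℕ} (π : Measure (EuclideanSpace ℝ (Fin d))) (x : EuclideanSpace ℝ (Fin d)) :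
    ℝ :=
  π.real {z | ∀ i, z i ≤ x i}

/-- The univariate dfs `F₁` and `F₂` are tail asymptotic. -/
def TailAsymptotic (F₁ F₂ : ℝ → ℝ) : Prop :=
  Tendsto (fun t => F₁ (-t) / F₂ (-t)) atTop (𝓝 1) ∧
  Tendsto (fun t => (1 - F₁ t) / (1 - F₂ t)) atTop (𝓝 1)

/-! ### Scaling constants -/

/-- Positive scaling constants for heavy-tailed sample clouds: `1 - F₀(c_n) ∼ 1 / n`. -/
def IsHeavyScaling (F₀ : ℝ → ℝ) (c : ℕ → ℝ) : Prop :=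
  (∀ n, 0 < c n) ∧ (fun n => 1 - F₀ (c n)) ~[atTop] (fun n : ℕ => 1 / (n : ℝ))

/-- Positive scaling constants for light-tailed sample clouds: `-log(1 - G₀(b_n)) ∼ log n`. -/
def IsLightScaling (G₀ : ℝ → ℝ) (b : ℕ → ℝ) : Prop :=
  (∀ n, 0 < b n) ∧
    (fun n => -Real.log (1 - G₀ (b n))) ~[atTop] (fun n : ℕ => Real.log (n : ℝ))

/-! ### Excess measures

Measures on `ℝᵈ ∖ {0}` are represented by measures on `ℝᵈ` which do not charge the origin. -/

/-- An excess measure with exponent `λ` on `ℝᵈ ∖ {0}`: an infinite measure, finite outside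
centered balls, with `ρ(rA) = ρ(A) / r ^ λ`. -/
structure IsExcessMeasure {d : ℕ} (lam : ℝ) (ρ : Measure (EuclideanSpace ℝ (Fin d))) : Prop where
  zero : ρ {0} = 0
  finite_away : ∀ ε : ℝ, 0 < ε → ρ {w | ε ≤ ‖w‖} < ∞
  infinite : ρ univ = ∞
  scaling : ∀ r : ℝ, 0 < r → ∀ A : Set (EuclideanSpace ℝ (Fin d)), MeasurableSet A →
    ρ (r • A) = ρ A / ENNReal.ofReal (r ^ lam)

/-- `π` varies regularly with scaling constants `c` and limit `ρ`: the mean measures of the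
sample clouds from `π` scaled by `c_n` converge to `ρ` weakly on the complement of centered
balls. -/
def RegularlyVaryingMeasure {d : ℕ} (π : Measure (EuclideanSpace ℝ (Fin d))) (c : ℕ → ℝ)
    (ρ : Measure (EuclideanSpace ℝ (Fin d))) : Prop :=
  ∀ φ : EuclideanSpace ℝ (Fin d) →ᵇ ℝ, (∃ ε : ℝ, 0 < ε ∧ ∀ w, ‖w‖ < ε → φ w = 0) →
    Tendsto (fun n : ℕ => (n : ℝ) * ∫ z, φ ((c n)⁻¹ • z) ∂π) atTop (𝓝 (∫ w, φ w ∂ρ))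

/-- `ρ` is the excess measure of the distribution `π`, whose marginals have df `F₀`. -/
def IsExcessMeasureOf {d : ℕ} (lam : ℝ) (F₀ : ℝ → ℝ) (π ρ : Measure (EuclideanSpace ℝ (Fin d))) :
    Prop :=
  IsExcessMeasure lam ρ ∧ ∀ c, IsHeavyScaling F₀ c → RegularlyVaryingMeasure π c ρ

/-- The marginals of `ρ` on `ℝ ∖ {0}` have density `λ / |t| ^ (λ + 1)`. -/
def HasParetoMarginals {d : ℕ} (lam : ℝ) (ρ : Measure (EuclideanSpace ℝ (Fin d))) : Prop :=
  ∀ i, (marginal ρ i).restrict {0}ᶜ =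
    (densityLaw (fun t : ℝ => lam / |t| ^ (lam + 1))).restrict {0}ᶜ

/-- The (open) orthant `Q_δ`, for `δ ∈ {-1, 1}ᵈ`. -/
def orthant {d : ℕ} (δ : Fin d → ℝ) : Set (EuclideanSpace ℝ (Fin d)) :=
  {w | ∀ i, 0 < δ i * w i}

/-- On each orthant, the restrictions of `ρ₁` and `ρ₂` have the same univariate marginals. -/
def SameOrthantMarginals {d : ℕ} (ρ₁ ρ₂ : Measure (EuclideanSpace ℝ (Fin d))) : Prop :=
  ∀ δ : Fin d → ℝ, (∀ i, δ i = 1 ∨ δ i = -1) →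
    ∀ i, marginal (ρ₁.restrict (orthant δ)) i = marginal (ρ₂.restrict (orthant δ)) i

/-! ### Sample clouds and their limits -/

/-- The scaled `n`-point sample cloud `{z₁ / a, …, z_n / a}` as a counting measure. -/
def sampleCloud {d n : ℕ} (a : ℝ) (z : Fin n → EuclideanSpace ℝ (Fin d)) :
    FiniteMeasure (EuclideanSpace ℝ (Fin d)) :=
  ∑ i, ⟨Measure.dirac (a⁻¹ • z i), inferInstance⟩

/-- The law of `n` independent observations from `π`. -/
def sampleLaw {d : ℕ} (π : Measure (EuclideanSpace ℝ (Fin d))) (n : ℕ) :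
    Measure (Fin n → EuclideanSpace ℝ (Fin d)) :=
  Measure.pi (fun _ => π)

/-- `N` is a Poisson point process with the finite mean measure `ρ`: the number of points in a
Borel set `A` is Poisson with expectation `ρ(A)`, and the numbers of points in disjoint Borel sets
are independent. -/
structure IsPoissonProcess {d : ℕ} {Ω : Type} [MeasurableSpace Ω] (P : Measure Ω)
    (N : Ω → FiniteMeasure (EuclideanSpace ℝ (Fin d)))
    (ρ : Measure (EuclideanSpace ℝ (Fin d))) : Prop where
  finite_mean : ρ univ < ∞
  measurable_count : ∀ A, MeasurableSet A → Measurable (fun ω => N ω A)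
  law_count : ∀ A, MeasurableSet A →
    P.map (fun ω => N ω A) = (poissonMeasure (ρ A).toNNReal).map (fun k : ℕ => (k : ℝ≥0))
  indep_count : ∀ (k : ℕ) (A : Fin k → Set (EuclideanSpace ℝ (Fin d))),
    (∀ i, MeasurableSet (A i)) → Pairwise (fun i j => Disjoint (A i) (A j)) →
    iIndepFun (fun i ω => N ω (A i)) P

/-- The sample clouds from `π` scaled by `c_n` converge in distribution, weakly on the complement
of centered balls, to the Poisson point process on `ℝᵈ ∖ {0}` with mean measure `ρ`: for each
`ε > 0` the restrictions to `{‖w‖ ≥ ε}` converge in distribution, as random elements of the space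
of finite measures with the weak topology. (The restriction of the Poisson point process with mean
measure `ρ` to a set is the Poisson point process whose mean measure is the restriction of `ρ`.) -/
def SampleCloudsConvergeToPoisson {d : ℕ} (π : Measure (EuclideanSpace ℝ (Fin d))) (c : ℕ → ℝ)
    (ρ : Measure (EuclideanSpace ℝ (Fin d))) : Prop :=
  ∀ ε : ℝ, 0 < ε →
    ∃ (Ω : Type) (_ : MeasurableSpace Ω) (P : Measure Ω)
      (N : Ω → FiniteMeasure (EuclideanSpace ℝ (Fin d))),
      IsProbabilityMeasure P ∧ IsPoissonProcess P N (ρ.restrict {w | ε ≤ ‖w‖}) ∧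
      ∀ Φ : FiniteMeasure (EuclideanSpace ℝ (Fin d)) →ᵇ ℝ,
        Tendsto
          (fun n : ℕ => ∫ z, Φ ((sampleCloud (c n) z).restrict {w | ε ≤ ‖w‖}) ∂(sampleLaw π n))
          atTop (𝓝 (∫ ω, Φ (N ω) ∂P))

/-- The sample clouds from `μ` scaled by `b_n` converge onto the compact set `E`. -/
def SampleCloudsConvergeOnto {d : ℕ} (μ : Measure (EuclideanSpace ℝ (Fin d))) (b : ℕ → ℝ)
    (E : Set (EuclideanSpace ℝ (Fin d))) : Prop :=
  IsCompact E ∧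
  (∀ U, IsOpen U → E ⊆ U →
    Tendsto (fun n : ℕ => sampleLaw μ n {x | 0 < sampleCloud (b n) x Uᶜ}) atTop (𝓝 0)) ∧
  (∀ m : ℕ, 1 ≤ m → ∀ ε : ℝ, 0 < ε → ∀ p ∈ E,
    Tendsto (fun n : ℕ => sampleLaw μ n {x | (m : ℝ≥0) < sampleCloud (b n) x (Metric.ball p ε)})
      atTop (𝓝 1))

/-- The limit set `E_{λ,θ}`; the norm of `WithLp.ofLp u : Fin d → ℝ` is the supremum norm. -/
def limitSet (d : ℕ) (lam θ : ℝ) : Set (EuclideanSpace ℝ (Fin d)) :=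
  {u | (lam + d) * ‖WithLp.ofLp u‖ ^ θ ≤ (∑ i, |u i| ^ θ) + lam}

end

/-! Both laws are images of one probability measure `ν = perturbedLaw lam ρ'`, written in
coordinates whose reference marginal is the symmetric Pareto df `P`, with `1 - P t = (2 ^ (1/λ) + t)
^ (-λ)` for `t ≥ 0`. The law with df `F̃` is the image of `ν` under `F₀⁻¹ ∘ P` in each coordinate,
and the law with df `G̃` is its image under `G₀⁻¹ ∘ P`. The relation `G̃ = F̃ ∘ K` is then an
identity between dfs (`jointCDF_map_metaMap`), and everything else concerns `ν`.

The measure `ν` has two parts. The first is the restriction of `ρ̃` to `balancedCone`, where all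
coordinates agree in size up to a logarithmic factor. The second is a multiple of `cubeMix`, which
gives the cube `[-eᵐ, eᵐ]ᵈ` the weight `e^(-λm) / (m+1)³`. Each part is visible on only one of the
two scales.

On the heavy scale, `r ^ λ` times the law of `w / r` tends to `ρ̃`
(`tendsto_integral_perturbedLaw`). The factor `(m+1)³` makes the tail of the cubes `O(s ^ (-λ) / log
s)`, which is negligible. Every `w` with nonzero coordinates enters the cone after dilation, so no
mass of `ρ̃` is lost provided that `ρ̃` does not charge the coordinate planes. This last fact
follows from the comparison with `ρ` on orthants (`IsExcessMeasure.measure_coord_eq_zero`). The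
convergence to `ρ` makes the tail of `F₀` regularly varying along `c_n`, so that `F₀⁻¹ ∘ P` is
asymptotically linear (`tendsto_scaled_metaComponent`). Hence the marginals are tail asymptotic to
`F₀` and the mean measures converge, and the binomial-to-Poisson limit `tendsto_integral_cloud`
gives convergence of the clouds.

On the light scale, `G₀⁻¹ ∘ P` is logarithmic: `|w| = n ^ (uᶿ/λ)` goes to about `b_n u`, because
`-log (1 - G₀)` is asymptotic to `ψ` (`tendsto_tailExponent_mul`). Powers of logarithms disappear.
The cone part collapses onto points with `|u₁| = ⋯ = |u_d| ≤ 1`, all of which lie in `E`. The cubes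
act like a density `‖w‖_∞ ^ (-(λ+d))`, so the expected number of sample points near `u` is `n` to
the power `(λ + ∑ |u_i|ᶿ - (λ+d) ‖u‖_∞ᶿ) / λ`, up to `n ^ o(1)`. This exponent is nonnegative
exactly on `E`. The upper estimate is `tendsto_natCast_mul_perturbedLaw_slab` and the lower one is
`tendsto_natCast_mul_perturbedLaw_box`. A union bound and a Chernoff bound turn expected counts into
the two halves of convergence onto `E`. -/

/-! ### Point clouds and Poisson processes -/

section PoissonProcess

variable {X : Type} [MeasurableSpace X]

/-- The counting measure of a finite family of points. -/
noncomputable def pointCloud {ι : Type*} [Fintype ι] (z : ι → X) : FiniteMeasure X :=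
  ∑ i, (diracProba (z i)).toFiniteMeasure

lemma pointCloud_apply {ι : Type*} [Fintype ι] (z : ι → X) {A : Set X} (hA : MeasurableSet A) :
    (pointCloud z A : ℝ) = ∑ i, A.indicator (fun _ => (1 : ℝ)) (z i) := by
  have h : ((pointCloud z : FiniteMeasure X) : Measure X) A
      = ∑ i, A.indicator (fun _ => (1 : ℝ≥0∞)) (z i) := by
    rw [pointCloud, FiniteMeasure.toMeasure_sum, Measure.finsetSum_apply]
    refine Finset.sum_congr rfl fun i _ => ?_
    exact Measure.dirac_apply' _ hA
  rw [FiniteMeasure.coeFn_def]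
  simp only
  rw [h, ENNReal.coe_toNNReal_eq_toReal, ENNReal.toReal_sum]
  · refine Finset.sum_congr rfl fun i _ => ?_
    by_cases hi : z i ∈ A <;> simp [hi]
  · intro i _
    by_cases hi : z i ∈ A <;> simp [hi]

lemma continuous_pointCloud {ι : Type*} [Fintype ι] [TopologicalSpace X]
    [OpensMeasurableSpace X] : Continuous (fun z : ι → X => pointCloud z) := by
  unfold pointCloud
  refine continuous_finsetSum _ fun i _ => ?_
  exact ProbabilityMeasure.toFiniteMeasure_continuous.comp
    (continuous_diracProba.comp (continuous_apply i))

/-- The law of a Poisson number of independent points with distribution `κ`. -/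
noncomputable def poissonLaw (r : ℝ≥0) (κ : Measure X) : Measure (Σ k : ℕ, Fin k → X) :=
  Measure.sum fun k =>
    poissonMeasure r {k} • (Measure.pi fun _ : Fin k => κ).map fun y => ⟨k, y⟩

lemma measurable_sigmaMk (k : ℕ) :
    Measurable (fun y : Fin k → X => (⟨k, y⟩ : Σ k : ℕ, Fin k → X)) :=
  measurable_iff_le_map.2 (iInf_le _ k)

lemma measurable_of_sigma {β : Type*} [MeasurableSpace β] {f : (Σ k : ℕ, Fin k → X) → β}
    (hf : ∀ k, Measurable fun y : Fin k → X => f ⟨k, y⟩) : Measurable f := by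
  intro s hs
  refine MeasurableSpace.measurableSet_iInf.2 fun k => ?_
  exact hf k hs

variable {r : ℝ≥0} {κ : Measure X} [IsProbabilityMeasure κ]

instance isProbabilityMeasure_poissonLaw : IsProbabilityMeasure (poissonLaw r κ) := by
  constructor
  rw [poissonLaw, Measure.sum_apply _ MeasurableSet.univ]
  have h : ∀ k, (poissonMeasure r {k} •
      (Measure.pi fun _ : Fin k => κ).map (fun y => (⟨k, y⟩ : Σ k : ℕ, Fin k → X))) univ = poissonMeasure r {k} := by
    intro k
    rw [Measure.smul_apply, Measure.map_apply (measurable_sigmaMk k) MeasurableSet.univ]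
    simp
  simp_rw [h]
  rw [← measure_iUnion₀]
  · rw [iUnion_of_singleton]
    simp
  · intro i j hij
    exact (disjoint_singleton.2 hij).aedisjoint
  · intro i
    exact (measurableSet_singleton i).nullMeasurableSet

lemma integral_poissonLaw {F : Type*} [NormedAddCommGroup F] [NormedSpace ℝ F]
    [MeasurableSpace F] [BorelSpace F] [SecondCountableTopology F]
    {f : (Σ k : ℕ, Fin k → X) → F} {C : ℝ} (hC : ∀ ω, ‖f ω‖ ≤ C)
    (hf : ∀ k, Measurable fun y : Fin k → X => f ⟨k, y⟩) :
    ∫ ω, f ω ∂(poissonLaw r κ) =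
      ∑' k : ℕ, (Real.exp (-r) * r ^ k / k.factorial) •
        ∫ y, f ⟨k, y⟩ ∂(Measure.pi fun _ : Fin k => κ) := by
  have hm : Measurable f := measurable_of_sigma hf
  have hi : Integrable f (poissonLaw r κ) :=
    Integrable.of_bound hm.aestronglyMeasurable C (ae_of_all _ hC)
  rw [poissonLaw] at hi ⊢
  rw [integral_sum_measure hi]
  refine tsum_congr fun k => ?_
  rw [integral_smul_measure, integral_map (measurable_sigmaMk k).aemeasurable
    hm.aestronglyMeasurable, ← measureReal_def, poissonMeasure_real_singleton]

lemma measurable_pointCloud_apply {ι : Type*} [Fintype ι] {A : Set X} (hA : MeasurableSet A) :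
    Measurable fun z : ι → X => (pointCloud z A : ℝ) := by
  simp_rw [pointCloud_apply _ hA]
  refine Finset.measurable_sum _ fun i _ => ?_
  exact (measurable_const.indicator hA).comp (measurable_pi_apply i)

/-- A point lies in at most one `A i`, so its contribution to the exponential is `1 + ∑ 1_{A i}
(e^{i t_i} - 1)`. Given `k` points the integral is a `k`-th power, and the Poisson weights sum these
powers to an exponential, which splits into a product over the sets. This one formula yields both
the Poisson laws of the counts and their independence. -/
lemma integral_exp_pointCloud {ι : Type*} [Fintype ι] (A : ι → Set X)
    (hA : ∀ i, MeasurableSet (A i)) (hd : Pairwise fun i j => Disjoint (A i) (A j)) (t : ι → ℝ) :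
    ∫ ω, Complex.exp ((∑ i, (pointCloud ω.2 (A i) : ℝ) * t i : ℝ) * Complex.I)
        ∂(poissonLaw r κ) =
      ∏ i, Complex.exp ((r * κ.real (A i) : ℝ) * (Complex.exp (t i * Complex.I) - 1)) := by
  classical
  set h : X → ℂ := fun y =>
    Complex.exp ((∑ i, (A i).indicator (fun _ => (1 : ℝ)) y * t i : ℝ) * Complex.I) with hh
  have h1 : ∀ y, h y = 1 + ∑ i, (A i).indicator (fun _ => Complex.exp (t i * Complex.I) - 1) y := by
    intro y
    by_cases hy : ∃ i, y ∈ A i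
    · obtain ⟨i, hi⟩ := hy
      have hne : ∀ j, j ≠ i → y ∉ A j := fun j hj hyj =>
        disjoint_left.1 (hd hj) hyj hi
      rw [hh]
      simp only
      rw [Finset.sum_eq_single i, Finset.sum_eq_single i]
      · simp [hi]
      · intro j _ hj; simp [hne j hj]
      · simp
      · intro j _ hj; simp [hne j hj]
      · simp
    · push Not at hy
      simp [hh, hy]
  have hint : ∫ y, h y ∂κ = 1 + ∑ i, (κ.real (A i) : ℂ) * (Complex.exp (t i * Complex.I) - 1) := by
    simp_rw [h1]
    rw [integral_add (integrable_const _), integral_finsetSum]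
    · congr 1
      · simp
      · refine Finset.sum_congr rfl fun i _ => ?_
        rw [integral_indicator_const _ (hA i)]
        simp
    · intro i _
      exact (integrable_const _).indicator (hA i)
    · exact integrable_finsetSum _ fun i _ => (integrable_const _).indicator (hA i)
  have hprod : ∀ k : ℕ, ∀ y : Fin k → X,
      Complex.exp ((∑ i, (pointCloud y (A i) : ℝ) * t i : ℝ) * Complex.I) = ∏ j, h (y j) := by
    intro k y
    rw [hh]
    simp only
    rw [← Complex.exp_sum, ← Finset.sum_mul, ← Complex.ofReal_sum, Finset.sum_comm]
    simp_rw [pointCloud_apply y (hA _), Finset.sum_mul]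
  rw [integral_poissonLaw (C := 1)]
  · have hk : ∀ k : ℕ, ∫ y, Complex.exp ((∑ i, (pointCloud y (A i) : ℝ) * t i : ℝ) * Complex.I)
        ∂(Measure.pi fun _ : Fin k => κ) = (∫ y, h y ∂κ) ^ k := by
      intro k
      simp_rw [hprod]
      rw [integral_fintype_prod_eq_prod (𝕜 := ℂ) (fun _ => h)]
      simp
    simp_rw [hk]
    have hs := (NormedSpace.expSeries_div_hasSum_exp ((r : ℂ) * ∫ y, h y ∂κ)).mul_left
      (Complex.exp (-r))
    rw [← Complex.exp_eq_exp_ℂ, ← Complex.exp_add] at hs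
    have hs2 := hs.tsum_eq
    calc _ = ∑' k : ℕ, Complex.exp (-r) * (((r : ℂ) * ∫ y, h y ∂κ) ^ k / k.factorial) := by
          refine tsum_congr fun k => ?_
          rw [Complex.real_smul]
          push_cast
          rw [mul_pow]
          ring
      _ = _ := by
          rw [hs2, hint, ← Complex.exp_sum]
          congr 1
          push_cast
          rw [mul_add, Finset.mul_sum, mul_one, neg_add_cancel_left]
          exact Finset.sum_congr rfl fun i _ => (mul_assoc _ _ _).symm
  · intro ω
    rw [Complex.norm_exp_ofReal_mul_I]
  · intro k
    refine Complex.measurable_exp.comp (Measurable.mul_const ?_ _)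
    refine Complex.measurable_ofReal.comp (Finset.measurable_sum _ fun i _ => ?_)
    exact (measurable_pointCloud_apply (hA i)).mul_const _

lemma map_poissonLaw {A : Set X} (hA : MeasurableSet A) :
    (poissonLaw r κ).map (fun ω => (pointCloud ω.2 A : ℝ)) =
      (poissonMeasure (r * (κ A).toNNReal)).map (fun k : ℕ => (k : ℝ)) := by
  have hm : Measurable fun ω : (Σ k : ℕ, Fin k → X) => (pointCloud ω.2 A : ℝ) :=
    measurable_of_sigma fun k => measurable_pointCloud_apply hA
  have := Measure.isProbabilityMeasure_map (μ := poissonLaw r κ) hm.aemeasurable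
  refine Measure.ext_of_charFun ?_
  ext t
  rw [charFun_map_cast_poissonMeasure, charFun_apply, integral_map hm.aemeasurable (by fun_prop)]
  have h := integral_exp_pointCloud (r := r) (κ := κ) (fun _ : Unit => A) (fun _ => hA)
    (fun i j h => absurd (Subsingleton.elim i j) h) (fun _ => t)
  simp only [Finset.univ_unique, Finset.sum_const, Finset.card_singleton, one_smul,
    Finset.prod_const, pow_one] at h
  convert h using 4
  · rw [Real.inner_apply]
  · push_cast
    congr 1

lemma iIndepFun_poissonLaw {k : ℕ} (A : Fin k → Set X)
    (hA : ∀ i, MeasurableSet (A i)) (hd : Pairwise fun i j => Disjoint (A i) (A j)) :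
    iIndepFun (fun i (ω : Σ k : ℕ, Fin k → X) => (pointCloud ω.2 (A i) : ℝ))
      (poissonLaw r κ) := by
  have hm : ∀ i, Measurable fun ω : (Σ k : ℕ, Fin k → X) => (pointCloud ω.2 (A i) : ℝ) :=
    fun i => measurable_of_sigma fun k => measurable_pointCloud_apply (hA i)
  rw [iIndepFun_iff_charFun_pi fun i => (hm i).aemeasurable]
  intro t
  have hm2 : Measurable fun ω : (Σ k : ℕ, Fin k → X) =>
      WithLp.toLp 2 (fun i => (pointCloud ω.2 (A i) : ℝ)) :=
    (WithLp.measurable_toLp 2 _).comp (measurable_pi_iff.2 hm)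
  rw [charFun_apply, integral_map hm2.aemeasurable (by fun_prop)]
  have h := integral_exp_pointCloud (r := r) (κ := κ) A hA hd (fun i => t i)
  convert h using 1
  · congr with ω
    congr 3
    rw [PiLp.inner_apply]
    refine Finset.sum_congr rfl fun i _ => ?_
    rw [Real.inner_apply]
  · refine Finset.prod_congr rfl fun i _ => ?_
    rw [map_poissonLaw (hA i), charFun_map_cast_poissonMeasure]
    push_cast
    congr 1

end PoissonProcess

lemma isPoissonProcess_poissonLaw {d : ℕ} {r : ℝ≥0}
    {κ : Measure (EuclideanSpace ℝ (Fin d))} [IsProbabilityMeasure κ] :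
    IsPoissonProcess (poissonLaw r κ) (fun ω => pointCloud ω.2) (r • κ) := by
  have hm : ∀ A : Set (EuclideanSpace ℝ (Fin d)), MeasurableSet A →
      Measurable fun ω : (Σ k : ℕ, Fin k → EuclideanSpace ℝ (Fin d)) => pointCloud ω.2 A := by
    intro A hA
    have h : Measurable fun ω : (Σ k : ℕ, Fin k → EuclideanSpace ℝ (Fin d)) =>
        (pointCloud ω.2 A : ℝ) := measurable_of_sigma fun k => measurable_pointCloud_apply hA
    simpa only [Real.toNNReal_coe] using h.real_toNNReal
  refine ⟨?_, hm, ?_, ?_⟩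
  · simp
  · intro A hA
    have h := map_poissonLaw (r := r) (κ := κ) hA
    have h2 := congrArg (Measure.map Real.toNNReal) h
    rw [Measure.map_map measurable_real_toNNReal (measurable_of_sigma fun k =>
      measurable_pointCloud_apply hA), Measure.map_map measurable_real_toNNReal (by fun_prop)] at h2
    convert h2 using 2
    · ext ω
      simp only [Function.comp_apply, Real.toNNReal_coe]
    · ext n
      simp
    · simp
  · intro k A hA hd
    have h := iIndepFun_poissonLaw (r := r) (κ := κ) A hA hd
    convert h.comp (fun _ => Real.toNNReal) (fun _ => measurable_real_toNNReal) using 2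
    ext ω
    simp only [Function.comp_apply, Real.toNNReal_coe]

/-! ### Binomial clouds and their Poisson limits -/

section Binomial

variable {X : Type} [MeasurableSpace X]

lemma Measure.pi_nnreal_smul {k : ℕ} (c : ℝ≥0) (κ : Measure X) [IsFiniteMeasure κ] :
    Measure.pi (fun _ : Fin k => c • κ) = c ^ k • Measure.pi (fun _ : Fin k => κ) := by
  refine Measure.pi_eq fun s _ => ?_
  simp only [Measure.smul_apply, Measure.pi_pi, ENNReal.smul_def, smul_eq_mul,
    Finset.prod_mul_distrib, Finset.prod_const, Finset.card_univ, Fintype.card_fin,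
    ENNReal.coe_pow]

lemma integral_pi_subtype {n : ℕ} (s : Finset (Fin n)) (μ ν : Measure X) [IsFiniteMeasure μ]
    [IsFiniteMeasure ν] (g : ({i // i ∈ s} → X) → ℝ) :
    ∫ z, g (fun i => z i) ∂(Measure.pi fun i : Fin n => if i ∈ s then μ else ν) =
      ν.real univ ^ (n - s.card) * ∫ z, g z ∂(Measure.pi fun _ : {i // i ∈ s} => μ) := by
  classical
  have hfin : ∀ i : Fin n, IsFiniteMeasure (if i ∈ s then μ else ν) := by
    intro i; split_ifs <;> infer_instance
  have hmp := measurePreserving_piEquivPiSubtypeProd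
    (fun i : Fin n => if i ∈ s then μ else ν) (fun i => i ∈ s)
  have h1 := hmp.integral_comp (MeasurableEquiv.measurableEmbedding _)
    (fun p : ({i // i ∈ s} → X) × ({i // i ∉ s} → X) => g p.1)
  rw [integral_fun_fst] at h1
  have h2 : ∀ i : {i // i ∈ s}, (if (i : Fin n) ∈ s then μ else ν) = μ := fun i => if_pos i.2
  have h3 : ∀ i : {i // i ∉ s}, (if (i : Fin n) ∈ s then μ else ν) = ν := fun i => if_neg i.2
  simp_rw [h2, h3] at h1
  refine h1.trans ?_
  rw [smul_eq_mul]
  congr 1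
  swap
  · congr!
  rw [measureReal_def, Measure.pi_univ, ENNReal.toReal_prod, Finset.prod_const, measureReal_def]
  congr 1
  rw [Finset.card_univ, Fintype.card_subtype_compl, Fintype.card_fin, Fintype.card_coe]

/-- The integral of a symmetric functional of the points of a sample falling in `A`. -/
lemma integral_sample_restrict {π : Measure X} [IsProbabilityMeasure π] {A : Set X}
    (hA : MeasurableSet A) {Φ : FiniteMeasure X → ℝ} {C : ℝ} (hC : ∀ m, ‖Φ m‖ ≤ C)
    (hΦ : ∀ (ι : Type) [Fintype ι], Measurable fun z : ι → X => Φ (pointCloud z)) (n : ℕ) :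
    ∫ z, Φ ((pointCloud z).restrict A) ∂(Measure.pi fun _ : Fin n => π) =
      ∑ k ∈ Finset.range (n + 1), (n.choose k : ℝ) * ((1 - π.real A) ^ (n - k) *
        ∫ z, Φ (pointCloud z) ∂(Measure.pi fun _ : Fin k => π.restrict A)) := by
  classical
  -- The sample space is partitioned by the set `s` of indices whose points fall in `A`. On `D s`
  -- the restricted cloud depends only on the coordinates in `s`; the others contribute the power of
  -- `1 - π A`, and the integral depends on `s` only through its cardinality.
  set D : Finset (Fin n) → Set (Fin n → X) := fun s =>
    univ.pi fun i => if i ∈ s then A else Aᶜ with hD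
  have hDm : ∀ s, MeasurableSet (D s) := fun s => MeasurableSet.univ_pi fun i => by
    split_ifs
    exacts [hA, hA.compl]
  have hmem : ∀ s z, z ∈ D s ↔ ∀ i, (z i ∈ A ↔ i ∈ s) := by
    intro s z
    simp only [hD, mem_univ_pi]
    refine forall_congr' fun i => ?_
    split_ifs with h <;> simp [h]
  have hU : ⋃ s, D s = univ := by
    refine eq_univ_of_forall fun z => mem_iUnion.2 ⟨Finset.univ.filter fun i => z i ∈ A, ?_⟩
    rw [hmem]
    simp
  have hdis : Pairwise (Function.onFun Disjoint D) := by
    intro s t hst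
    refine disjoint_left.2 fun z hz hz' => hst ?_
    ext i
    rw [← (hmem s z).1 hz i, (hmem t z).1 hz' i]
  have hval : ∀ s, ∀ z ∈ D s, Φ ((pointCloud z).restrict A) =
      Φ (pointCloud fun i : {i // i ∈ s} => z i) := by
    intro s z hz
    congr 1
    refine FiniteMeasure.eq_of_forall_toMeasure_apply_eq _ _ fun B hB => ?_
    rw [FiniteMeasure.restrict_measure_eq, Measure.restrict_apply hB, pointCloud, pointCloud,
      FiniteMeasure.toMeasure_sum, FiniteMeasure.toMeasure_sum, Measure.finsetSum_apply,
      Measure.finsetSum_apply, Finset.sum_coe_sort s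
        (fun i => ((diracProba (z i)).toFiniteMeasure : Measure X) B),
      ← Finset.sum_subset (Finset.subset_univ s)]
    · refine Finset.sum_congr rfl fun i hi => ?_
      have hzi : z i ∈ A := ((hmem s z).1 hz i).2 hi
      change Measure.dirac (z i) (B ∩ A) = Measure.dirac (z i) B
      rw [Measure.dirac_apply' _ (hB.inter hA), Measure.dirac_apply' _ hB]
      by_cases h : z i ∈ B <;> simp [h, hzi]
    · intro i _ hi
      have hzi : z i ∉ A := fun h => hi (((hmem s z).1 hz i).1 h)
      change Measure.dirac (z i) (B ∩ A) = 0
      rw [Measure.dirac_apply' _ (hB.inter hA)]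
      simp [hzi]
  have hmeas : ∀ s : Finset (Fin n), Measurable fun z : Fin n → X =>
      Φ (pointCloud fun i : {i // i ∈ s} => z i) := fun s =>
    (hΦ {i // i ∈ s}).comp (measurable_pi_iff.2 fun i => measurable_pi_apply _)
  have hint : ∀ s, IntegrableOn (fun z => Φ ((pointCloud z).restrict A)) (D s)
      (Measure.pi fun _ : Fin n => π) := by
    intro s
    refine IntegrableOn.congr_fun (f := fun z : Fin n → X =>
      Φ (pointCloud fun i : {i // i ∈ s} => z i)) ?_ (fun z hz => (hval s z hz).symm) (hDm s)
    exact Integrable.of_bound (hmeas s).aestronglyMeasurable C (ae_of_all _ fun z => hC _)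
  have hcompl : (π.restrict Aᶜ).real univ = 1 - π.real A := by
    rw [measureReal_restrict_apply_univ, probReal_compl_eq_one_sub hA]
  have hterm : ∀ s : Finset (Fin n),
      ∫ z in D s, Φ ((pointCloud z).restrict A) ∂(Measure.pi fun _ : Fin n => π) =
      (1 - π.real A) ^ (n - s.card) *
        ∫ z, Φ (pointCloud z) ∂(Measure.pi fun _ : Fin s.card => π.restrict A) := by
    intro s
    rw [setIntegral_congr_fun (hDm s) (hval s), hD]
    simp only
    rw [Measure.restrict_pi_pi]
    have : ∀ i : Fin n, π.restrict (if i ∈ s then A else Aᶜ) =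
        if i ∈ s then π.restrict A else π.restrict Aᶜ := by
      intro i; split_ifs <;> rfl
    simp_rw [this]
    rw [integral_pi_subtype s (π.restrict A) (π.restrict Aᶜ) (fun z => Φ (pointCloud z)), hcompl]
    congr 1
    have hmp := measurePreserving_piCongrLeft (α := fun _ : {i // i ∈ s} => X)
      (fun _ => π.restrict A) s.equivFin.symm
    rw [← hmp.integral_comp (MeasurableEquiv.measurableEmbedding _)]
    refine integral_congr_ae (ae_of_all _ fun z => ?_)
    simp only
    congr 1
    rw [pointCloud, pointCloud, ← Equiv.sum_comp s.equivFin.symm]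
    refine Finset.sum_congr rfl fun j _ => ?_
    rw [MeasurableEquiv.coe_piCongrLeft, Equiv.piCongrLeft_apply_apply]
  rw [← setIntegral_univ, ← hU, integral_iUnion_fintype hDm hdis hint]
  simp_rw [hterm]
  have h := Finset.sum_powerset_apply_card (x := (Finset.univ : Finset (Fin n)))
    (fun k => (1 - π.real A) ^ (n - k) *
        ∫ z, Φ (pointCloud z) ∂(Measure.pi fun _ : Fin k => π.restrict A))
  rw [Finset.powerset_univ, Finset.card_univ, Fintype.card_fin] at h
  rw [h]
  refine Finset.sum_congr rfl fun k _ => ?_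
  rw [nsmul_eq_mul]

variable [TopologicalSpace X] [SecondCountableTopology X]
  [TopologicalSpace.PseudoMetrizableSpace X] [BorelSpace X]

/-- The clouds formed by the points in `A` of samples from `π n` converge in distribution to
a Poisson cloud if the mean measures converge weakly. -/
theorem tendsto_integral_cloud {π : ℕ → Measure X} [∀ n, IsProbabilityMeasure (π n)] {A : Set X}
    (hA : MeasurableSet A) {σ : FiniteMeasure X} [Nonempty X] (hσ : σ ≠ 0)
    (h : ∀ φ : X →ᵇ ℝ, Tendsto (fun n : ℕ => (n : ℝ) * ∫ x in A, φ x ∂(π n)) atTop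
      (𝓝 (∫ x, φ x ∂(σ : Measure X)))) (Φ : FiniteMeasure X →ᵇ ℝ) :
    Tendsto (fun n : ℕ => ∫ z, Φ ((pointCloud z).restrict A) ∂(Measure.pi fun _ : Fin n => π n))
      atTop (𝓝 (∫ ω, Φ (pointCloud ω.2) ∂(poissonLaw σ.mass (σ.normalize : Measure X)))) := by
  obtain ⟨ν, hν⟩ : ∃ ν : ℕ → FiniteMeasure X, ∀ n, (ν n : Measure X) = (π n).restrict A :=
    ⟨fun n => ⟨(π n).restrict A, inferInstance⟩, fun n => rfl⟩
  set m : ℕ → FiniteMeasure X := fun n => (n : ℝ≥0) • ν n with hm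
  have hmσ : Tendsto m atTop (𝓝 σ) := by
    rw [FiniteMeasure.tendsto_iff_forall_integral_tendsto]
    intro φ
    refine (h φ).congr fun n => ?_
    rw [hm]
    simp only [FiniteMeasure.toMeasure_smul]
    rw [hν, integral_smul_nnreal_measure]
    rfl
  set κ : ℕ → ProbabilityMeasure X := fun n => (m n).normalize
  have hκ : Tendsto κ atTop (𝓝 σ.normalize) := FiniteMeasure.tendsto_normalize_of_tendsto hmσ hσ
  set q : ℕ → ℝ := fun n => (π n).real A with hq
  have hmass : Tendsto (fun n => ((m n).mass : ℝ)) atTop (𝓝 σ.mass) :=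
    (NNReal.continuous_coe.tendsto _).comp (hmσ.mass)
  have hmq : ∀ n, ((m n).mass : ℝ) = n * q n := by
    intro n
    have h1 : (ν n).mass = (q n).toNNReal := by
      rw [FiniteMeasure.mass, FiniteMeasure.coeFn_def]
      simp only [hν, Measure.restrict_apply_univ, hq, measureReal_def]
      exact (ENNReal.toNNReal_toReal_eq _).symm
    rw [hm]
    simp only
    rw [FiniteMeasure.mass, FiniteMeasure.smul_apply]
    change ((n : ℝ≥0) • (ν n).mass : ℝ≥0) = (n : ℝ) * q n
    rw [h1]
    simp [hq]
  have hnq : Tendsto (fun n : ℕ => (n : ℝ) * q n) atTop (𝓝 σ.mass) := by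
    refine hmass.congr hmq
  -- Since `κ n` normalises `n • π n|_A`, the case `n = 0` must be left out. Factoring out `q n`
  -- turns the `k`-th term into a binomial weight times an expectation over `k` independent points
  -- from `κ n`.
  have hrestr : ∀ n : ℕ, n ≠ 0 → (π n).restrict A = (q n).toNNReal • (κ n : Measure X) := by
    intro n hn
    have h1 := congrArg (fun μ : FiniteMeasure X => (μ : Measure X))
      (FiniteMeasure.self_eq_mass_smul_normalize (m n))
    simp only [FiniteMeasure.toMeasure_smul, hm, hν] at h1
    have h2 : (m n).mass = n * (q n).toNNReal := by
      apply NNReal.coe_injective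
      rw [hmq n]
      simp [hq]
    rw [show ((n : ℝ≥0) • ν n).mass = n * (q n).toNNReal from h2, mul_smul] at h1
    have hn' : (n : ℝ≥0) ≠ 0 := by exact_mod_cast hn
    have h3 := congrArg (fun μ => (n : ℝ≥0)⁻¹ • μ) h1
    simp only [smul_smul, ← mul_assoc, inv_mul_cancel₀ hn', one_smul, one_mul] at h3
    exact h3
  set J : ℕ → ℕ → ℝ := fun n k =>
    ∫ z, Φ (pointCloud z) ∂(Measure.pi fun _ : Fin k => (κ n : Measure X)) with hJ
  have hcont : ∀ (ι : Type) [Fintype ι], Continuous fun z : ι → X => Φ (pointCloud z) :=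
    fun ι _ => Φ.continuous.comp continuous_pointCloud
  have hJlim : ∀ k, Tendsto (fun n => J n k) atTop
      (𝓝 (∫ z, Φ (pointCloud z) ∂(Measure.pi fun _ : Fin k => (σ.normalize : Measure X)))) := by
    intro k
    have hpi : Tendsto (fun n => ProbabilityMeasure.pi fun _ : Fin k => κ n) atTop
        (𝓝 (ProbabilityMeasure.pi fun _ : Fin k => σ.normalize)) :=
      (ProbabilityMeasure.continuous_pi.tendsto _).comp (tendsto_pi_nhds.2 fun _ => hκ)
    rw [ProbabilityMeasure.tendsto_iff_forall_integral_tendsto] at hpi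
    exact hpi (Φ.compContinuous ⟨_, continuous_pointCloud⟩)
  have hJb : ∀ n k, |J n k| ≤ ‖Φ‖ := by
    intro n k
    refine (norm_integral_le_of_norm_le_const (ae_of_all _ fun z => Φ.norm_coe_le_norm _)).trans ?_
    simp
  have hq0 : ∀ n, 0 ≤ q n := fun n => measureReal_nonneg
  have hq1 : ∀ n, q n ≤ 1 := fun n => measureReal_le_one
  set T : ℕ → ℕ → ℝ := fun n k => (n.choose k : ℝ) * q n ^ k * (1 - q n) ^ (n - k) * J n k with hT
  have hexp : ∀ n : ℕ, n ≠ 0 →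
      ∫ z, Φ ((pointCloud z).restrict A) ∂(Measure.pi fun _ : Fin n => π n) = ∑' k, T n k := by
    intro n hn
    rw [integral_sample_restrict hA Φ.norm_coe_le_norm (fun ι _ => (hcont ι).measurable) n,
      tsum_eq_sum (s := Finset.range (n + 1))]
    · refine Finset.sum_congr rfl fun k _ => ?_
      rw [hrestr n hn, Measure.pi_nnreal_smul, integral_smul_nnreal_measure, hT, hJ]
      simp only [NNReal.smul_def, smul_eq_mul, NNReal.coe_pow, Real.coe_toNNReal _ (hq0 n)]
      ring
    · intro k hk
      rw [Finset.mem_range, not_lt] at hk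
      rw [hT]
      simp only
      rw [Nat.choose_eq_zero_of_lt (by omega)]
      simp
  obtain ⟨M, hM⟩ : ∃ M : ℝ, ∀ᶠ n : ℕ in atTop, (n : ℝ) * q n ≤ M :=
    ⟨σ.mass + 1, (hnq.eventually (gt_mem_nhds (lt_add_one _))).mono fun n hn => hn.le⟩
  have hlim : Tendsto (fun n => ∑' k, T n k) atTop (𝓝 (∑' k : ℕ,
      (Real.exp (-(σ.mass : ℝ)) * (σ.mass : ℝ) ^ k / k.factorial) *
        ∫ z, Φ (pointCloud z) ∂(Measure.pi fun _ : Fin k => (σ.normalize : Measure X)))) := by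
    -- Binomial weights are at most `(n q_n)ᵏ / k!`, and `n q_n` is eventually bounded by `M`, so an
    -- exponential series dominates.
    refine tendsto_tsum_of_dominated_convergence
      (bound := fun k => M ^ k / k.factorial * ‖Φ‖) ?_ ?_ ?_
    · exact (Real.summable_pow_div_factorial M).mul_right _
    · intro k
      exact (tendsto_choose_mul_pow_of_tendsto_mul_atTop k hnq).mul (hJlim k)
    · filter_upwards [hM] with n hn k
      rw [hT]
      simp only [norm_mul, Real.norm_eq_abs]
      have h1 : |((n.choose k : ℕ) : ℝ)| * |q n ^ k| ≤ M ^ k / k.factorial := by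
        rw [abs_of_nonneg (by positivity), abs_of_nonneg (pow_nonneg (hq0 n) k)]
        calc _ ≤ (n : ℝ) ^ k / k.factorial * q n ^ k := by
              gcongr
              exact Nat.choose_le_pow_div k n
          _ = (n * q n) ^ k / k.factorial := by rw [mul_pow]; ring
          _ ≤ M ^ k / k.factorial := by
              gcongr
      have h2 : |(1 - q n) ^ (n - k)| ≤ 1 := by
        rw [abs_of_nonneg (pow_nonneg (by linarith [hq1 n]) _)]
        exact pow_le_one₀ (by linarith [hq1 n]) (by linarith [hq0 n])
      have h3 : 0 ≤ M ^ k / (k.factorial : ℝ) := le_trans (by positivity) h1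
      calc _ ≤ M ^ k / k.factorial * 1 * ‖Φ‖ := by
            gcongr
            exact hJb n k
        _ = _ := by ring
  rw [integral_poissonLaw (C := ‖Φ‖) (fun ω => Φ.norm_coe_le_norm _)
    (fun k => (hcont (Fin k)).measurable)]
  simp only [smul_eq_mul]
  refine hlim.congr' ?_
  filter_upwards [eventually_ne_atTop 0] with n hn
  exact (hexp n hn).symm

end Binomial

/-! ### Numbers of sample points in a set -/

section Counting

variable {X : Type} [MeasurableSpace X] {μ : Measure X} [IsProbabilityMeasure μ]

lemma pi_exists_mem_le {A : Set X} (hA : MeasurableSet A) (n : ℕ) :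
    (Measure.pi fun _ : Fin n => μ) {z | ∃ i, z i ∈ A} ≤ n * μ A := by
  have h : {z : Fin n → X | ∃ i, z i ∈ A} = ⋃ i, (fun z : Fin n → X => z i) ⁻¹' A := by
    ext z; simp
  rw [h]
  refine (measure_iUnion_fintype_le _ _).trans ?_
  have h2 : ∀ i : Fin n,
      (Measure.pi fun _ : Fin n => μ) ((fun z : Fin n → X => z i) ⁻¹' A) = μ A := fun i =>
    (measurePreserving_eval (fun _ : Fin n => μ) i).measure_preimage hA.nullMeasurableSet
  simp [h2]

/-- Chernoff bound: Markov's inequality for `e^{-N}`, where `N` is the number of points in `A`. Each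
point contributes the factor `1 - μ(A)(1 - e⁻¹) ≤ exp (-μ(A)(1 - e⁻¹))`. -/
lemma pi_sum_indicator_le {A : Set X} (hA : MeasurableSet A) (n : ℕ) (m : ℝ) :
    (Measure.pi fun _ : Fin n => μ).real {z | ∑ i, A.indicator (fun _ => (1 : ℝ)) (z i) ≤ m} ≤
      Real.exp m * Real.exp (-(n * μ.real A * (1 - Real.exp (-1)))) := by
  set g : X → ℝ := fun y => Real.exp (-A.indicator (fun _ => (1 : ℝ)) y) with hg
  have hg1 : ∀ y, g y = 1 - A.indicator (fun _ => 1 - Real.exp (-1)) y := by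
    intro y
    by_cases hy : y ∈ A <;> simp [hg, hy]
  have hgm : Measurable g := Real.measurable_exp.comp (measurable_const.indicator hA).neg
  have hint : ∫ y, g y ∂μ = 1 - μ.real A * (1 - Real.exp (-1)) := by
    simp_rw [hg1]
    rw [integral_sub (integrable_const _) ((integrable_const _).indicator hA),
      integral_indicator_const _ hA]
    simp
  have hgle : ∀ y, ‖g y‖ ≤ 1 := by
    intro y
    rw [hg, Real.norm_eq_abs, abs_of_pos (Real.exp_pos _), Real.exp_le_one_iff, neg_nonpos]
    exact indicator_nonneg (fun _ _ => zero_le_one) _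
  have hprodm : Measurable fun z : Fin n → X => ∏ i, g (z i) :=
    Finset.measurable_prod _ fun i _ => hgm.comp (measurable_pi_apply i)
  have hI : Integrable (fun z : Fin n → X => ∏ i, g (z i)) (Measure.pi fun _ : Fin n => μ) := by
    refine Integrable.of_bound hprodm.aestronglyMeasurable 1 (ae_of_all _ fun z => ?_)
    rw [norm_prod]
    exact Finset.prod_le_one (fun _ _ => norm_nonneg _) fun i _ => hgle _
  have hpos : 0 ≤ᵐ[Measure.pi fun _ : Fin n => μ] fun z : Fin n → X => ∏ i, g (z i) :=
    ae_of_all _ fun z => Finset.prod_nonneg fun i _ => (Real.exp_pos _).le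
  have hM := mul_meas_ge_le_integral_of_nonneg hpos hI (Real.exp (-m))
  have hset : {z : Fin n → X | ∑ i, A.indicator (fun _ => (1 : ℝ)) (z i) ≤ m} =
      {z | Real.exp (-m) ≤ ∏ i, g (z i)} := by
    ext z
    simp only [mem_ofPred_eq, hg]
    rw [← Real.exp_sum, Real.exp_le_exp, Finset.sum_neg_distrib, neg_le_neg_iff]
  rw [integral_fintype_prod_eq_prod (𝕜 := ℝ) (fun _ => g), hint, Finset.prod_const,
    Finset.card_univ, Fintype.card_fin, ← hset] at hM
  have hp0 : 0 ≤ μ.real A := measureReal_nonneg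
  have hp1 : μ.real A ≤ 1 := measureReal_le_one
  have he : 0 < Real.exp (-1) := Real.exp_pos _
  have he1 : Real.exp (-1) < 1 := Real.exp_lt_one_iff.2 (by norm_num)
  have hpow : (1 - μ.real A * (1 - Real.exp (-1))) ^ n ≤
      Real.exp (-(n * μ.real A * (1 - Real.exp (-1)))) := by
    rw [show -(n * μ.real A * (1 - Real.exp (-1))) = n * (-(μ.real A * (1 - Real.exp (-1)))) by
      ring, Real.exp_nat_mul]
    refine pow_le_pow_left₀ (by nlinarith) ?_ n
    linarith [Real.add_one_le_exp (-(μ.real A * (1 - Real.exp (-1))))]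
  rw [Real.exp_neg, ← div_eq_inv_mul, div_le_iff₀' (Real.exp_pos m)] at hM
  exact hM.trans (mul_le_mul_of_nonneg_left hpow (Real.exp_pos m).le)

end Counting

lemma sampleCloud_eq_pointCloud {d n : ℕ} (a : ℝ) (z : Fin n → EuclideanSpace ℝ (Fin d)) :
    sampleCloud a z = pointCloud fun i => a⁻¹ • z i := rfl

section SampleCounting

variable {d : ℕ} {μ : Measure (EuclideanSpace ℝ (Fin d))} [IsProbabilityMeasure μ]

lemma tendsto_sampleLaw_zero {b : ℕ → ℝ} {A : Set (EuclideanSpace ℝ (Fin d))}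
    (hA : MeasurableSet A)
    (h : Tendsto (fun n : ℕ => n * μ.real {z | (b n)⁻¹ • z ∈ A}) atTop (𝓝 0)) :
    Tendsto (fun n : ℕ => sampleLaw μ n {x | 0 < sampleCloud (b n) x A}) atTop (𝓝 0) := by
  have h2 : Tendsto (fun n : ℕ => ENNReal.ofReal (n * μ.real {z | (b n)⁻¹ • z ∈ A}))
      atTop (𝓝 0) := by
    simpa using ENNReal.tendsto_ofReal h
  refine tendsto_of_tendsto_of_tendsto_of_le_of_le tendsto_const_nhds h2
    (fun n => bot_le) fun n => ?_
  have hm : Measurable fun z : EuclideanSpace ℝ (Fin d) => (b n)⁻¹ • z := by fun_prop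
  have hle : sampleLaw μ n {x | 0 < sampleCloud (b n) x A} ≤
      (Measure.pi fun _ : Fin n => μ) {z | ∃ i, z i ∈ {z | (b n)⁻¹ • z ∈ A}} := by
    refine measure_mono fun z hz => ?_
    by_contra hcon
    simp only [mem_ofPred_eq, not_exists] at hcon hz
    have h0 : ((sampleCloud (b n) z A : ℝ≥0) : ℝ) = 0 := by
      rw [sampleCloud_eq_pointCloud, pointCloud_apply _ hA]
      exact Finset.sum_eq_zero fun i _ => indicator_of_notMem (hcon i) _
    rw [NNReal.coe_eq_zero] at h0
    exact absurd h0 hz.ne'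
  refine hle.trans ((pi_exists_mem_le (hm hA) n).trans ?_)
  rw [ENNReal.ofReal_mul (by positivity), ENNReal.ofReal_natCast, ofReal_measureReal]
  rfl

lemma tendsto_sampleLaw_one {b : ℕ → ℝ} {A : Set (EuclideanSpace ℝ (Fin d))}
    (hA : MeasurableSet A)
    (h : Tendsto (fun n : ℕ => n * μ.real {z | (b n)⁻¹ • z ∈ A}) atTop atTop) (m : ℕ) :
    Tendsto (fun n : ℕ => sampleLaw μ n {x | (m : ℝ≥0) < sampleCloud (b n) x A})
      atTop (𝓝 1) := by
  have hm : ∀ n, MeasurableSet {z : EuclideanSpace ℝ (Fin d) | (b n)⁻¹ • z ∈ A} := fun n =>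
    (by fun_prop : Measurable fun z : EuclideanSpace ℝ (Fin d) => (b n)⁻¹ • z) hA
  set B : ∀ n : ℕ, Set (Fin n → EuclideanSpace ℝ (Fin d)) := fun n =>
    {x | (m : ℝ≥0) < sampleCloud (b n) x A} with hB
  have hBc : ∀ n, (B n)ᶜ = {z | ∑ i, {z : EuclideanSpace ℝ (Fin d) | (b n)⁻¹ • z ∈ A}.indicator
      (fun _ => (1 : ℝ)) (z i) ≤ m} := by
    intro n
    ext z
    simp only [hB, mem_compl_iff, mem_ofPred_eq, not_lt]
    rw [← NNReal.coe_le_coe, sampleCloud_eq_pointCloud, pointCloud_apply _ hA]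
    rfl
  have hmeas : ∀ n, MeasurableSet (B n) := by
    intro n
    rw [← MeasurableSet.compl_iff, hBc]
    refine measurableSet_le (Finset.measurable_sum _ fun i _ => ?_) measurable_const
    exact (measurable_const.indicator (hm n)).comp (measurable_pi_apply i)
  have hprob : ∀ n, IsProbabilityMeasure (sampleLaw μ n) := fun n => by
    unfold sampleLaw; infer_instance
  have hc : Tendsto (fun n => (sampleLaw μ n).real (B n)ᶜ) atTop (𝓝 0) := by
    have he1 : Real.exp (-1) < 1 := Real.exp_lt_one_iff.2 (by norm_num)
    have hlim : Tendsto (fun n : ℕ => Real.exp m *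
        Real.exp (-(n * μ.real {z | (b n)⁻¹ • z ∈ A} * (1 - Real.exp (-1))))) atTop (𝓝 0) := by
      rw [← mul_zero (Real.exp m)]
      refine Tendsto.const_mul _ (Real.tendsto_exp_neg_atTop_nhds_zero.comp ?_)
      exact h.atTop_mul_const (by linarith)
    refine tendsto_of_tendsto_of_tendsto_of_le_of_le tendsto_const_nhds hlim
      (fun n => measureReal_nonneg) fun n => ?_
    simp only [hBc]
    exact pi_sum_indicator_le (hm n) n m
  have h1 : Tendsto (fun n => (sampleLaw μ n).real (B n)) atTop (𝓝 1) := by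
    have := hc.const_sub 1
    rw [sub_zero] at this
    refine this.congr fun n => ?_
    rw [probReal_compl_eq_one_sub (hmeas n)]
    ring
  have h2 := ENNReal.tendsto_ofReal h1
  rw [ENNReal.ofReal_one] at h2
  refine h2.congr fun n => ?_
  rw [ofReal_measureReal]

end SampleCounting

/-! ### Symmetric distribution functions -/

/-- A continuous strictly increasing distribution function, symmetric about the origin. -/
structure IsSymmCDF (F : ℝ → ℝ) : Prop where
  continuous : Continuous F
  strictMono : StrictMono F
  tendsto_atTop : Tendsto F atTop (𝓝 1)
  symm : ∀ t, F (-t) = 1 - F t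

namespace IsSymmCDF

variable {F G : ℝ → ℝ}

lemma lt_one (hF : IsSymmCDF F) (t : ℝ) : F t < 1 :=
  (hF.strictMono (lt_add_one t)).trans_le
    (hF.strictMono.monotone.ge_of_tendsto hF.tendsto_atTop _)

lemma pos (hF : IsSymmCDF F) (t : ℝ) : 0 < F t := by
  have h := hF.lt_one (-t)
  rw [hF.symm] at h
  linarith

lemma apply_zero (hF : IsSymmCDF F) : F 0 = 1 / 2 := by
  have h := hF.symm 0
  rw [neg_zero] at h
  linarith

lemma tendsto_atBot (hF : IsSymmCDF F) : Tendsto F atBot (𝓝 0) := by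
  have h := (hF.tendsto_atTop.comp tendsto_neg_atBot_atTop).const_sub 1
  rw [sub_self] at h
  refine h.congr fun t => ?_
  rw [Function.comp_apply, hF.symm]
  ring

lemma exists_eq (hF : IsSymmCDF F) {p : ℝ} (h0 : 0 < p) (h1 : p < 1) : ∃ t, F t = p := by
  obtain ⟨a, ha⟩ := (hF.tendsto_atBot.eventually (gt_mem_nhds h0)).exists
  obtain ⟨b, hb⟩ := (hF.tendsto_atTop.eventually (lt_mem_nhds h1)).exists
  exact mem_range_of_exists_le_of_exists_ge hF.continuous ⟨a, ha.le⟩ ⟨b, hb.le⟩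

lemma quantile_apply (hF : IsSymmCDF F) (t : ℝ) : quantile F (F t) = t := by
  have : {s | F t ≤ F s} = Ici t := by
    ext s
    exact hF.strictMono.le_iff_le
  rw [quantile, this, csInf_Ici]

lemma apply_quantile (hF : IsSymmCDF F) {p : ℝ} (h0 : 0 < p) (h1 : p < 1) :
    F (quantile F p) = p := by
  obtain ⟨t, rfl⟩ := hF.exists_eq h0 h1
  rw [hF.quantile_apply]

lemma apply_metaComponent (hF : IsSymmCDF F) (hG : IsSymmCDF G) (s : ℝ) :
    F (metaComponent F G s) = G s :=
  hF.apply_quantile (hG.pos s) (hG.lt_one s)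

lemma metaComponent_le_iff (hF : IsSymmCDF F) (hG : IsSymmCDF G) {s t : ℝ} :
    metaComponent F G s ≤ t ↔ G s ≤ F t := by
  rw [← hF.strictMono.le_iff_le, hF.apply_metaComponent hG]

lemma lt_metaComponent_iff (hF : IsSymmCDF F) (hG : IsSymmCDF G) {s t : ℝ} :
    t < metaComponent F G s ↔ F t < G s := by
  rw [← hF.strictMono.lt_iff_lt, hF.apply_metaComponent hG]

lemma metaComponent_strictMono (hF : IsSymmCDF F) (hG : IsSymmCDF G) :
    StrictMono (metaComponent F G) := by
  intro s t hst
  rw [hF.lt_metaComponent_iff hG, hF.apply_metaComponent hG]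
  exact hG.strictMono hst

lemma metaComponent_metaComponent (hF : IsSymmCDF F) (hG : IsSymmCDF G) (t : ℝ) :
    metaComponent F G (metaComponent G F t) = t := by
  apply hF.strictMono.injective
  rw [hF.apply_metaComponent hG, hG.apply_metaComponent hF]

lemma metaComponent_neg (hF : IsSymmCDF F) (hG : IsSymmCDF G) (s : ℝ) :
    metaComponent F G (-s) = -metaComponent F G s := by
  apply hF.strictMono.injective
  rw [hF.apply_metaComponent hG, hF.symm, hF.apply_metaComponent hG, hG.symm]

lemma metaComponent_zero (hF : IsSymmCDF F) (hG : IsSymmCDF G) : metaComponent F G 0 = 0 := by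
  apply hF.strictMono.injective
  rw [hF.apply_metaComponent hG, hF.apply_zero, hG.apply_zero]

lemma abs_metaComponent (hF : IsSymmCDF F) (hG : IsSymmCDF G) (s : ℝ) :
    |metaComponent F G s| = metaComponent F G |s| := by
  have hmono := (hF.metaComponent_strictMono hG).monotone
  rcases le_total 0 s with h | h
  · rw [abs_of_nonneg h, abs_of_nonneg]
    rw [← hF.metaComponent_zero hG]
    exact hmono h
  · rw [abs_of_nonpos h, hF.metaComponent_neg hG, abs_of_nonpos]
    rw [← hF.metaComponent_zero hG]
    exact hmono h

lemma measurable_metaComponent (hF : IsSymmCDF F) (hG : IsSymmCDF G) :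
    Measurable (metaComponent F G) :=
  (hF.metaComponent_strictMono hG).monotone.measurable

end IsSymmCDF

lemma continuous_cdf {μ : Measure ℝ} [IsProbabilityMeasure μ] (h : ∀ a, μ {a} = 0) :
    Continuous (cdf μ) := by
  refine continuous_iff_continuousAt.2 fun a => ?_
  rw [(monotone_cdf μ).continuousAt_iff_leftLim_eq_rightLim, (cdf μ).rightLim_eq]
  have h1 := h a
  rw [← measure_cdf μ, StieltjesFunction.measure_singleton, ENNReal.ofReal_eq_zero] at h1
  exact le_antisymm ((monotone_cdf μ).leftLim_le le_rfl) (by linarith)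

lemma strictMono_cdf {μ : Measure ℝ} [IsProbabilityMeasure μ]
    (h : ∀ a b, a < b → μ (Ioc a b) ≠ 0) : StrictMono (cdf μ) := by
  intro a b hab
  have h1 := h a b hab
  rw [← measure_cdf μ, StieltjesFunction.measure_Ioc, Ne, ENNReal.ofReal_eq_zero] at h1
  linarith

lemma one_sub_cdf {μ : Measure ℝ} [IsProbabilityMeasure μ] (t : ℝ) :
    1 - cdf μ t = μ.real (Ioi t) := by
  rw [cdf_eq_real, ← probReal_compl_eq_one_sub measurableSet_Iic, compl_Iic]

lemma IsPosContDensity.isProbabilityMeasure {X : Type*} [MeasureSpace X] [TopologicalSpace X]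
    {f : X → ℝ} (hf : IsPosContDensity f) : IsProbabilityMeasure (densityLaw f) := by
  constructor
  rw [densityLaw, withDensity_apply _ MeasurableSet.univ, Measure.restrict_univ,
    ← ofReal_integral_eq_lintegral_ofReal hf.integrable (ae_of_all _ fun x => (hf.pos x).le),
    hf.integral_eq_one, ENNReal.ofReal_one]

lemma IsPosContDensity.isSymmCDF {f : ℝ → ℝ} (hf : IsPosContDensity f)
    (hs : ∀ t, f (-t) = f t) : IsSymmCDF (cdf (densityLaw f)) := by
  have := hf.isProbabilityMeasure
  have hat : ∀ a, densityLaw f {a} = 0 := fun a => by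
    rw [densityLaw, withDensity_apply _ (measurableSet_singleton a)]
    simp
  refine ⟨continuous_cdf hat, strictMono_cdf fun a b hab h0 => ?_, tendsto_cdf_atTop _,
    fun t => ?_⟩
  · rw [densityLaw, withDensity_apply _ measurableSet_Ioc,
      setLIntegral_eq_zero_iff measurableSet_Ioc hf.continuous.measurable.ennreal_ofReal] at h0
    have h1 : volume (Ioc a b) = 0 := by
      refine measure_mono_null (fun x hx => ?_) h0
      simp only [mem_compl_iff, mem_ofPred_eq]
      intro hcon
      exact absurd (ENNReal.ofReal_eq_zero.1 (hcon hx)) (not_le.2 (hf.pos x))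
    rw [Real.volume_Ioc, ENNReal.ofReal_eq_zero] at h1
    linarith
  · rw [one_sub_cdf, cdf_eq_real, measureReal_def, measureReal_def]
    congr 1
    rw [← measure_congr (Ioi_ae_eq_Ici' (hat t)).symm, densityLaw,
      withDensity_apply _ measurableSet_Iic, withDensity_apply _ measurableSet_Ici,
      ← (Measure.measurePreserving_neg (volume : Measure ℝ)).setLIntegral_comp_preimage
        measurableSet_Ici (hf.continuous.measurable.ennreal_ofReal)]
    simp [hs]

/-! ### The symmetric Pareto distribution -/

/-- The tail of the symmetric Pareto distribution. -/
noncomputable def paretoTail (lam t : ℝ) : ℝ := (2 ^ lam⁻¹ + |t|) ^ (-lam)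

/-- The symmetric Pareto distribution function. -/
noncomputable def paretoCDF (lam t : ℝ) : ℝ :=
  if 0 ≤ t then 1 - paretoTail lam t else paretoTail lam t

section Pareto

variable {lam : ℝ}

lemma two_rpow_pos (a : ℝ) : (0 : ℝ) < 2 ^ a := Real.rpow_pos_of_pos two_pos a

/-- This is the reason for the shift `2 ^ (1/λ)`: the two branches of `paretoCDF` meet at the value
`1/2`. -/
lemma paretoTail_zero (h : 0 < lam) : paretoTail lam 0 = 1 / 2 := by
  rw [paretoTail, abs_zero, add_zero, ← Real.rpow_mul two_pos.le]
  rw [show lam⁻¹ * -lam = -1 by field_simp, Real.rpow_neg_one]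
  norm_num

lemma paretoTail_lt (h : 0 < lam) {s t : ℝ} (hst : |s| < |t|) :
    paretoTail lam t < paretoTail lam s :=
  Real.rpow_lt_rpow_of_neg (add_pos_of_pos_of_nonneg (two_rpow_pos _) (abs_nonneg s))
    (by linarith) (by linarith)

lemma paretoTail_le_half (h : 0 < lam) (t : ℝ) : paretoTail lam t ≤ 1 / 2 := by
  rw [← paretoTail_zero h]
  rcases (abs_nonneg t).eq_or_lt with h0 | h0
  · rw [abs_eq_zero.1 h0.symm]
  · exact (paretoTail_lt h (by simpa using h0)).le

lemma continuous_paretoTail (lam : ℝ) : Continuous (paretoTail lam) := by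
  unfold paretoTail
  refine Continuous.rpow_const (by fun_prop) fun t => Or.inl ?_
  exact (add_pos_of_pos_of_nonneg (two_rpow_pos _) (abs_nonneg t)).ne'

lemma isSymmCDF_paretoCDF (h : 0 < lam) : IsSymmCDF (paretoCDF lam) := by
  refine ⟨?_, ?_, ?_, ?_⟩
  · unfold paretoCDF
    refine Continuous.if_le (continuous_const.sub (continuous_paretoTail lam))
      (continuous_paretoTail lam) continuous_const continuous_id fun t ht => ?_
    rw [← ht, paretoTail_zero h]
    norm_num
  · intro s t hst
    unfold paretoCDF
    have hs := paretoTail_le_half h s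
    have ht := paretoTail_le_half h t
    split_ifs with h1 h2 h2
    · have := paretoTail_lt h (s := s) (t := t)
        (by rwa [abs_of_nonneg h1, abs_of_nonneg (h1.trans hst.le)])
      linarith
    · linarith
    · push Not at h1
      have h3 : paretoTail lam s < 1 / 2 := by
        rw [← paretoTail_zero h]
        exact paretoTail_lt h (by simpa using h1.ne)
      linarith
    · push Not at h1 h2
      exact paretoTail_lt h (by rw [abs_of_neg h1, abs_of_neg h2]; linarith)
  · have h1 : Tendsto (paretoTail lam) atTop (𝓝 0) := by
      refine (tendsto_rpow_neg_atTop h).comp ?_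
      exact tendsto_atTop_add_const_left _ _ tendsto_abs_atTop_atTop
    have h2 := h1.const_sub 1
    rw [sub_zero] at h2
    refine h2.congr' ?_
    filter_upwards [eventually_ge_atTop 0] with t ht
    rw [paretoCDF, if_pos ht]
  · intro t
    have habs : paretoTail lam (-t) = paretoTail lam t := by rw [paretoTail, paretoTail, abs_neg]
    rcases lt_trichotomy t 0 with ht | rfl | ht
    · rw [paretoCDF, paretoCDF, if_pos (by linarith), if_neg (by linarith), habs]
    · rw [neg_zero, paretoCDF, if_pos le_rfl, paretoTail_zero h]
      norm_num
    · rw [paretoCDF, paretoCDF, if_neg (by linarith), if_pos ht.le, habs]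
      ring

lemma one_sub_paretoCDF {t : ℝ} (ht : 0 ≤ t) : 1 - paretoCDF lam t = (2 ^ lam⁻¹ + t) ^ (-lam) := by
  rw [paretoCDF, if_pos ht, paretoTail, abs_of_nonneg ht]
  ring

end Pareto

/-! ### Tails of light-tailed densities -/

/-- The exponent of the tail of a distribution function. -/
noncomputable def tailExponent (G : ℝ → ℝ) (s : ℝ) : ℝ := -Real.log (1 - G s)

lemma IsSymmCDF.tailExponent_strictMono {G : ℝ → ℝ} (hG : IsSymmCDF G) :
    StrictMono (tailExponent G) := by
  intro s t hst
  have := hG.strictMono hst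
  have := hG.lt_one t
  exact neg_lt_neg (Real.log_lt_log (by linarith) (by linarith))

lemma IsPosContDensity.one_sub_cdf_eq {f : ℝ → ℝ} (hf : IsPosContDensity f) (s : ℝ) :
    1 - cdf (densityLaw f) s = ∫ t in Ioi s, f t := by
  have := hf.isProbabilityMeasure
  rw [one_sub_cdf, measureReal_def, densityLaw, withDensity_apply _ measurableSet_Ioi,
    ← ofReal_integral_eq_lintegral_ofReal hf.integrable.integrableOn
      (ae_of_all _ fun x => (hf.pos x).le), ENNReal.toReal_ofReal]
  exact setIntegral_nonneg measurableSet_Ioi fun x _ => (hf.pos x).le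

section LightTail

variable {g ψ : ℝ → ℝ} {θ : ℝ}

lemma IsVonMisesExponent.exists_monotoneOn (hψ : IsVonMisesExponent ψ) :
    ∃ s₀, MonotoneOn ψ (Ioi s₀) := by
  obtain ⟨s₀, hs, hd⟩ := hψ.smooth
  refine ⟨s₀, (strictMonoOn_of_deriv_pos (convex_Ioi s₀) hs.continuousOn fun x hx => ?_).monotoneOn⟩
  rw [interior_Ioi] at hx
  exact hd x hx

lemma eventually_density_bounds
    (ha : Tendsto (fun s => g s / Real.exp (-ψ s)) atTop (𝓝 1)) :
    ∃ S, ∀ s, S ≤ s → g s ≤ 2 * Real.exp (-ψ s) ∧ Real.exp (-ψ s) ≤ 2 * g s := by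
  have h1 := (ha.eventually (gt_mem_nhds (show (1 : ℝ) < 2 by norm_num))).and
    (ha.eventually (lt_mem_nhds (show (1 / 2 : ℝ) < 1 by norm_num)))
  obtain ⟨S, hS⟩ := eventually_atTop.1 h1
  refine ⟨S, fun s hs => ?_⟩
  obtain ⟨h2, h3⟩ := hS s hs
  have he := Real.exp_pos (-ψ s)
  rw [div_lt_iff₀ he] at h2
  rw [lt_div_iff₀ he] at h3
  constructor <;> linarith

/-- The tail beyond `s` contains the mass of `(s, x s]`, on which `g ≥ e^{-ψ(x s)} / 2`. The length
`(x - 1) s` is at least `2` for large `s`, which cancels the factor `1/2`. -/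
lemma tailExponent_le (hg : IsPosContDensity g) (hψ : IsVonMisesExponent ψ)
    (ha : Tendsto (fun s => g s / Real.exp (-ψ s)) atTop (𝓝 1)) {x : ℝ} (hx : 1 < x) :
    ∀ᶠ s in atTop, tailExponent (cdf (densityLaw g)) s ≤ ψ (x * s) := by
  obtain ⟨s₀, hmono⟩ := hψ.exists_monotoneOn
  obtain ⟨S, hS⟩ := eventually_density_bounds ha
  filter_upwards [eventually_gt_atTop s₀, eventually_ge_atTop S, eventually_gt_atTop 0,
    eventually_ge_atTop (2 / (x - 1))] with s h1 h2 h3 h4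
  have hsx : s ≤ x * s := by nlinarith
  have hlow : ∀ t ∈ Ioc s (x * s), Real.exp (-ψ (x * s)) / 2 ≤ g t := by
    intro t ht
    have h5 := (hS t (h2.trans ht.1.le)).2
    have h6 : ψ t ≤ ψ (x * s) := hmono (h1.trans ht.1) (h1.trans_le hsx) ht.2
    have h7 : Real.exp (-ψ (x * s)) ≤ Real.exp (-ψ t) := Real.exp_le_exp.2 (by linarith)
    linarith
  have hT : Real.exp (-ψ (x * s)) ≤ 1 - cdf (densityLaw g) s := by
    rw [hg.one_sub_cdf_eq]
    calc Real.exp (-ψ (x * s)) ≤ (x * s - s) * (Real.exp (-ψ (x * s)) / 2) := by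
          have h8 : 2 ≤ x * s - s := by
            rw [div_le_iff₀ (by linarith)] at h4
            linarith
          nlinarith [Real.exp_pos (-ψ (x * s))]
      _ = ∫ t in Ioc s (x * s), Real.exp (-ψ (x * s)) / 2 := by
          rw [setIntegral_const, measureReal_def, Real.volume_Ioc,
            ENNReal.toReal_ofReal (by linarith), smul_eq_mul]
      _ ≤ ∫ t in Ioc s (x * s), g t :=
          setIntegral_mono_on (by simp) hg.integrable.integrableOn measurableSet_Ioc hlow
      _ ≤ ∫ t in Ioi s, g t :=
          setIntegral_mono_set hg.integrable.integrableOn (ae_of_all _ fun t => (hg.pos t).le)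
            (Ioc_subset_Ioi_self.eventuallyLE)
  have := Real.log_le_log (Real.exp_pos _) hT
  rw [Real.log_exp] at this
  rw [tailExponent]
  linarith

/-- The substitution `t ↦ x t` compares the tail beyond `x s` with the tail beyond `s`. Regular
variation gives `ψ (x t) ≥ (c + 1) ψ t`, hence `g (x t) ≤ 4 e^{-c ψ(s)} g t` for `t > s`, and the
integral of `g` is at most `1`. -/
lemma le_tailExponent (hg : IsPosContDensity g) (hψ : IsVonMisesExponent ψ)
    (ha : Tendsto (fun s => g s / Real.exp (-ψ s)) atTop (𝓝 1)) (hrv : RegularlyVarying ψ θ)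
    {x : ℝ} (hx : 0 < x) {c : ℝ} (hc0 : 0 ≤ c) (hc : c < x ^ θ - 1) :
    ∀ᶠ s in atTop, c * ψ s - Real.log (4 * x) ≤
      tailExponent (cdf (densityLaw g)) (x * s) := by
  have hprob := hg.isProbabilityMeasure
  obtain ⟨s₀, hmono⟩ := hψ.exists_monotoneOn
  obtain ⟨S, hS⟩ := eventually_density_bounds ha
  have hratio : ∀ᶠ s in atTop, (c + 1) * ψ s ≤ ψ (x * s) := by
    filter_upwards [(hrv x hx).eventually (lt_mem_nhds (show c + 1 < x ^ θ by linarith)),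
      hψ.tendsto.eventually_gt_atTop 0] with s h1 h2
    exact ((lt_div_iff₀ h2).1 h1).le
  obtain ⟨S₁, hS₁⟩ := eventually_atTop.1 hratio
  filter_upwards [eventually_gt_atTop s₀, eventually_ge_atTop S, eventually_ge_atTop S₁,
    eventually_ge_atTop (S / x)] with s h1 h2 h3 h4
  have hup : ∀ t ∈ Ioi s, g (x * t) ≤ 4 * Real.exp (-(c * ψ s)) * g t := by
    intro t ht
    rw [mem_Ioi] at ht
    have hxt : S ≤ x * t := by
      rw [div_le_iff₀ hx] at h4
      nlinarith
    have h5 := (hS (x * t) hxt).1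
    have h6 := (hS t (h2.trans ht.le)).2
    have h7 := hS₁ t (h3.trans ht.le)
    have h8 : ψ s ≤ ψ t := hmono h1 (h1.trans ht) ht.le
    have h9 : Real.exp (-ψ (x * t)) ≤ Real.exp (-(c * ψ s)) * Real.exp (-ψ t) := by
      rw [← Real.exp_add, Real.exp_le_exp]
      nlinarith
    have h10 := Real.exp_pos (-(c * ψ s))
    nlinarith
  have hI : ∫ t in Ioi s, g t ≤ 1 := by
    rw [← hg.integral_eq_one]
    exact setIntegral_le_integral hg.integrable (ae_of_all _ fun t => (hg.pos t).le)
  have hT : 1 - cdf (densityLaw g) (x * s) ≤ 4 * x * Real.exp (-(c * ψ s)) := by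
    rw [hg.one_sub_cdf_eq]
    have h5 : ∫ t in Ioi s, g (x * t) = x⁻¹ * ∫ t in Ioi (x * s), g t := by
      rw [integral_comp_mul_left_Ioi g s hx, smul_eq_mul]
    have h6 : ∫ t in Ioi s, g (x * t) ≤ ∫ t in Ioi s, 4 * Real.exp (-(c * ψ s)) * g t := by
      refine setIntegral_mono_on ?_ (hg.integrable.integrableOn.const_mul _) measurableSet_Ioi hup
      exact (hg.integrable.comp_mul_left' hx.ne').integrableOn
    rw [integral_const_mul, h5, inv_mul_le_iff₀ hx] at h6
    have h10 := Real.exp_pos (-(c * ψ s))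
    calc _ ≤ _ := h6
      _ ≤ x * (4 * Real.exp (-(c * ψ s)) * 1) := by gcongr
      _ = _ := by ring
  have hpos : 0 < 1 - cdf (densityLaw g) (x * s) := by
    rw [hg.one_sub_cdf_eq]
    rw [setIntegral_pos_iff_support_of_nonneg_ae (ae_of_all _ fun t => (hg.pos t).le)
      hg.integrable.integrableOn]
    have : Function.support g = univ := by
      ext t; simp [(hg.pos t).ne']
    rw [this, univ_inter]
    simp
  have := Real.log_le_log hpos hT
  rw [Real.log_mul (by positivity) (Real.exp_pos _).ne', Real.log_exp] at this
  rw [tailExponent]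
  linarith

/-- From below, `le_tailExponent` with `c = xᶿ - 2`, evaluated at `s / x`, bounds the lower limit by
`1 - 2 x ^ (-θ)`; then `x` is taken large. From above, `tailExponent_le` bounds the upper limit by
`xᶿ`; then `x` is taken close to `1`. -/
lemma tendsto_tailExponent_div (hθ : 0 < θ) (hg : IsPosContDensity g)
    (hψ : IsVonMisesExponent ψ)
    (ha : Tendsto (fun s => g s / Real.exp (-ψ s)) atTop (𝓝 1)) (hrv : RegularlyVarying ψ θ) :
    Tendsto (fun s => tailExponent (cdf (densityLaw g)) s / ψ s) atTop (𝓝 1) := by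
  refine tendsto_order.2 ⟨fun a ha1 => ?_, fun a ha1 => ?_⟩
  · have hlim : Tendsto (fun x : ℝ => 1 - 2 * x ^ (-θ)) atTop (𝓝 1) := by
      simpa using ((tendsto_rpow_neg_atTop hθ).const_mul 2).const_sub 1
    obtain ⟨x, hx1, hx2, hx3⟩ := ((hlim.eventually (lt_mem_nhds ha1)).and
      ((eventually_gt_atTop 0).and ((tendsto_rpow_atTop hθ).eventually_ge_atTop 2))).exists
    have h1 := le_tailExponent hg hψ ha hrv hx2 (c := x ^ θ - 2) (by linarith) (by linarith)
    have h2 : ∀ᶠ s in atTop, (x ^ θ - 2) * ψ (x⁻¹ * s) - Real.log (4 * x) ≤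
        tailExponent (cdf (densityLaw g)) s := by
      have h3 := (tendsto_id.const_mul_atTop (inv_pos.2 hx2)).eventually h1
      filter_upwards [h3] with s hs
      simpa [mul_inv_cancel_left₀ hx2.ne'] using hs
    have h4 : Tendsto (fun s => (x ^ θ - 2) * (ψ (x⁻¹ * s) / ψ s) - Real.log (4 * x) / ψ s)
        atTop (𝓝 ((x ^ θ - 2) * x⁻¹ ^ θ - 0)) :=
      ((hrv _ (inv_pos.2 hx2)).const_mul _).sub (hψ.tendsto.const_div_atTop _)
    have h5 : (x ^ θ - 2) * x⁻¹ ^ θ - 0 = 1 - 2 * x ^ (-θ) := by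
      rw [Real.inv_rpow hx2.le, ← Real.rpow_neg hx2.le, sub_mul, ← Real.rpow_add hx2]
      simp
    rw [h5] at h4
    filter_upwards [h2, h4.eventually (lt_mem_nhds hx1), hψ.tendsto.eventually_gt_atTop 0]
      with s h6 h7 h8
    refine h7.trans_le ?_
    rw [← mul_div_assoc, ← sub_div]
    exact div_le_div_of_nonneg_right h6 h8.le
  · have hlim : Tendsto (fun x : ℝ => x ^ θ) (𝓝[>] 1) (𝓝 1) := by
      have : ContinuousAt (fun x : ℝ => x ^ θ) 1 :=
        Real.continuousAt_rpow_const _ _ (Or.inl one_ne_zero)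
      simpa using this.tendsto.mono_left nhdsWithin_le_nhds
    obtain ⟨x, hx1, hx2⟩ := ((hlim.eventually (gt_mem_nhds ha1)).and
      self_mem_nhdsWithin).exists
    filter_upwards [tailExponent_le hg hψ ha hx2,
      (hrv x (by linarith)).eventually (gt_mem_nhds hx1), hψ.tendsto.eventually_gt_atTop 0]
      with s h1 h2 h3
    exact (div_le_div_of_nonneg_right h1 h3.le).trans_lt h2

/-- Tail exponents along a light scaling. -/
theorem tendsto_tailExponent_mul (hθ : 0 < θ) (hg : IsPosContDensity g) (hs : ∀ t, g (-t) = g t)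
    (hψ : IsVonMisesExponent ψ)
    (ha : Tendsto (fun s => g s / Real.exp (-ψ s)) atTop (𝓝 1)) (hrv : RegularlyVarying ψ θ)
    {b : ℕ → ℝ} (hb : IsLightScaling (cdf (densityLaw g)) b) {u : ℝ} (hu : 0 < u) :
    Tendsto (fun n : ℕ => tailExponent (cdf (densityLaw g)) (b n * u) / Real.log n) atTop
      (𝓝 (u ^ θ)) := by
  have hG := hg.isSymmCDF hs
  set Λ := tailExponent (cdf (densityLaw g)) with hΛ
  have hlog : Tendsto (fun n : ℕ => Real.log n) atTop atTop :=
    Real.tendsto_log_atTop.comp tendsto_natCast_atTop_atTop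
  have hlog0 : ∀ᶠ n : ℕ in atTop, Real.log n ≠ 0 := hlog.eventually_ne_atTop 0
  have hbΛ : Tendsto (fun n => Λ (b n) / Real.log n) atTop (𝓝 1) :=
    (isEquivalent_iff_tendsto_one hlog0).1 hb.2
  have hbinf : Tendsto b atTop atTop := by
    refine tendsto_atTop.2 fun B => ?_
    have h1 : Tendsto (fun n => Λ (b n)) atTop atTop := hb.2.symm.tendsto_atTop hlog
    filter_upwards [h1.eventually_gt_atTop (Λ B)] with n hn
    exact (hG.tailExponent_strictMono.lt_iff_lt.1 hn).le
  have hbu : Tendsto (fun n => b n * u) atTop atTop := hbinf.atTop_mul_const hu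
  have hquot := tendsto_tailExponent_div hθ hg hψ ha hrv
  have h1 := hquot.comp hbu
  have h2 := (hrv u hu).comp hbinf
  have h3 := (hquot.comp hbinf).inv₀ one_ne_zero
  -- The product telescopes: `Λ(bu)/ψ(bu) · ψ(bu)/ψ(b) · ψ(b)/Λ(b) · Λ(b)/log n`, with only the
  -- second factor having a limit other than `1` in general.
  have h4 := ((h1.mul h2).mul h3).mul hbΛ
  simp only [one_mul, mul_one, inv_one] at h4
  refine h4.congr' ?_
  filter_upwards [hlog0, (hψ.tendsto.comp hbinf).eventually_gt_atTop 0,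
    (hψ.tendsto.comp hbu).eventually_gt_atTop 0,
    (hquot.comp hbinf).eventually_ne one_ne_zero] with n h5 h6 h7 h8
  simp only [Function.comp_apply] at h6 h7 h8 ⊢
  have h9 : Λ (b n) ≠ 0 := fun h => h8 (by rw [← hΛ, h, zero_div])
  rw [← hΛ, mul_comm u (b n)]
  field_simp

end LightTail

/-! ### Excess measures -/

section Excess

variable {d : ℕ} {lam : ℝ} {ρ : Measure (EuclideanSpace ℝ (Fin d))}

lemma abs_coord_le_norm (w : EuclideanSpace ℝ (Fin d)) (i : Fin d) : |w i| ≤ ‖w‖ :=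
  PiLp.norm_apply_le w i

lemma measurable_coord (i : Fin d) :
    Measurable fun w : EuclideanSpace ℝ (Fin d) => w i := by fun_prop

lemma IsExcessMeasure.ne_top_of_coord (hρ : IsExcessMeasure lam ρ) (i : Fin d) {r : ℝ}
    (hr : 0 < r) : ρ {w | r ≤ |w i|} ≠ ∞ :=
  ne_top_of_le_ne_top (hρ.finite_away r hr).ne
    (measure_mono fun w hw => le_trans hw (abs_coord_le_norm w i))

lemma IsExcessMeasure.measure_preimage_smul (hρ : IsExcessMeasure lam ρ) {r : ℝ} (hr : 0 < r)
    {A : Set (EuclideanSpace ℝ (Fin d))} (hA : MeasurableSet A) :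
    ρ {w | r⁻¹ • w ∈ A} = ρ A / ENNReal.ofReal (r ^ lam) := by
  rw [← hρ.scaling r hr A hA]
  congr 1
  ext w
  rw [mem_smul_set_iff_inv_smul_mem₀ hr.ne']
  rfl

lemma IsExcessMeasure.map_smul (hρ : IsExcessMeasure lam ρ) {r : ℝ} (hr : 0 < r) :
    ρ.map (fun w => r⁻¹ • w) = ENNReal.ofReal (r ^ (-lam)) • ρ := by
  ext A hA
  rw [Measure.map_apply (by fun_prop) hA, Measure.smul_apply, smul_eq_mul, Real.rpow_neg hr.le,
    ENNReal.ofReal_inv_of_pos (Real.rpow_pos_of_pos hr _), mul_comm, ← div_eq_mul_inv]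
  exact hρ.measure_preimage_smul hr hA

lemma IsExcessMeasure.integral_smul (hρ : IsExcessMeasure lam ρ) {r : ℝ} (hr : 0 < r)
    {g : EuclideanSpace ℝ (Fin d) → ℝ} (hg : Measurable g) :
    r ^ lam * ∫ w, g (r⁻¹ • w) ∂ρ = ∫ w, g w ∂ρ := by
  have h := integral_map (μ := ρ) (φ := fun w => r⁻¹ • w) (by fun_prop)
    hg.aestronglyMeasurable
  rw [hρ.map_smul hr, integral_smul_measure, ENNReal.toReal_ofReal
    (Real.rpow_nonneg hr.le _)] at h
  rw [← h, smul_eq_mul, ← mul_assoc, ← Real.rpow_add hr]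
  simp

lemma IsExcessMeasure.real_abs_coord (hρ : IsExcessMeasure lam ρ) (i : Fin d) {r : ℝ}
    (hr : 0 < r) : ρ.real {w | r ≤ |w i|} = ρ.real {w | 1 ≤ |w i|} * r ^ (-lam) := by
  have hm : MeasurableSet {w : EuclideanSpace ℝ (Fin d) | 1 ≤ |w i|} :=
    measurableSet_le measurable_const (measurable_coord i).abs
  have hset : {w : EuclideanSpace ℝ (Fin d) | r ≤ |w i|} =
      {w | r⁻¹ • w ∈ {w : EuclideanSpace ℝ (Fin d) | 1 ≤ |w i|}} := by
    ext w
    simp only [mem_ofPred_eq, PiLp.smul_apply, smul_eq_mul, abs_mul, abs_inv, abs_of_pos hr]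
    rw [← div_eq_inv_mul, le_div_iff₀ hr, one_mul]
  rw [hset, measureReal_def, hρ.measure_preimage_smul hr hm, ENNReal.toReal_div,
    ENNReal.toReal_ofReal (Real.rpow_nonneg hr.le _), Real.rpow_neg hr.le, div_eq_mul_inv]
  rfl

/-- A continuous function of the `i`-th coordinate between the indicators of `{b ≤ |w i|}` and
`{a ≤ |w i|}`. -/
noncomputable def coordRamp (i : Fin d) (a b : ℝ) : EuclideanSpace ℝ (Fin d) →ᵇ ℝ :=
  BoundedContinuousFunction.ofNormedAddCommGroup
    (fun w => max 0 (min 1 ((|w i| - a) / (b - a))))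
    (by fun_prop) 1 fun w => by
      rw [Real.norm_eq_abs, abs_of_nonneg (le_max_left _ _)]
      exact max_le zero_le_one (min_le_left _ _)

lemma coordRamp_apply (i : Fin d) (a b : ℝ) (w : EuclideanSpace ℝ (Fin d)) :
    coordRamp i a b w = max 0 (min 1 ((|w i| - a) / (b - a))) := rfl

lemma indicator_le_coordRamp (i : Fin d) {a b : ℝ} (hab : a < b)
    (w : EuclideanSpace ℝ (Fin d)) :
    {w : EuclideanSpace ℝ (Fin d) | b ≤ |w i|}.indicator (fun _ => (1 : ℝ)) w ≤
      coordRamp i a b w := by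
  by_cases h : b ≤ |w i|
  · rw [indicator_of_mem (by exact h), coordRamp_apply]
    refine le_max_of_le_right (le_min le_rfl ?_)
    rw [le_div_iff₀ (by linarith)]
    linarith
  · rw [indicator_of_notMem (by exact h)]
    exact le_max_left _ _

lemma coordRamp_le_indicator (i : Fin d) {a b : ℝ} (hab : a < b)
    (w : EuclideanSpace ℝ (Fin d)) :
    coordRamp i a b w ≤
      {w : EuclideanSpace ℝ (Fin d) | a ≤ |w i|}.indicator (fun _ => (1 : ℝ)) w := by
  by_cases h : a ≤ |w i|
  · rw [indicator_of_mem (by exact h), coordRamp_apply]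
    exact max_le zero_le_one (min_le_left _ _)
  · rw [indicator_of_notMem (by exact h), coordRamp_apply]
    refine max_le le_rfl (min_le_of_right_le ?_)
    push Not at h
    exact div_nonpos_of_nonpos_of_nonneg (by linarith) (by linarith)

lemma measurableSet_le_abs_coord (i : Fin d) (r : ℝ) :
    MeasurableSet {w : EuclideanSpace ℝ (Fin d) | r ≤ |w i|} :=
  measurableSet_le measurable_const (measurable_coord i).abs

lemma IsExcessMeasure.integral_coordRamp (hρ : IsExcessMeasure lam ρ) (i : Fin d) {a b : ℝ}
    (ha : 0 < a) (hab : a < b) :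
    ρ.real {w | b ≤ |w i|} ≤ ∫ w, coordRamp i a b w ∂ρ ∧
      ∫ w, coordRamp i a b w ∂ρ ≤ ρ.real {w | a ≤ |w i|} := by
  have hI : ∀ r : ℝ, 0 < r → Integrable
      ({w : EuclideanSpace ℝ (Fin d) | r ≤ |w i|}.indicator (fun _ => (1 : ℝ))) ρ := fun r hr =>
    (integrable_indicator_iff (measurableSet_le_abs_coord i r)).2
      (integrableOn_const (hs := hρ.ne_top_of_coord i hr))
  have hR : Integrable (fun w => coordRamp i a b w) ρ := by
    refine (hI a ha).mono (coordRamp i a b).continuous.aestronglyMeasurable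
      (ae_of_all _ fun w => ?_)
    rw [Real.norm_eq_abs, abs_of_nonneg (le_max_left _ _), Real.norm_eq_abs]
    exact (coordRamp_le_indicator i hab w).trans (le_abs_self _)
  have hint : ∀ r : ℝ, ∫ w, ({w : EuclideanSpace ℝ (Fin d) | r ≤ |w i|}.indicator
      (fun _ => (1 : ℝ))) w ∂ρ = ρ.real {w | r ≤ |w i|} := fun r => by
    rw [integral_indicator_const _ (measurableSet_le_abs_coord i r), smul_eq_mul, mul_one]
  rw [← hint, ← hint]
  exact ⟨integral_mono (hI b (ha.trans hab)) hR (indicator_le_coordRamp i hab),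
    integral_mono hR (hI a ha) (coordRamp_le_indicator i hab)⟩

lemma integral_coordRamp_smul {π : Measure (EuclideanSpace ℝ (Fin d))} [IsProbabilityMeasure π]
    (i : Fin d) {a b c : ℝ} (hc : 0 < c) (hab : a < b) :
    π.real {z | c * b ≤ |z i|} ≤ ∫ z, coordRamp i a b (c⁻¹ • z) ∂π ∧
      ∫ z, coordRamp i a b (c⁻¹ • z) ∂π ≤ π.real {z | c * a ≤ |z i|} := by
  have hset : ∀ r : ℝ, ∀ z : EuclideanSpace ℝ (Fin d), c⁻¹ • z ∈
      {w : EuclideanSpace ℝ (Fin d) | r ≤ |w i|} ↔ c * r ≤ |z i| := by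
    intro r z
    simp only [mem_ofPred_eq, PiLp.smul_apply, smul_eq_mul, abs_mul, abs_inv, abs_of_pos hc]
    rw [← div_eq_inv_mul, le_div_iff₀ hc, mul_comm]
  have hI : ∀ r : ℝ, Integrable
      ({w : EuclideanSpace ℝ (Fin d) | c * r ≤ |w i|}.indicator (fun _ => (1 : ℝ))) π := fun r =>
    (integrable_const _).indicator (measurableSet_le_abs_coord i _)
  have hR : Integrable (fun z => coordRamp i a b (c⁻¹ • z)) π :=
    Integrable.of_bound (by fun_prop) ‖coordRamp i a b‖
      (ae_of_all _ fun z => (coordRamp i a b).norm_coe_le_norm _)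
  have hint : ∀ r : ℝ, ∫ w, ({w : EuclideanSpace ℝ (Fin d) | c * r ≤ |w i|}.indicator
      (fun _ => (1 : ℝ))) w ∂π = π.real {w | c * r ≤ |w i|} := fun r => by
    rw [integral_indicator_const _ (measurableSet_le_abs_coord i _), smul_eq_mul, mul_one]
  have hind : ∀ r : ℝ, ∀ z : EuclideanSpace ℝ (Fin d),
      {w : EuclideanSpace ℝ (Fin d) | c * r ≤ |w i|}.indicator (fun _ => (1 : ℝ)) z =
      {w : EuclideanSpace ℝ (Fin d) | r ≤ |w i|}.indicator (fun _ => (1 : ℝ)) (c⁻¹ • z) := by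
    intro r z
    by_cases h : c * r ≤ |z i|
    · rw [indicator_of_mem (by exact h), indicator_of_mem ((hset r z).2 h)]
    · rw [indicator_of_notMem (by exact h), indicator_of_notMem fun h' => h ((hset r z).1 h')]
  rw [← hint, ← hint]
  refine ⟨integral_mono (hI b) hR fun z => ?_, integral_mono hR (hI a) fun z => ?_⟩
  · simp only [hind]
    exact indicator_le_coordRamp i hab _
  · simp only [hind]
    exact coordRamp_le_indicator i hab _

lemma exists_isHeavyScaling {F : ℝ → ℝ} (hF : IsSymmCDF F) : ∃ c, IsHeavyScaling F c := by
  -- From `n = 3` on, `1 - 1/n` exceeds `F 0 = 1/2`, so the quantile is positive. Smaller `n` get an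
  -- arbitrary positive value.
  have h : ∀ n : ℕ, ∃ c : ℝ, 0 < c ∧ (3 ≤ n → 1 - F c = 1 / n) := by
    intro n
    by_cases hn : 3 ≤ n
    · have hn' : (3 : ℝ) ≤ n := by exact_mod_cast hn
      have h1 : (1 : ℝ) / n ≤ 1 / 3 := one_div_le_one_div_of_le (by norm_num) hn'
      have h2 : (0 : ℝ) < 1 / n := by positivity
      obtain ⟨t, ht⟩ := hF.exists_eq (p := 1 - 1 / n) (by linarith) (by linarith)
      refine ⟨t, ?_, fun _ => by rw [ht]; ring⟩
      rw [← hF.strictMono.lt_iff_lt, hF.apply_zero, ht]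
      linarith
    · exact ⟨1, one_pos, fun h => absurd h hn⟩
  choose c hc0 hc using h
  refine ⟨c, hc0, IsEquivalent.congr_left (IsEquivalent.refl) ?_⟩
  filter_upwards [eventually_ge_atTop 3] with n hn
  exact (hc n hn).symm

lemma real_abs_coord_of_marginal {π : Measure (EuclideanSpace ℝ (Fin d))} {f₀ : ℝ → ℝ}
    (hf : IsPosContDensity f₀) (hs : ∀ t, f₀ (-t) = f₀ t) {i : Fin d}
    (hm : marginal π i = densityLaw f₀) {t : ℝ} (ht : 0 < t) :
    π.real {z | t ≤ |z i|} = 2 * (1 - cdf (densityLaw f₀) t) := by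
  have := hf.isProbabilityMeasure
  have hF := hf.isSymmCDF hs
  have hat : densityLaw f₀ {t} = 0 := by
    rw [densityLaw, withDensity_apply _ (measurableSet_singleton t)]
    simp
  have hmeas : MeasurableSet {x : ℝ | t ≤ |x|} :=
    measurableSet_le measurable_const measurable_abs
  have h1 : π.real {z | t ≤ |z i|} = (densityLaw f₀).real {x | t ≤ |x|} := by
    rw [← hm, measureReal_def, measureReal_def, marginal, Measure.map_apply (measurable_coord i)
      hmeas]
    rfl
  have h2 : {x : ℝ | t ≤ |x|} = Iic (-t) ∪ Ici t := by
    ext x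
    simp only [mem_ofPred_eq, mem_union, mem_Iic, mem_Ici, le_abs']
  rw [h1, h2, measureReal_union (disjoint_left.2 fun x hx hx' => by
    rw [mem_Iic] at hx; rw [mem_Ici] at hx'; linarith) measurableSet_Ici, ← cdf_eq_real, hF.symm,
    measureReal_congr (Ioi_ae_eq_Ici' hat).symm, ← one_sub_cdf]
  ring

/-- Weak convergence sees only continuous functions, so the indicator of `{x ≤ |w i|}` is squeezed
between ramps with a neighbouring endpoint `y`. By scaling, the mass of `{y ≤ |w i|}` is a constant
times `y ^ (-λ)`, which is continuous at `x`, so the squeeze closes. -/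
lemma IsExcessMeasureOf.tendsto_abs_coord {π : Measure (EuclideanSpace ℝ (Fin d))}
    [IsProbabilityMeasure π] {F : ℝ → ℝ} (hρ : IsExcessMeasureOf lam F π ρ)
    {c : ℕ → ℝ} (hc : IsHeavyScaling F c) (i : Fin d) {x : ℝ} (hx : 0 < x) :
    Tendsto (fun n : ℕ => n * π.real {z | c n * x ≤ |z i|}) atTop
      (𝓝 (ρ.real {w | 1 ≤ |w i|} * x ^ (-lam))) := by
  have hramp : ∀ a b : ℝ, 0 < a → a < b → Tendsto (fun n : ℕ => (n : ℝ) *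
      ∫ z, coordRamp i a b ((c n)⁻¹ • z) ∂π) atTop (𝓝 (∫ w, coordRamp i a b w ∂ρ)) := by
    intro a b ha hab
    refine hρ.2 c hc _ ⟨a, ha, fun w hw => ?_⟩
    refine le_antisymm ((coordRamp_le_indicator i hab w).trans_eq ?_) (le_max_left _ _)
    refine indicator_of_notMem (fun h => ?_) _
    exact absurd (le_trans h (abs_coord_le_norm w i)) (not_le.2 hw)
  have hcont : Tendsto (fun y : ℝ => ρ.real {w | 1 ≤ |w i|} * y ^ (-lam)) (𝓝 x)
      (𝓝 (ρ.real {w | 1 ≤ |w i|} * x ^ (-lam))) :=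
    ((Real.continuousAt_rpow_const x (-lam) (Or.inl hx.ne')).tendsto).const_mul _
  refine tendsto_order.2 ⟨fun v hv => ?_, fun v hv => ?_⟩
  · obtain ⟨y, hy1, hy2⟩ := (((hcont.eventually (lt_mem_nhds hv)).filter_mono
      nhdsWithin_le_nhds).and (self_mem_nhdsWithin (s := Ioi x))).exists
    change x < y at hy2
    have h1 := (hρ.1.integral_coordRamp i hx hy2).1
    rw [hρ.1.real_abs_coord i (hx.trans hy2)] at h1
    filter_upwards [(hramp x y hx hy2).eventually (lt_mem_nhds (hy1.trans_le h1))] with n hn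
    refine hn.trans_le (mul_le_mul_of_nonneg_left ?_ (Nat.cast_nonneg n))
    exact (integral_coordRamp_smul i (hc.1 n) hy2).2
  · obtain ⟨y, hy1, hy2⟩ := (((hcont.eventually (gt_mem_nhds hv)).filter_mono
      nhdsWithin_le_nhds).and (Ioo_mem_nhdsLT hx)).exists
    have h1 := (hρ.1.integral_coordRamp i hy2.1 hy2.2).2
    rw [hρ.1.real_abs_coord i hy2.1] at h1
    filter_upwards [(hramp y x hy2.1 hy2.2).eventually (gt_mem_nhds (h1.trans_lt hy1))] with n hn
    refine lt_of_le_of_lt (mul_le_mul_of_nonneg_left ?_ (Nat.cast_nonneg n)) hn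
    exact (integral_coordRamp_smul i (hc.1 n) hy2.2).1

lemma IsHeavyScaling.tendsto_mul {F : ℝ → ℝ} {c : ℕ → ℝ} (hc : IsHeavyScaling F c) :
    Tendsto (fun n : ℕ => n * (1 - F (c n))) atTop (𝓝 1) := by
  have h0 : ∀ᶠ n : ℕ in atTop, (1 : ℝ) / n ≠ 0 := by
    filter_upwards [eventually_ne_atTop 0] with n hn
    have : (n : ℝ) ≠ 0 := by exact_mod_cast hn
    exact one_div_ne_zero this
  refine ((isEquivalent_iff_tendsto_one h0).1 hc.2).congr fun n => ?_
  simp only [Pi.div_apply]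
  rw [div_div_eq_mul_div, div_one, mul_comm]

/-- The marginals of the excess measure. -/
theorem IsExcessMeasureOf.real_one_le_abs_coord {f : EuclideanSpace ℝ (Fin d) → ℝ} {f₀ : ℝ → ℝ}
    (hf : IsPosContDensity f) (hf₀ : IsPosContDensity f₀) (hs : ∀ t, f₀ (-t) = f₀ t)
    (hm : ∀ i, marginal (densityLaw f) i = densityLaw f₀)
    (hρ : IsExcessMeasureOf lam (cdf (densityLaw f₀)) (densityLaw f) ρ) (i : Fin d) :
    ρ.real {w | 1 ≤ |w i|} = 2 := by
  have := hf.isProbabilityMeasure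
  obtain ⟨c, hc⟩ := exists_isHeavyScaling (hf₀.isSymmCDF hs)
  have h1 := hρ.tendsto_abs_coord hc i one_pos
  have h2 := hc.tendsto_mul.const_mul 2
  rw [Real.one_rpow, mul_one] at h1
  rw [mul_one] at h2
  -- The expected count `n P(|Z_i| ≥ c_n)` has two limits: the mass of the slab under `ρ`, and `2`,
  -- because it equals `2 n (1 - F₀(c_n))`.
  refine tendsto_nhds_unique h1 (h2.congr fun n => ?_)
  rw [mul_one, real_abs_coord_of_marginal hf₀ hs (hm i) (hc.1 n)]
  ring

/-- The tail of the marginal distribution varies regularly. -/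
theorem IsExcessMeasureOf.tendsto_tail {f : EuclideanSpace ℝ (Fin d) → ℝ} {f₀ : ℝ → ℝ}
    (hf : IsPosContDensity f) (hf₀ : IsPosContDensity f₀) (hs : ∀ t, f₀ (-t) = f₀ t)
    (hm : ∀ i, marginal (densityLaw f) i = densityLaw f₀)
    (hρ : IsExcessMeasureOf lam (cdf (densityLaw f₀)) (densityLaw f) ρ) (i : Fin d)
    {c : ℕ → ℝ} (hc : IsHeavyScaling (cdf (densityLaw f₀)) c) {x : ℝ} (hx : 0 < x) :
    Tendsto (fun n : ℕ => n * (1 - cdf (densityLaw f₀) (c n * x))) atTop (𝓝 (x ^ (-lam))) := by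
  have := hf.isProbabilityMeasure
  have h1 := (hρ.tendsto_abs_coord hc i hx).const_mul (1 / 2)
  rw [hρ.real_one_le_abs_coord hf hf₀ hs hm i, ← mul_assoc, one_div_mul_cancel two_ne_zero,
    one_mul] at h1
  refine h1.congr fun n => ?_
  rw [real_abs_coord_of_marginal hf₀ hs (hm i) (mul_pos (hc.1 n) hx)]
  ring

end Excess

/-! ### Pareto marginals, orthants and coordinate planes -/

section ParetoMarginals

variable {d : ℕ} {lam : ℝ} {ρ ρ' : Measure (EuclideanSpace ℝ (Fin d))}

lemma densityLaw_pareto_Ioi (h : 0 < lam) :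
    densityLaw (fun t : ℝ => lam / |t| ^ (lam + 1)) (Ioi 1) = 1 := by
  have hcongr : ∀ t ∈ Ioi (1 : ℝ), lam / |t| ^ (lam + 1) = lam * t ^ (-lam - 1) := by
    intro t ht
    have ht0 : 0 < t := one_pos.trans ht
    rw [abs_of_pos ht0, div_eq_mul_inv, ← Real.rpow_neg ht0.le]
    congr 2
    ring
  have hint : IntegrableOn (fun t : ℝ => lam * t ^ (-lam - 1)) (Ioi 1) :=
    (integrableOn_Ioi_rpow_of_lt (by linarith) one_pos).const_mul lam
  rw [densityLaw, withDensity_apply _ measurableSet_Ioi,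
    setLIntegral_congr_fun measurableSet_Ioi fun t ht => by rw [hcongr t ht],
    ← ofReal_integral_eq_lintegral_ofReal hint, integral_const_mul,
    integral_Ioi_rpow_of_lt (by linarith) one_pos]
  · rw [Real.one_rpow, ← ENNReal.ofReal_one]
    congr 1
    rw [show -lam - 1 + 1 = -lam by ring]
    field_simp
  · refine (ae_restrict_iff' measurableSet_Ioi).2 (ae_of_all _ fun t ht => ?_)
    exact mul_nonneg h.le (Real.rpow_nonneg (one_pos.trans ht).le _)

lemma densityLaw_pareto_Iio (h : 0 < lam) :
    densityLaw (fun t : ℝ => lam / |t| ^ (lam + 1)) (Iio (-1)) = 1 := by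
  rw [← densityLaw_pareto_Ioi h, densityLaw, withDensity_apply _ measurableSet_Iio,
    withDensity_apply _ measurableSet_Ioi,
    ← (Measure.measurePreserving_neg (volume : Measure ℝ)).setLIntegral_comp_preimage
        measurableSet_Iio (by fun_prop)]
  simp

lemma HasParetoMarginals.measure_coord (hρ : HasParetoMarginals lam ρ) (i : Fin d) {B : Set ℝ}
    (hB : MeasurableSet B) (h0 : (0 : ℝ) ∉ B) :
    ρ {w | w i ∈ B} = densityLaw (fun t : ℝ => lam / |t| ^ (lam + 1)) B := by
  have hsub : B ⊆ {0}ᶜ := fun x hx h => h0 (mem_singleton_iff.1 h ▸ hx)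
  have h := congrArg (fun μ : Measure ℝ => μ B) (hρ i)
  simp only [Measure.restrict_apply hB, inter_eq_left.2 hsub] at h
  rw [← h, marginal, Measure.map_apply (measurable_coord i) hB]
  rfl

lemma HasParetoMarginals.measure_coord_eq (hρ : HasParetoMarginals lam ρ) (i : Fin d) {t : ℝ}
    (ht : t ≠ 0) : ρ {w | w i = t} = 0 := by
  refine (hρ.measure_coord i (measurableSet_singleton t) (by simpa using ht.symm)).trans ?_
  rw [densityLaw, withDensity_apply _ (measurableSet_singleton t)]
  simp

lemma HasParetoMarginals.measure_one_lt (h : 0 < lam) (hρ : HasParetoMarginals lam ρ)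
    (i : Fin d) : ρ {w | 1 < w i} = 1 :=
  (hρ.measure_coord i measurableSet_Ioi (by simp)).trans (densityLaw_pareto_Ioi h)

lemma HasParetoMarginals.measure_lt_neg_one (h : 0 < lam) (hρ : HasParetoMarginals lam ρ)
    (i : Fin d) : ρ {w | w i < -1} = 1 :=
  (hρ.measure_coord i measurableSet_Iio (by simp)).trans (densityLaw_pareto_Iio h)

lemma HasParetoMarginals.measure_one_le_abs (h : 0 < lam) (hρ : HasParetoMarginals lam ρ)
    (i : Fin d) : ρ {w | 1 ≤ |w i|} = 2 := by
  have hset : {w : EuclideanSpace ℝ (Fin d) | 1 ≤ |w i|} =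
      ({w | 1 < w i} ∪ {w | w i < -1}) ∪ ({w | w i = 1} ∪ {w | w i = -1}) := by
    ext w
    simp only [mem_ofPred_eq, mem_union, le_abs']
    constructor
    · rintro (h | h)
      · rcases h.lt_or_eq with h | h <;> tauto
      · rcases h.lt_or_eq with h | h
        · tauto
        · exact Or.inr (Or.inl h.symm)
    · rintro ((h | h) | (h | h)) <;> first | (left; linarith) | (right; linarith)
  have hnull : ρ ({w | w i = 1} ∪ {w | w i = -1}) = 0 :=
    measure_union_null (hρ.measure_coord_eq i one_ne_zero)
      (hρ.measure_coord_eq i (neg_ne_zero.2 one_ne_zero))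
  rw [hset, measure_congr (union_ae_eq_left_of_ae_eq_empty (ae_eq_empty.2 hnull)), measure_union, hρ.measure_one_lt h,
    hρ.measure_lt_neg_one h, one_add_one_eq_two]
  · refine disjoint_left.2 fun w hw hw' => ?_
    simp only [mem_ofPred_eq] at hw hw'
    linarith
  · exact measurableSet_lt (measurable_coord i) measurable_const

/-- The sign vectors in `{-1, 1}ᵈ`. -/
noncomputable def signVector (σ : Fin d → Bool) (i : Fin d) : ℝ := if σ i then 1 else -1

lemma signVector_eq (σ : Fin d → Bool) (i : Fin d) :
    signVector σ i = 1 ∨ signVector σ i = -1 := by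
  unfold signVector
  split_ifs <;> simp

lemma measurableSet_orthant (δ : Fin d → ℝ) : MeasurableSet (orthant δ) := by
  have : orthant δ = ⋂ i, {w : EuclideanSpace ℝ (Fin d) | 0 < δ i * w i} := by
    ext w; simp [orthant]
  rw [this]
  exact MeasurableSet.iInter fun i =>
    measurableSet_lt measurable_const ((measurable_coord i).const_mul _)

lemma iUnion_orthant : ⋃ σ : Fin d → Bool, orthant (signVector σ) =
    {w : EuclideanSpace ℝ (Fin d) | ∀ i, w i ≠ 0} := by
  ext w
  simp only [mem_iUnion, orthant, mem_ofPred_eq]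
  constructor
  · rintro ⟨σ, h⟩ i h0
    have := h i
    rw [h0, mul_zero] at this
    exact lt_irrefl _ this
  · intro h
    refine ⟨fun i => decide (0 < w i), fun i => ?_⟩
    rcases (h i).lt_or_gt with h1 | h1
    · simp [signVector, h1.not_gt, h1]
    · simp [signVector, h1]

lemma disjoint_orthant : Pairwise (Function.onFun Disjoint
    fun σ : Fin d → Bool => (orthant (signVector σ) : Set (EuclideanSpace ℝ (Fin d)))) := by
  intro σ τ hne
  refine disjoint_left.2 fun w hw hw' => hne ?_
  funext i
  have h1 := hw i
  have h2 := hw' i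
  unfold signVector at h1 h2
  cases hσ : σ i <;> cases hτ : τ i <;> simp [hσ, hτ] at h1 h2 ⊢ <;> linarith

/-- A measure which has the same univariate marginals on orthants as a measure that does not
charge the coordinate planes, and the same total univariate marginals, does not charge the
coordinate planes. -/
theorem IsExcessMeasure.measure_coord_eq_zero (hρ' : IsExcessMeasure lam ρ')
    (hplanes : ∀ i, ρ {w | w i = 0} = 0) (horth : SameOrthantMarginals ρ' ρ)
    (htot : ∀ i, ρ' {w | 1 ≤ |w i|} = ρ {w | 1 ≤ |w i|}) (i : Fin d) :
    ρ' {w | w i = 0} = 0 := by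
  set Q : Set (EuclideanSpace ℝ (Fin d)) := {w | ∀ i, w i ≠ 0} with hQ
  set B : Fin d → Set (EuclideanSpace ℝ (Fin d)) := fun j => {w | 1 ≤ |w j|} with hB
  have hBm : ∀ j, MeasurableSet (B j) := fun j => measurableSet_le_abs_coord j 1
  have hsum : ∀ μ : Measure (EuclideanSpace ℝ (Fin d)), ∀ j,
      μ (B j ∩ Q) = ∑' σ : Fin d → Bool, μ (B j ∩ orthant (signVector σ)) := by
    intro μ j
    rw [hQ, ← iUnion_orthant, inter_iUnion, measure_iUnion]
    · intro σ τ hne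
      exact (disjoint_orthant hne).mono inter_subset_right inter_subset_right
    · exact fun σ => (hBm j).inter (measurableSet_orthant _)
  have hmeas1 : MeasurableSet {t : ℝ | 1 ≤ |t|} := measurableSet_le measurable_const measurable_abs
  have horth' : ∀ j, ∀ σ : Fin d → Bool, ρ' (B j ∩ orthant (signVector σ)) =
      ρ (B j ∩ orthant (signVector σ)) := by
    intro j σ
    have h := congrArg (fun μ : Measure ℝ => μ {t : ℝ | 1 ≤ |t|})
      (horth (signVector σ) (signVector_eq σ) j)
    simp only [marginal] at h
    rw [Measure.map_apply (measurable_coord j) hmeas1, Measure.map_apply (measurable_coord j) hmeas1,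
      Measure.restrict_apply (measurable_coord j hmeas1),
      Measure.restrict_apply (measurable_coord j hmeas1)] at h
    exact h
  have hQm : MeasurableSet Q := by
    rw [hQ, ← iUnion_orthant]
    exact MeasurableSet.iUnion fun σ => measurableSet_orthant _
  have hρQ : ∀ j, ρ (B j ∩ Q) = ρ (B j) := by
    intro j
    rw [measure_inter_conull]
    have : Qᶜ = ⋃ i, {w : EuclideanSpace ℝ (Fin d) | w i = 0} := by
      ext w; simp [hQ]
    exact measure_mono_null (this ▸ fun w hw => hw) (measure_iUnion_null hplanes)
  -- The orthants fill `Q`, so `ρ'(B j ∩ Q) = ρ(B j ∩ Q) = ρ(B j) = ρ'(B j)`. This common value is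
  -- finite, so nothing is left outside `Q`.
  have hnull : ∀ j, ρ' (B j \ Q) = 0 := by
    intro j
    have h1 : ρ' (B j ∩ Q) = ρ' (B j) := by
      rw [hsum, tsum_congr (horth' j), ← hsum, hρQ, htot]
    have h2 := measure_inter_add_sdiff (μ := ρ') (B j) hQm
    rw [h1] at h2
    have h3 : ρ' (B j) ≠ ∞ := hρ'.ne_top_of_coord j one_pos
    exact (ENNReal.add_right_inj h3).1 (h2.trans (add_zero _).symm)
  have hmi : MeasurableSet {w : EuclideanSpace ℝ (Fin d) | w i = 0} :=
    measurable_coord i (measurableSet_singleton 0)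
  -- A nonzero point of the plane has an integer multiple in some slab `B j`, still in the plane.
  -- Scaling carries null sets to null sets, so countably many of them cover the plane.
  have hcover : {w : EuclideanSpace ℝ (Fin d) | w i = 0} ⊆
      {0} ∪ ⋃ j, ⋃ n : ℕ, {w | ((n : ℝ) + 1) • w ∈ B j ∩ {w | w i = 0}} := by
    intro w hw
    by_cases hw0 : w = 0
    · exact Or.inl hw0
    · right
      obtain ⟨j, hj⟩ : ∃ j, w j ≠ 0 := by
        by_contra hcon
        push Not at hcon
        exact hw0 (by ext j; simpa using hcon j)
      obtain ⟨n, hn⟩ := exists_nat_ge (1 / |w j|)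
      rw [div_le_iff₀ (abs_pos.2 hj)] at hn
      simp only [mem_iUnion]
      refine ⟨j, n, ?_, ?_⟩
      · simp only [hB, mem_ofPred_eq, PiLp.smul_apply, smul_eq_mul, abs_mul]
        rw [abs_of_nonneg (by positivity)]
        nlinarith [abs_nonneg (w j)]
      · simp only [mem_ofPred_eq] at hw
        simp [hw]
  refine measure_mono_null hcover (measure_union_null hρ'.zero
    (measure_iUnion_null fun j => measure_iUnion_null fun n => ?_))
  have hr : (0 : ℝ) < ((n : ℝ) + 1)⁻¹ := by positivity
  have h := hρ'.measure_preimage_smul hr ((hBm j).inter hmi)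
  rw [inv_inv] at h
  have hsub : B j ∩ {w | w i = 0} ⊆ B j \ Q := fun w hw => ⟨hw.1, fun h => h i hw.2⟩
  rw [h, measure_mono_null hsub (hnull j), ENNReal.zero_div]

end ParetoMarginals

/-! ### A slowly thinning mixture of uniform distributions on cubes -/

section CubeMix

/-- The uniform distribution on `[-R, R]ᵈ`. -/
noncomputable def cubeLaw (d : ℕ) (R : ℝ) : Measure (EuclideanSpace ℝ (Fin d)) :=
  (Measure.pi fun _ : Fin d =>
    (ENNReal.ofReal (2 * R))⁻¹ • (volume : Measure ℝ).restrict (Icc (-R) R)).map (WithLp.toLp 2)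

/-- The weights of the cubes `[-eᵐ, eᵐ]ᵈ`. -/
noncomputable def cubeWeight (lam : ℝ) (m : ℕ) : ℝ := Real.exp (-(lam * m)) / (m + 1) ^ 3

/-- A mixture of uniform distributions on the cubes `[-eᵐ, eᵐ]ᵈ`. -/
noncomputable def cubeMix (d : ℕ) (lam : ℝ) : Measure (EuclideanSpace ℝ (Fin d)) :=
  Measure.sum fun m : ℕ => ENNReal.ofReal (cubeWeight lam m) • cubeLaw d (Real.exp m)

variable {d : ℕ} {lam : ℝ}

lemma measurableSet_box {B : Fin d → Set ℝ} (hB : ∀ i, MeasurableSet (B i)) :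
    MeasurableSet {w : EuclideanSpace ℝ (Fin d) | ∀ i, w i ∈ B i} := by
  have : {w : EuclideanSpace ℝ (Fin d) | ∀ i, w i ∈ B i} = ⋂ i, {w | w i ∈ B i} := by
    ext w; simp
  rw [this]
  exact MeasurableSet.iInter fun i => measurable_coord i (hB i)

lemma cubeLaw_box {R : ℝ} (hR : 0 < R) {B : Fin d → Set ℝ} (hB : ∀ i, MeasurableSet (B i)) :
    cubeLaw d R {w | ∀ i, w i ∈ B i} =
      ∏ i, (ENNReal.ofReal (2 * R))⁻¹ * volume (B i ∩ Icc (-R) R) := by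
  have h2R : (ENNReal.ofReal (2 * R))⁻¹ ≠ ∞ := by
    rw [ENNReal.inv_ne_top]
    exact (ENNReal.ofReal_pos.2 (by positivity)).ne'
  have hfin := Measure.smul_finite ((volume : Measure ℝ).restrict (Icc (-R) R)) h2R
  rw [cubeLaw, Measure.map_apply (WithLp.measurable_toLp 2 _) (measurableSet_box hB)]
  have hset : (WithLp.toLp 2) ⁻¹' {w : EuclideanSpace ℝ (Fin d) | ∀ i, w i ∈ B i} =
      univ.pi B := by
    ext w; simp
  rw [hset, Measure.pi_pi]
  refine Finset.prod_congr rfl fun i _ => ?_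
  rw [Measure.smul_apply, smul_eq_mul, Measure.restrict_apply (hB i)]

lemma cubeLaw_Icc {R : ℝ} (hR : 0 < R) :
    cubeLaw d R {w | ∀ i, w i ∈ Icc (-R) R} = 1 := by
  rw [cubeLaw_box hR fun _ => measurableSet_Icc]
  refine Finset.prod_eq_one fun i _ => ?_
  rw [inter_self, Real.volume_Icc, show R - -R = 2 * R by ring]
  exact ENNReal.inv_mul_cancel (ENNReal.ofReal_pos.2 (by positivity)).ne' ENNReal.ofReal_ne_top

lemma isProbabilityMeasure_cubeLaw {R : ℝ} (hR : 0 < R) : IsProbabilityMeasure (cubeLaw d R) := by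
  constructor
  have h := cubeLaw_box (d := d) hR fun _ => MeasurableSet.univ
  simp only [mem_univ, implies_true, ofPred_true, univ_inter] at h
  rw [h]
  refine Finset.prod_eq_one fun i _ => ?_
  rw [Real.volume_Icc, show R - -R = 2 * R by ring]
  exact ENNReal.inv_mul_cancel (ENNReal.ofReal_pos.2 (by positivity)).ne' ENNReal.ofReal_ne_top

lemma cubeLaw_eq_zero {R s : ℝ} (hR : 0 < R) (hs : R < s) :
    cubeLaw d R {w | ∃ j, s ≤ |w j|} = 0 := by
  have := isProbabilityMeasure_cubeLaw (d := d) hR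
  refine measure_mono_null (t := {w | ∀ i, w i ∈ Icc (-R) R}ᶜ) ?_ ?_
  · rintro w ⟨j, hj⟩ hw
    have := abs_le.2 (hw j)
    linarith
  · rw [prob_compl_eq_zero_iff (measurableSet_box fun _ => measurableSet_Icc)]
    exact cubeLaw_Icc hR

lemma cubeWeight_pos (lam : ℝ) (m : ℕ) : 0 < cubeWeight lam m := by
  unfold cubeWeight; positivity

/-- The sum of the series of inverse squares. -/
noncomputable def inverseSquareSum : ℝ := ∑' m : ℕ, 1 / ((m : ℝ) + 1) ^ 2

lemma summable_inverseSquare : Summable fun m : ℕ => 1 / ((m : ℝ) + 1) ^ 2 := by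
  have h := (summable_nat_add_iff 1).2 (Real.summable_one_div_nat_pow.2 one_lt_two)
  simpa using h

lemma cubeMix_le {A : Set (EuclideanSpace ℝ (Fin d))} (hA : MeasurableSet A) {B : ℝ}
    (hB : 0 ≤ B)
    (h : ∀ m : ℕ, ENNReal.ofReal (cubeWeight lam m) * cubeLaw d (Real.exp m) A ≤
      ENNReal.ofReal (B * (1 / ((m : ℝ) + 1) ^ 2))) :
    cubeMix d lam A ≤ ENNReal.ofReal (B * inverseSquareSum) := by
  rw [cubeMix, Measure.sum_apply _ hA, inverseSquareSum, ← tsum_mul_left,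
    ENNReal.ofReal_tsum_of_nonneg (fun m => by positivity) (summable_inverseSquare.mul_left B)]
  exact ENNReal.tsum_le_tsum h

lemma le_cubeMix (A : Set (EuclideanSpace ℝ (Fin d))) (m : ℕ) :
    ENNReal.ofReal (cubeWeight lam m) * cubeLaw d (Real.exp m) A ≤ cubeMix d lam A :=
  (ENNReal.le_tsum m).trans (Measure.le_sum_apply _ A)

lemma cubeMix_univ_ne_top (hlam : 0 < lam) : cubeMix d lam univ ≠ ∞ := by
  refine ne_top_of_le_ne_top ENNReal.ofReal_ne_top
    (cubeMix_le MeasurableSet.univ zero_le_one fun m => ?_)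
  have := isProbabilityMeasure_cubeLaw (d := d) (Real.exp_pos m)
  rw [measure_univ, mul_one, one_mul]
  refine ENNReal.ofReal_le_ofReal ?_
  unfold cubeWeight
  have hm : (0 : ℝ) ≤ m := Nat.cast_nonneg m
  refine div_le_div₀ zero_le_one (Real.exp_le_one_iff.2 (by nlinarith)) (by positivity) ?_
  exact pow_le_pow_right₀ (by linarith) (by norm_num)

lemma cubeMix_univ_ne_zero (d : ℕ) (lam : ℝ) : cubeMix d lam univ ≠ 0 := by
  have := isProbabilityMeasure_cubeLaw (d := d) (Real.exp_pos (0 : ℕ))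
  have h := le_cubeMix (d := d) (lam := lam) univ 0
  rw [measure_univ, mul_one] at h
  intro h0
  rw [h0, nonpos_iff_eq_zero, ENNReal.ofReal_eq_zero] at h
  exact absurd h (not_le.2 (cubeWeight_pos lam 0))

lemma measurableSet_exists_le_abs (s : ℝ) :
    MeasurableSet {w : EuclideanSpace ℝ (Fin d) | ∃ j, s ≤ |w j|} := by
  have : {w : EuclideanSpace ℝ (Fin d) | ∃ j, s ≤ |w j|} = ⋃ j, {w | s ≤ |w j|} := by
    ext w; simp
  rw [this]
  exact MeasurableSet.iUnion fun j => measurableSet_le_abs_coord j s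

/-- One of the three factors `m + 1` in the weight is spent on the gain `1 / (1 + log s)`; the other
two keep the series over `m` summable. -/
lemma cubeWeight_le_of_le_exp (hlam : 0 < lam) {s : ℝ} (hs : 1 ≤ s) {m : ℕ}
    (hm : s ≤ Real.exp m) :
    cubeWeight lam m ≤ s ^ (-lam) / (1 + Real.log s) * (1 / ((m : ℝ) + 1) ^ 2) := by
  have hs0 : 0 < s := by linarith
  have hlog : Real.log s ≤ m := by rw [← Real.log_exp m]; exact Real.log_le_log hs0 hm
  have hlog0 : 0 ≤ Real.log s := Real.log_nonneg hs
  have hexp : Real.exp (-(lam * m)) ≤ s ^ (-lam) := by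
    rw [Real.rpow_def_of_pos hs0, Real.exp_le_exp]
    nlinarith
  have h1 : cubeWeight lam m = Real.exp (-(lam * m)) / (m + 1) * (1 / ((m : ℝ) + 1) ^ 2) := by
    unfold cubeWeight
    rw [div_mul_div_comm, mul_one, ← pow_succ']
  rw [h1]
  refine mul_le_mul_of_nonneg_right ?_ (by positivity)
  exact div_le_div₀ (Real.rpow_nonneg hs0.le _) hexp (by positivity) (by linarith)

lemma cubeMix_tail (hlam : 0 < lam) {s : ℝ} (hs : 1 ≤ s) :
    cubeMix d lam {w | ∃ j, s ≤ |w j|} ≤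
      ENNReal.ofReal (s ^ (-lam) / (1 + Real.log s) * inverseSquareSum) := by
  have hlog0 : 0 ≤ Real.log s := Real.log_nonneg hs
  have hs0 : 0 ≤ s := by linarith
  refine cubeMix_le (measurableSet_exists_le_abs s) (by positivity) fun m => ?_
  rcases lt_or_ge (Real.exp m) s with h | h
  · rw [cubeLaw_eq_zero (Real.exp_pos m) h, mul_zero]
    exact bot_le
  · have := isProbabilityMeasure_cubeLaw (d := d) (Real.exp_pos m)
    calc _ ≤ ENNReal.ofReal (cubeWeight lam m) * 1 := by gcongr; exact prob_le_one
      _ ≤ _ := by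
        rw [mul_one]
        exact ENNReal.ofReal_le_ofReal (cubeWeight_le_of_le_exp hlam hs h)

/-- The reason the cubes leave no trace on the heavy scale: their tail is smaller than that of an
excess measure by a logarithm. -/
lemma tendsto_cubeMix_tail (hlam : 0 < lam) :
    Tendsto (fun s : ℝ => s ^ lam * (cubeMix d lam).real {w | ∃ j, s ≤ |w j|}) atTop (𝓝 0) := by
  have hlim : Tendsto (fun s : ℝ => inverseSquareSum / (1 + Real.log s)) atTop (𝓝 0) :=
    (tendsto_atTop_add_const_left _ _ Real.tendsto_log_atTop).const_div_atTop _
  refine tendsto_of_tendsto_of_tendsto_of_le_of_le' tendsto_const_nhds hlim ?_ ?_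
  · filter_upwards [eventually_ge_atTop 0] with s hs
    exact mul_nonneg (Real.rpow_nonneg hs _) measureReal_nonneg
  · filter_upwards [eventually_ge_atTop 1] with s hs
    have hs0 : 0 < s := by linarith
    have hlog0 : 0 ≤ Real.log s := Real.log_nonneg hs
    have hK : 0 ≤ inverseSquareSum := tsum_nonneg fun m => by positivity
    have h := ENNReal.toReal_mono ENNReal.ofReal_ne_top (cubeMix_tail (d := d) hlam hs)
    rw [ENNReal.toReal_ofReal (by positivity)] at h
    calc s ^ lam * (cubeMix d lam).real {w | ∃ j, s ≤ |w j|}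
        ≤ s ^ lam * (s ^ (-lam) / (1 + Real.log s) * inverseSquareSum) := by gcongr; exact h
      _ = (s ^ lam * s ^ (-lam)) * inverseSquareSum / (1 + Real.log s) := by ring
      _ = _ := by
        rw [← Real.rpow_add hs0, add_neg_cancel, Real.rpow_zero, one_mul]

end CubeMix

/-! ### The perturbed excess measure -/

section PerturbedLaw

variable {d : ℕ} {lam : ℝ} {ρ : Measure (EuclideanSpace ℝ (Fin d))}

/-- The points whose coordinates are all of about the same size. -/
def balancedCone (d : ℕ) (R : ℝ) : Set (EuclideanSpace ℝ (Fin d)) :=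
  {w | (∀ i, R ≤ |w i|) ∧ ∀ i j, |w j| ≤ |w i| * Real.log |w i|}

lemma measurableSet_balancedCone (R : ℝ) : MeasurableSet (balancedCone d R) := by
  have : balancedCone d R = (⋂ i, {w | R ≤ |w i|}) ∩
      ⋂ i, ⋂ j, {w | |w j| ≤ |w i| * Real.log |w i|} := by
    ext w; simp [balancedCone]
  rw [this]
  refine (MeasurableSet.iInter fun i => measurableSet_le_abs_coord i R).inter
    (MeasurableSet.iInter fun i => MeasurableSet.iInter fun j => ?_)
  have hi : ∀ i : Fin d, Measurable fun w : EuclideanSpace ℝ (Fin d) => |w i| :=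
    fun i => (measurable_coord i).abs
  exact measurableSet_le (hi j) ((hi i).mul (Real.measurable_log.comp (hi i)))

/-- Dilation keeps the ratios `|w j| / |w i|` fixed, whereas the permitted ratio `log (r |w i|)`
grows without bound. -/
lemma eventually_smul_mem_balancedCone (R : ℝ) {w : EuclideanSpace ℝ (Fin d)}
    (hw : ∀ i, w i ≠ 0) : ∀ᶠ r : ℝ in atTop, r • w ∈ balancedCone d R := by
  have hinf : ∀ i, Tendsto (fun r : ℝ => r * |w i|) atTop atTop := fun i =>
    tendsto_id.atTop_mul_const (abs_pos.2 (hw i))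
  have h1 : ∀ᶠ r : ℝ in atTop, ∀ i, R ≤ r * |w i| :=
    eventually_all.2 fun i => (hinf i).eventually_ge_atTop R
  have h2 : ∀ᶠ r : ℝ in atTop, ∀ i j, |w j| ≤ |w i| * Real.log (r * |w i|) := by
    refine eventually_all.2 fun i => eventually_all.2 fun j => ?_
    exact ((Real.tendsto_log_atTop.comp (hinf i)).const_mul_atTop
      (abs_pos.2 (hw i))).eventually_ge_atTop _
  filter_upwards [h1, h2, eventually_gt_atTop 0] with r h3 h4 hr
  have habs : ∀ i, |(r • w) i| = r * |w i| := fun i => by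
    rw [PiLp.smul_apply, smul_eq_mul, abs_mul, abs_of_pos hr]
  refine ⟨fun i => by rw [habs]; exact h3 i, fun i j => ?_⟩
  rw [habs, habs, mul_assoc]
  exact mul_le_mul_of_nonneg_left (h4 i j) hr.le

/-- The part of the excess measure `ρ` on a balanced cone, completed to a probability measure by
a mixture of uniform distributions on cubes. -/
noncomputable def perturbedLaw (lam : ℝ) (ρ : Measure (EuclideanSpace ℝ (Fin d))) :
    Measure (EuclideanSpace ℝ (Fin d)) :=
  ρ.restrict (balancedCone d (4 ^ lam⁻¹)) +
    ((1 - ρ (balancedCone d (4 ^ lam⁻¹))) / cubeMix d lam univ) • cubeMix d lam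

lemma one_le_four_rpow (hlam : 0 < lam) : (1 : ℝ) ≤ 4 ^ lam⁻¹ :=
  Real.one_le_rpow (by norm_num) (inv_pos.2 hlam).le

/-- The radius `4 ^ (1/λ)` is chosen so that a single coordinate slab already has mass `2 / 4`. At
least half of the total mass then remains for the cubes. -/
lemma measure_balancedCone_le (hlam : 0 < lam) (hρ : IsExcessMeasure lam ρ)
    (hm : ∀ i, ρ {w | 1 ≤ |w i|} = 2) (hd : 1 ≤ d) :
    ρ (balancedCone d (4 ^ lam⁻¹)) ≤ ENNReal.ofReal (1 / 2) := by
  set i : Fin d := ⟨0, hd⟩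
  have hR : (0 : ℝ) < 4 ^ lam⁻¹ := by positivity
  refine (measure_mono (t := {w | 4 ^ lam⁻¹ ≤ |w i|}) fun w hw => hw.1 i).trans ?_
  rw [← ofReal_measureReal (hρ.ne_top_of_coord i hR)]
  refine ENNReal.ofReal_le_ofReal ?_
  rw [hρ.real_abs_coord i hR, measureReal_def, hm, ← Real.rpow_mul (by norm_num),
    show lam⁻¹ * -lam = -1 by field_simp, Real.rpow_neg_one]
  norm_num

/-- The weight of the cubes in the perturbed excess measure is positive and finite. -/
lemma perturbedLaw_weight (hlam : 0 < lam) (hρ : IsExcessMeasure lam ρ)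
    (hm : ∀ i, ρ {w | 1 ≤ |w i|} = 2) (hd : 1 ≤ d) :
    (1 - ρ (balancedCone d (4 ^ lam⁻¹))) / cubeMix d lam univ ≠ 0 ∧
      (1 - ρ (balancedCone d (4 ^ lam⁻¹))) / cubeMix d lam univ ≠ ∞ := by
  have h := measure_balancedCone_le hlam hρ hm hd
  refine ⟨?_, ENNReal.div_ne_top (ne_top_of_le_ne_top ENNReal.one_ne_top tsub_le_self)
    (cubeMix_univ_ne_zero d lam)⟩
  refine ENNReal.div_ne_zero.2 ⟨?_, cubeMix_univ_ne_top hlam⟩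
  rw [Ne, tsub_eq_zero_iff_le, not_le]
  refine h.trans_lt ?_
  rw [← ENNReal.ofReal_one, ENNReal.ofReal_lt_ofReal_iff one_pos]
  norm_num

lemma isProbabilityMeasure_perturbedLaw (hlam : 0 < lam) (hρ : IsExcessMeasure lam ρ)
    (hm : ∀ i, ρ {w | 1 ≤ |w i|} = 2) (hd : 1 ≤ d) :
    IsProbabilityMeasure (perturbedLaw lam ρ) := by
  constructor
  have h := measure_balancedCone_le hlam hρ hm hd
  rw [perturbedLaw, Measure.add_apply, Measure.restrict_apply_univ, Measure.smul_apply,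
    smul_eq_mul, ENNReal.div_mul_cancel (cubeMix_univ_ne_zero d lam) (cubeMix_univ_ne_top hlam)]
  refine add_tsub_cancel_of_le (h.trans ?_)
  rw [← ENNReal.ofReal_one]
  exact ENNReal.ofReal_le_ofReal (by norm_num)

/-- The perturbed excess measure rescales to the excess measure. -/
theorem tendsto_integral_perturbedLaw (hlam : 0 < lam) (hρ : IsExcessMeasure lam ρ)
    (hm : ∀ i, ρ {w | 1 ≤ |w i|} = 2) (hd : 1 ≤ d) (hplanes : ∀ i, ρ {w | w i = 0} = 0)
    {ι : Type*} {l : Filter ι} [l.IsCountablyGenerated] {r : ι → ℝ} (hr : Tendsto r l atTop)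
    {φ : ι → EuclideanSpace ℝ (Fin d) → ℝ} {φ₀ : EuclideanSpace ℝ (Fin d) → ℝ}
    (hφm : ∀ i, Measurable (φ i)) {M : ℝ} (hM : ∀ i w, |φ i w| ≤ M) {δ : ℝ} (hδ : 0 < δ)
    (hφδ : ∀ᶠ i in l, ∀ w, (∀ j, |w j| < δ) → φ i w = 0)
    (hlim : ∀ᵐ w ∂ρ, Tendsto (fun i => φ i w) l (𝓝 (φ₀ w))) :
    Tendsto (fun i => r i ^ lam * ∫ w, φ i ((r i)⁻¹ • w) ∂(perturbedLaw lam ρ)) l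
      (𝓝 (∫ w, φ₀ w ∂ρ)) := by
  -- The sign of `M` is read off from one `φ i₀`; with no index the filter is `⊥`.
  rcases isEmpty_or_nonempty ι with hι | ⟨⟨i₀⟩⟩
  · rw [l.filter_eq_bot_of_isEmpty]
    exact tendsto_bot
  have hM0 : 0 ≤ M := (abs_nonneg _).trans (hM i₀ 0)
  have := isProbabilityMeasure_perturbedLaw hlam hρ hm hd
  obtain ⟨ha0, ha1⟩ := perturbedLaw_weight hlam hρ hm hd
  set a := (1 - ρ (balancedCone d (4 ^ lam⁻¹))) / cubeMix d lam univ with ha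
  set S := balancedCone d (4 ^ lam⁻¹) with hS
  have hSm : MeasurableSet S := measurableSet_balancedCone _
  have hfinS : IsFiniteMeasure (ρ.restrict S) := ⟨by
    rw [Measure.restrict_apply_univ]
    exact (measure_balancedCone_le hlam hρ hm hd).trans_lt ENNReal.ofReal_lt_top⟩
  have hfinC : IsFiniteMeasure (cubeMix d lam) := ⟨(cubeMix_univ_ne_top hlam).lt_top⟩
  have hsm : ∀ i, Measurable fun w => φ i ((r i)⁻¹ • w) := fun i =>
    (hφm i).comp (measurable_const_smul _)
  have hsplit : ∀ i, ∫ w, φ i ((r i)⁻¹ • w) ∂(perturbedLaw lam ρ) =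
      ∫ w in S, φ i ((r i)⁻¹ • w) ∂ρ +
        a.toReal * ∫ w, φ i ((r i)⁻¹ • w) ∂(cubeMix d lam) := by
    intro i
    have hI : ∀ μ : Measure (EuclideanSpace ℝ (Fin d)), IsFiniteMeasure μ →
        Integrable (fun w => φ i ((r i)⁻¹ • w)) μ := fun μ _ =>
      Integrable.of_bound (hsm i).aestronglyMeasurable M (ae_of_all _ fun w => hM i _)
    rw [perturbedLaw, integral_add_measure (hI _ hfinS) ((hI _ hfinC).smul_measure ha1),
      integral_smul_measure, smul_eq_mul]
  -- Scaling invariance of `ρ` moves the dilation into the indicator of the cone, which tends to `1`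
  -- off the coordinate planes. The dominating function is `M` on the points having some coordinate
  -- of size at least `δ`, a set of finite mass.
  have hmain : Tendsto (fun i => r i ^ lam * ∫ w in S, φ i ((r i)⁻¹ • w) ∂ρ) l
      (𝓝 (∫ w, φ₀ w ∂ρ)) := by
    have hcv : ∀ᶠ i in l, r i ^ lam * ∫ w in S, φ i ((r i)⁻¹ • w) ∂ρ =
        ∫ w, S.indicator (fun _ => (1 : ℝ)) (r i • w) * φ i w ∂ρ := by
      filter_upwards [hr.eventually_gt_atTop 0] with i hi
      have hmeas : Measurable fun w : EuclideanSpace ℝ (Fin d) =>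
          S.indicator (fun _ => (1 : ℝ)) (r i • w) * φ i w :=
        ((measurable_const.indicator hSm).comp (measurable_const_smul _)).mul (hφm i)
      rw [← hρ.integral_smul hi hmeas, ← integral_indicator hSm]
      congr 2 with w
      rw [smul_inv_smul₀ hi.ne']
      by_cases hw : w ∈ S <;> simp [hw]
    refine Tendsto.congr' (hcv.mono fun i hi => hi.symm) ?_
    refine tendsto_integral_filter_of_dominated_convergence
      ({w : EuclideanSpace ℝ (Fin d) | ∃ j, δ ≤ |w j|}.indicator fun _ => M) ?_ ?_ ?_ ?_
    · refine Eventually.of_forall fun i => ?_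
      exact (((measurable_const.indicator hSm).comp (measurable_const_smul _)).mul
        (hφm i)).aestronglyMeasurable
    · filter_upwards [hφδ] with i hi
      refine ae_of_all _ fun w => ?_
      by_cases hw : ∃ j, δ ≤ |w j|
      · rw [indicator_of_mem (s := {w : EuclideanSpace ℝ (Fin d) | ∃ j, δ ≤ |w j|}) hw, norm_mul, Real.norm_eq_abs (φ i w)]
        have h1 : ‖S.indicator (fun _ => (1 : ℝ)) (r i • w)‖ ≤ 1 := by
          by_cases h : r i • w ∈ S <;> simp [h]
        exact (mul_le_mul h1 (hM i w) (abs_nonneg _) zero_le_one).trans_eq (one_mul M)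
      · rw [indicator_of_notMem (s := {w : EuclideanSpace ℝ (Fin d) | ∃ j, δ ≤ |w j|}) hw]
        push Not at hw
        rw [hi w hw, mul_zero, norm_zero]
    · rw [integrable_indicator_iff (measurableSet_exists_le_abs δ)]
      refine integrableOn_const (hs := ?_)
      refine ne_top_of_le_ne_top (hρ.finite_away δ hδ).ne (measure_mono ?_)
      rintro w ⟨j, hj⟩
      exact hj.trans (abs_coord_le_norm w j)
    · have hne : ∀ᵐ w ∂ρ, ∀ i, w i ≠ 0 := by
        refine ae_all_iff.2 fun i => ?_
        rw [ae_iff]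
        simpa using hplanes i
      filter_upwards [hlim, hne] with w hw1 hw2
      refine hw1.congr' ?_
      filter_upwards [hr.eventually (eventually_smul_mem_balancedCone (4 ^ lam⁻¹) hw2)] with i hi
      rw [indicator_of_mem (by exact hi), one_mul]
  -- The integrand vanishes unless some `|w j| ≥ r δ`, so the negligible tail of the cubes bounds
  -- this part.
  have hrest : Tendsto (fun i => r i ^ lam *
      (a.toReal * ∫ w, φ i ((r i)⁻¹ • w) ∂(cubeMix d lam))) l (𝓝 0) := by
    have htail := ((tendsto_cubeMix_tail (d := d) hlam).comp
      (hr.atTop_mul_const hδ)).const_mul (a.toReal * M * δ ^ (-lam))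
    rw [mul_zero] at htail
    refine squeeze_zero_norm' ?_ htail
    filter_upwards [hφδ, hr.eventually_gt_atTop 0] with i hi hri
    set T : Set (EuclideanSpace ℝ (Fin d)) := {w | ∃ j, r i * δ ≤ |w j|} with hT
    have hTm : MeasurableSet T := measurableSet_exists_le_abs _
    have hbound : ‖∫ w, φ i ((r i)⁻¹ • w) ∂(cubeMix d lam)‖ ≤ M * (cubeMix d lam).real T := by
      have h0 : ∫ w, φ i ((r i)⁻¹ • w) ∂(cubeMix d lam) =
          ∫ w in T, φ i ((r i)⁻¹ • w) ∂(cubeMix d lam) := by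
        refine (setIntegral_eq_integral_of_forall_compl_eq_zero fun w hw => hi _ fun j => ?_).symm
        have h1 : ¬ (r i * δ ≤ |w j|) := fun h => hw ⟨j, h⟩
        push Not at h1
        rw [PiLp.smul_apply, smul_eq_mul, abs_mul, abs_inv, abs_of_pos hri, ← div_eq_inv_mul,
          div_lt_iff₀ hri]
        linarith
      rw [h0]
      exact norm_setIntegral_le_of_norm_le_const (measure_lt_top _ _) fun w _ => hM i _
    rw [norm_mul, norm_mul, Real.norm_of_nonneg (Real.rpow_nonneg hri.le _),
      Real.norm_of_nonneg ENNReal.toReal_nonneg]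
    calc r i ^ lam * (a.toReal * ‖∫ w, φ i ((r i)⁻¹ • w) ∂(cubeMix d lam)‖)
        ≤ r i ^ lam * (a.toReal * (M * (cubeMix d lam).real T)) := by gcongr
      _ = a.toReal * M * δ ^ (-lam) * ((r i * δ) ^ lam * (cubeMix d lam).real T) := by
          rw [Real.mul_rpow hri.le hδ.le, Real.rpow_neg hδ.le]
          have : δ ^ lam ≠ 0 := (Real.rpow_pos_of_pos hδ _).ne'
          field_simp
  have hfin := hmain.add hrest
  rw [add_zero] at hfin
  refine hfin.congr fun i => ?_
  rw [hsplit, mul_add]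

end PerturbedLaw

/-! ### The heavy-tailed distribution -/

section MetaMap

variable {d : ℕ} {F G P : ℝ → ℝ}

lemma IsSymmCDF.measurable_metaMap (hF : IsSymmCDF F) (hP : IsSymmCDF P) :
    Measurable (metaMap F P : EuclideanSpace ℝ (Fin d) → EuclideanSpace ℝ (Fin d)) :=
  (WithLp.measurable_toLp 2 _).comp (measurable_pi_iff.2 fun i =>
    (hF.measurable_metaComponent hP).comp (measurable_coord i))

lemma metaMap_apply (x : EuclideanSpace ℝ (Fin d)) (i : Fin d) :
    metaMap F P x i = metaComponent F P (x i) := rfl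

/-- Pulled back to `ν`, both boxes are the set where `P (w i) ≤ G (x i)` for all `i`. -/
lemma jointCDF_map_metaMap (hF : IsSymmCDF F) (hG : IsSymmCDF G) (hP : IsSymmCDF P)
    (ν : Measure (EuclideanSpace ℝ (Fin d))) :
    jointCDF (ν.map (metaMap G P)) = jointCDF (ν.map (metaMap F P)) ∘ metaMap F G := by
  have hbox : ∀ x : EuclideanSpace ℝ (Fin d),
      MeasurableSet {z : EuclideanSpace ℝ (Fin d) | ∀ i, z i ≤ x i} := fun x =>
    measurableSet_box fun i => measurableSet_Iic
  funext x
  rw [Function.comp_apply, jointCDF, jointCDF,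
    map_measureReal_apply (hG.measurable_metaMap hP) (hbox _),
    map_measureReal_apply (hF.measurable_metaMap hP) (hbox _)]
  congr 1
  ext w
  refine forall_congr' fun i => ?_
  rw [metaMap_apply, metaMap_apply, metaMap_apply, hG.metaComponent_le_iff hP,
    hF.metaComponent_le_iff hP, hF.apply_metaComponent hG]

lemma marginal_map_metaMap (hF : IsSymmCDF F) (hP : IsSymmCDF P)
    (ν : Measure (EuclideanSpace ℝ (Fin d))) (i : Fin d) {B : Set ℝ} (hB : MeasurableSet B) :
    marginal (ν.map (metaMap F P)) i B = ν {w | metaComponent F P (w i) ∈ B} := by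
  rw [marginal, Measure.map_apply (measurable_coord i) hB,
    Measure.map_apply (hF.measurable_metaMap hP) (measurable_coord i hB)]
  rfl

end MetaMap

/-! ### Marginals of the perturbed law and of its heavy-tailed image -/

section Marginals

variable {d : ℕ} {lam : ℝ} {ρ : Measure (EuclideanSpace ℝ (Fin d))} {F : ℝ → ℝ}

lemma cubeMix_coord_eq (i : Fin d) (t : ℝ) : cubeMix d lam {w | w i = t} = 0 := by
  rw [cubeMix, Measure.sum_apply_eq_zero]
  intro m
  rw [Measure.smul_apply]
  have h := cubeLaw_box (d := d) (Real.exp_pos m)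
    (B := fun j => if j = i then {t} else univ) (fun j => by split_ifs <;> measurability)
  have hset : {w : EuclideanSpace ℝ (Fin d) | ∀ j, w j ∈ if j = i then ({t} : Set ℝ) else univ} =
      {w | w i = t} := by
    ext w
    simp only [mem_ofPred_eq]
    refine ⟨fun h => by simpa using h i, fun h j => ?_⟩
    split_ifs with hj
    · rw [hj]; exact h
    · trivial
  rw [hset] at h
  rw [h, Finset.prod_eq_zero (Finset.mem_univ i), smul_zero]
  rw [if_pos rfl, measure_mono_null inter_subset_left Real.volume_singleton, mul_zero]

lemma perturbedLaw_coord_eq (hρ : ∀ t, ∀ i, ρ {w | w i = t} = 0) (i : Fin d) (t : ℝ) :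
    perturbedLaw lam ρ {w | w i = t} = 0 := by
  rw [perturbedLaw, Measure.add_apply, Measure.smul_apply, cubeMix_coord_eq, smul_zero, add_zero]
  exact nonpos_iff_eq_zero.1 ((Measure.restrict_apply_le _ _).trans_eq (hρ t i))

/-- Every bounded interval lies inside the side of a large cube. Thus the cubes, which reach every
scale, make the marginal dfs strictly increasing. -/
lemma cubeMix_coord_Ioc (i : Fin d) {a b : ℝ} (hab : a < b) :
    cubeMix d lam {w | w i ∈ Ioc a b} ≠ 0 := by
  obtain ⟨m, hm⟩ := exists_nat_ge (max |a| |b|)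
  have hexp : max |a| |b| ≤ Real.exp m := by linarith [Real.add_one_le_exp (m : ℝ)]
  have ha := abs_le.1 ((le_max_left _ _).trans hexp)
  have hb := abs_le.1 ((le_max_right _ _).trans hexp)
  have h := cubeLaw_box (d := d) (Real.exp_pos m)
    (B := fun j => if j = i then Ioc a b else univ) (fun j => by split_ifs <;> measurability)
  have hset : {w : EuclideanSpace ℝ (Fin d) | ∀ j, w j ∈ if j = i then Ioc a b else univ} =
      {w | w i ∈ Ioc a b} := by
    ext w
    simp only [mem_ofPred_eq]
    refine ⟨fun h => by simpa using h i, fun h j => ?_⟩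
    split_ifs with hj
    · rw [hj]; exact h
    · trivial
  rw [hset] at h
  intro h0
  have h1 := (le_cubeMix (lam := lam) {w : EuclideanSpace ℝ (Fin d) | w i ∈ Ioc a b} m).trans h0.le
  rw [nonpos_iff_eq_zero, mul_eq_zero, ENNReal.ofReal_eq_zero] at h1
  refine h1.elim (fun h2 => absurd h2 (not_le.2 (cubeWeight_pos lam m))) fun h2 => ?_
  rw [h, Finset.prod_eq_zero_iff] at h2
  obtain ⟨j, -, hj⟩ := h2
  rw [mul_eq_zero, ENNReal.inv_eq_zero] at hj
  refine hj.elim (fun h => ENNReal.ofReal_ne_top h) fun h3 => ?_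
  have hexp0 := Real.exp_pos (m : ℝ)
  split_ifs at h3
  · have hsub : Ioc a b ⊆ Icc (-Real.exp m) (Real.exp m) := fun x hx =>
      ⟨by linarith [hx.1, ha.1], by linarith [hx.2, hb.2]⟩
    rw [inter_eq_left.2 hsub, Real.volume_Ioc, ENNReal.ofReal_eq_zero] at h3
    linarith
  · rw [univ_inter, Real.volume_Icc, ENNReal.ofReal_eq_zero] at h3
    linarith

lemma perturbedLaw_coord_Ioc (hlam : 0 < lam) (hρ : IsExcessMeasure lam ρ)
    (hm : ∀ i, ρ {w | 1 ≤ |w i|} = 2) (hd : 1 ≤ d) (i : Fin d) {a b : ℝ} (hab : a < b) :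
    perturbedLaw lam ρ {w | w i ∈ Ioc a b} ≠ 0 := by
  intro h0
  rw [perturbedLaw, Measure.add_apply, Measure.smul_apply, smul_eq_mul, add_eq_zero,
    mul_eq_zero] at h0
  exact h0.2.elim (perturbedLaw_weight hlam hρ hm hd).1 (cubeMix_coord_Ioc i hab)

lemma tendsto_perturbedLaw_coord (hlam : 0 < lam) (hρ : IsExcessMeasure lam ρ)
    (hm : ∀ i, ρ {w | 1 ≤ |w i|} = 2) (hd : 1 ≤ d) (hplanes : ∀ i, ρ {w | w i = 0} = 0)
    (i : Fin d) {B : Set ℝ} (hB : MeasurableSet B) (hB1 : ∀ t ∈ B, 1 ≤ |t|) :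
    Tendsto (fun s : ℝ => s ^ lam * (perturbedLaw lam ρ).real {w | s⁻¹ * w i ∈ B}) atTop
      (𝓝 (ρ.real {w | w i ∈ B})) := by
  have hBm : MeasurableSet {w : EuclideanSpace ℝ (Fin d) | w i ∈ B} := measurable_coord i hB
  have h := tendsto_integral_perturbedLaw hlam hρ hm hd hplanes (l := atTop) (r := id)
    tendsto_id
    (φ := fun _ => {w : EuclideanSpace ℝ (Fin d) | w i ∈ B}.indicator fun _ => (1 : ℝ))
    (φ₀ := {w : EuclideanSpace ℝ (Fin d) | w i ∈ B}.indicator fun _ => (1 : ℝ)) (M := 1)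
    (fun _ => measurable_const.indicator hBm)
    (fun _ w => by by_cases h : w i ∈ B <;> simp [h]) (δ := 1) one_pos
    (Eventually.of_forall fun _ w hw =>
      indicator_of_notMem (s := {w : EuclideanSpace ℝ (Fin d) | w i ∈ B})
        (fun h => absurd (hB1 _ h) (not_le.2 (hw i))) _)
    (ae_of_all _ fun w => tendsto_const_nhds)
  rw [integral_indicator_const _ hBm, smul_eq_mul, mul_one] at h
  refine h.congr fun s => ?_
  congr 1
  have hsm : MeasurableSet {w : EuclideanSpace ℝ (Fin d) | s⁻¹ * w i ∈ B} :=
    ((measurable_coord i).const_mul _) hB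
  rw [← mul_one ((perturbedLaw lam ρ).real _), ← smul_eq_mul, ← integral_indicator_const _ hsm]
  rfl

lemma tendsto_rpow_mul_paretoTail (lam : ℝ) :
    Tendsto (fun s : ℝ => s ^ lam * (1 - paretoCDF lam s)) atTop (𝓝 1) := by
  have h1 : Tendsto (fun s : ℝ => 2 ^ lam⁻¹ / s + 1) atTop (𝓝 1) := by
    simpa using (tendsto_id.const_div_atTop ((2 : ℝ) ^ lam⁻¹)).add_const 1
  have h2 := h1.rpow_const (p := -lam) (Or.inl one_ne_zero)
  rw [Real.one_rpow] at h2
  refine h2.congr' ?_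
  filter_upwards [eventually_gt_atTop 0] with s hs
  have hk : (0 : ℝ) < 2 ^ lam⁻¹ := two_rpow_pos _
  rw [one_sub_paretoCDF hs.le, show (2 : ℝ) ^ lam⁻¹ / s + 1 = (2 ^ lam⁻¹ + s) / s by field_simp,
    Real.div_rpow (by positivity) hs.le, Real.rpow_neg hs.le, div_inv_eq_mul, mul_comm]

/-- The marginals of the heavy-tailed distribution. -/
theorem marginal_heavyLaw (hlam : 0 < lam) (hρ : IsExcessMeasure lam ρ)
    (hmarg : HasParetoMarginals lam ρ) (hd : 1 ≤ d) (hplanes : ∀ i, ρ {w | w i = 0} = 0)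
    (hF : IsSymmCDF F) (i : Fin d) :
    Continuous (cdf (marginal ((perturbedLaw lam ρ).map (metaMap F (paretoCDF lam))) i)) ∧
    StrictMono (cdf (marginal ((perturbedLaw lam ρ).map (metaMap F (paretoCDF lam))) i)) ∧
    TailAsymptotic (cdf (marginal ((perturbedLaw lam ρ).map (metaMap F (paretoCDF lam))) i)) F := by
  have hP := isSymmCDF_paretoCDF hlam
  have hm := hmarg.measure_one_le_abs hlam
  have hprob := isProbabilityMeasure_perturbedLaw hlam hρ hm hd
  have hprob1 : IsProbabilityMeasure ((perturbedLaw lam ρ).map (metaMap F (paretoCDF lam))) :=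
    Measure.isProbabilityMeasure_map (hF.measurable_metaMap hP).aemeasurable
  set μ := marginal ((perturbedLaw lam ρ).map (metaMap F (paretoCDF lam))) i with hμ
  have hprob2 : IsProbabilityMeasure μ :=
    Measure.isProbabilityMeasure_map (measurable_coord i).aemeasurable
  have happly : ∀ {B : Set ℝ}, MeasurableSet B →
      μ B = perturbedLaw lam ρ {w | metaComponent F (paretoCDF lam) (w i) ∈ B} := fun hB =>
    marginal_map_metaMap hF hP _ i hB
  have hnull : ∀ t, ∀ i, ρ {w | w i = t} = 0 := by
    intro t i
    rcases eq_or_ne t 0 with rfl | ht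
    · exact hplanes i
    · exact hmarg.measure_coord_eq i ht
  set q := metaComponent F (paretoCDF lam) with hq
  set q' := metaComponent (paretoCDF lam) F with hq'
  have hqq' : ∀ t, q (q' t) = t := fun t => hF.metaComponent_metaComponent hP t
  have hq'q : ∀ t, q' (q t) = t := fun t => hP.metaComponent_metaComponent hF t
  have hmono : StrictMono q := hF.metaComponent_strictMono hP
  have hmono' : StrictMono q' := hP.metaComponent_strictMono hF
  refine ⟨continuous_cdf fun t => ?_, strictMono_cdf fun a b hab => ?_, ?_⟩
  · rw [happly (measurableSet_singleton t)]
    refine measure_mono_null (fun w hw => ?_) (perturbedLaw_coord_eq hnull i (q' t))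
    have : q (w i) = t := hw
    change w i = q' t
    rw [← this, hq'q]
  · rw [happly measurableSet_Ioc]
    have h := perturbedLaw_coord_Ioc hlam hρ hm hd i (hmono' hab)
    convert h using 2
    ext w
    change (a < q (w i) ∧ q (w i) ≤ b) ↔ (q' a < w i ∧ w i ≤ q' b)
    rw [← hmono.lt_iff_lt (a := q' a), ← hmono.le_iff_le (b := q' b), hqq', hqq']
  · have hq'inf : Tendsto q' atTop atTop := by
      refine tendsto_atTop.2 fun B => ?_
      filter_upwards [eventually_ge_atTop (q B)] with t ht
      rw [← hq'q B]
      exact hmono'.monotone ht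
    -- With `s = q' t` one has `F t = P s`, so the tail ratio at `t` is the tail of the marginal of
    -- `ν` at `s` over the Pareto tail at `s`. Multiplied by `s ^ λ`, numerator and denominator both
    -- tend to `1`.
    have hden := (tendsto_rpow_mul_paretoTail lam).comp hq'inf
    have hFP : ∀ t, F t = paretoCDF lam (q' t) := fun t => (hP.apply_metaComponent hF t).symm
    have hq'neg : ∀ t, q' (-t) = -q' t := fun t => hP.metaComponent_neg hF t
    constructor
    · have hnum := (tendsto_perturbedLaw_coord hlam hρ hm hd hplanes i (B := Iic (-1))
        measurableSet_Iic fun t ht => le_abs.2 (Or.inr (by rw [mem_Iic] at ht; linarith))).comp hq'inf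
      have h1 : ρ.real {w | w i ∈ Iic (-1)} = 1 := by
        have hset : {w : EuclideanSpace ℝ (Fin d) | w i ∈ Iic (-1)} =
            {w | w i < -1} ∪ {w | w i = -1} := by
          ext w; exact le_iff_lt_or_eq (a := w i)
        rw [hset, measureReal_def, measure_congr (union_ae_eq_left_of_ae_eq_empty
          (ae_eq_empty.2 (hnull (-1) i))), hmarg.measure_lt_neg_one hlam, ENNReal.toReal_one]
      rw [h1] at hnum
      have h := hnum.div hden one_ne_zero
      rw [div_one] at h
      refine h.congr' ?_
      filter_upwards [hq'inf.eventually_gt_atTop 0] with t ht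
      simp only [Pi.div_apply, Function.comp_apply]
      rw [mul_div_mul_left _ _ (Real.rpow_pos_of_pos ht _).ne', hF.symm, ← hFP, cdf_eq_real,
        measureReal_def, measureReal_def, happly measurableSet_Iic]
      congr 3
      ext w
      change (q' t)⁻¹ * w i ≤ -1 ↔ q (w i) ≤ -t
      rw [← div_eq_inv_mul, div_le_iff₀ ht, neg_one_mul, ← hq'neg, ← hmono.le_iff_le, hqq']
    · have hnum := (tendsto_perturbedLaw_coord hlam hρ hm hd hplanes i (B := Ioi 1)
        measurableSet_Ioi fun t ht => le_abs.2 (Or.inl (le_of_lt ht))).comp hq'inf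
      have h1 : ρ.real {w | w i ∈ Ioi 1} = 1 := by
        have := hmarg.measure_one_lt hlam i
        rw [measureReal_def]
        change (ρ {w | 1 < w i}).toReal = 1
        rw [this, ENNReal.toReal_one]
      rw [h1] at hnum
      have h := hnum.div hden one_ne_zero
      rw [div_one] at h
      refine h.congr' ?_
      filter_upwards [hq'inf.eventually_gt_atTop 0] with t ht
      simp only [Pi.div_apply, Function.comp_apply]
      rw [mul_div_mul_left _ _ (Real.rpow_pos_of_pos ht _).ne', ← hFP, one_sub_cdf,
        measureReal_def, measureReal_def, happly measurableSet_Ioi]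
      congr 3
      ext w
      change 1 < (q' t)⁻¹ * w i ↔ t < q (w i)
      rw [← div_eq_inv_mul, lt_div_iff₀ ht, one_mul, ← hmono.lt_iff_lt, hqq']

end Marginals

/-! ### Convergence of the heavy-tailed sample clouds -/

section HeavyClouds

variable {d : ℕ} {lam : ℝ} {ρ : Measure (EuclideanSpace ℝ (Fin d))} {F : ℝ → ℝ}

lemma tendsto_natCast_rpow_inv (hlam : 0 < lam) :
    Tendsto (fun n : ℕ => (n : ℝ) ^ lam⁻¹) atTop atTop :=
  (tendsto_rpow_atTop (inv_pos.2 hlam)).comp tendsto_natCast_atTop_atTop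

lemma natCast_rpow_inv_rpow (hlam : 0 < lam) (n : ℕ) : ((n : ℝ) ^ lam⁻¹) ^ lam = n := by
  rw [← Real.rpow_mul (Nat.cast_nonneg n), inv_mul_cancel₀ hlam.ne', Real.rpow_one]

lemma tendsto_natCast_mul_paretoTail (hlam : 0 < lam) {t : ℝ} (ht : 0 < t) :
    Tendsto (fun n : ℕ => n * (1 - paretoCDF lam ((n : ℝ) ^ lam⁻¹ * t))) atTop
      (𝓝 (t ^ (-lam))) := by
  have h := ((tendsto_rpow_mul_paretoTail lam).comp
    ((tendsto_natCast_rpow_inv hlam).atTop_mul_const ht)).const_mul (t ^ (-lam))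
  rw [mul_one] at h
  refine h.congr fun n => ?_
  simp only [Function.comp_apply]
  rw [Real.mul_rpow (by positivity) ht.le, natCast_rpow_inv_rpow hlam, Real.rpow_neg ht.le]
  have : t ^ lam ≠ 0 := (Real.rpow_pos_of_pos ht _).ne'
  field_simp

/-- Asymptotic linearity of `F⁻¹ ∘ P`: the tail of `P` at `n ^ (1/λ) t` and that of `F` at `c_n y`,
multiplied by `n`, tend to `t ^ (-λ)` and `y ^ (-λ)`. Comparing these limits for `y` on either side
of `t` locates the quantile. -/
lemma tendsto_scaled_metaComponent (hlam : 0 < lam) (hF : IsSymmCDF F) {c : ℕ → ℝ}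
    (hc : ∀ n, 0 < c n)
    (hrv : ∀ x : ℝ, 0 < x → Tendsto (fun n : ℕ => n * (1 - F (c n * x))) atTop (𝓝 (x ^ (-lam))))
    {t : ℝ} (ht : 0 < t) :
    Tendsto (fun n : ℕ => (c n)⁻¹ * metaComponent F (paretoCDF lam) ((n : ℝ) ^ lam⁻¹ * t)) atTop
      (𝓝 t) := by
  have hP := isSymmCDF_paretoCDF hlam
  have hpar := tendsto_natCast_mul_paretoTail hlam ht
  refine tendsto_order.2 ⟨fun y hy => ?_, fun y hy => ?_⟩
  · have hz0 : 0 < max y (t / 2) := lt_max_of_lt_right (by linarith)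
    have hzt : max y (t / 2) < t := max_lt hy (by linarith)
    have hlt := Real.rpow_lt_rpow_of_neg hz0 hzt (neg_neg_of_pos hlam)
    filter_upwards [hpar.eventually_lt (hrv _ hz0) hlt, eventually_gt_atTop 0] with n hn hn0
    have hn0' : (0 : ℝ) < n := by exact_mod_cast hn0
    refine (le_max_left y (t / 2)).trans_lt ?_
    rw [← div_eq_inv_mul, lt_div_iff₀' (hc n), hF.lt_metaComponent_iff hP]
    have := lt_of_mul_lt_mul_left hn hn0'.le
    linarith
  · have hlt := Real.rpow_lt_rpow_of_neg ht hy (neg_neg_of_pos hlam)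
    filter_upwards [(hrv y (ht.trans hy)).eventually_lt hpar hlt, eventually_gt_atTop 0]
      with n hn hn0
    have hn0' : (0 : ℝ) < n := by exact_mod_cast hn0
    rw [← div_eq_inv_mul, div_lt_iff₀' (hc n), ← hF.strictMono.lt_iff_lt,
      hF.apply_metaComponent hP]
    have := lt_of_mul_lt_mul_left hn hn0'.le
    linarith

lemma tendsto_scaled_metaComponent_of_ne (hlam : 0 < lam) (hF : IsSymmCDF F) {c : ℕ → ℝ}
    (hc : ∀ n, 0 < c n)
    (hrv : ∀ x : ℝ, 0 < x → Tendsto (fun n : ℕ => n * (1 - F (c n * x))) atTop (𝓝 (x ^ (-lam))))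
    {t : ℝ} (ht : t ≠ 0) :
    Tendsto (fun n : ℕ => (c n)⁻¹ * metaComponent F (paretoCDF lam) ((n : ℝ) ^ lam⁻¹ * t)) atTop
      (𝓝 t) := by
  rcases ht.lt_or_gt with h | h
  · have h1 := (tendsto_scaled_metaComponent hlam hF hc hrv (neg_pos.2 h)).neg
    rw [neg_neg] at h1
    refine h1.congr fun n => ?_
    rw [mul_neg, hF.metaComponent_neg (isSymmCDF_paretoCDF hlam)]
    ring
  · exact tendsto_scaled_metaComponent hlam hF hc hrv h

lemma norm_le_of_abs_coord_le {w : EuclideanSpace ℝ (Fin d)} {B : ℝ} (hB : 0 ≤ B)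
    (h : ∀ j, |w j| ≤ B) : ‖w‖ ≤ d * B := by
  rw [EuclideanSpace.norm_eq]
  refine Real.sqrt_le_iff.2 ⟨by positivity, ?_⟩
  have h1 : ∑ j, ‖w j‖ ^ 2 ≤ ∑ _j : Fin d, B ^ 2 :=
    Finset.sum_le_sum fun j _ => pow_le_pow_left₀ (norm_nonneg _) (h j) 2
  rw [Finset.sum_const, Finset.card_univ, Fintype.card_fin, nsmul_eq_mul] at h1
  refine h1.trans ?_
  rw [mul_pow]
  refine mul_le_mul_of_nonneg_right ?_ (sq_nonneg B)
  exact_mod_cast Nat.le_self_pow two_ne_zero d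

/-- By scaling the shell `ε ≤ ‖w‖ < ε x` has mass proportional to `1 - x ^ (-λ)`, which tends to `0`
as `x` decreases to `1`. -/
lemma IsExcessMeasure.measure_sphere (hρ : IsExcessMeasure lam ρ) {ε : ℝ} (hε : 0 < ε) :
    ρ {w | ‖w‖ = ε} = 0 := by
  have hmeas : ∀ r : ℝ, MeasurableSet {w : EuclideanSpace ℝ (Fin d) | r ≤ ‖w‖} := fun r =>
    measurableSet_le measurable_const measurable_norm
  have hscale : ∀ x : ℝ, 1 ≤ x →
      ρ.real {w | ε * x ≤ ‖w‖} = ρ.real {w | ε ≤ ‖w‖} * x ^ (-lam) := by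
    intro x hx
    have hx0 : 0 < x := by linarith
    have hset : {w : EuclideanSpace ℝ (Fin d) | ε * x ≤ ‖w‖} =
        {w | x⁻¹ • w ∈ {w : EuclideanSpace ℝ (Fin d) | ε ≤ ‖w‖}} := by
      ext w
      simp only [mem_ofPred_eq, norm_smul, norm_inv, Real.norm_of_nonneg hx0.le]
      rw [← div_eq_inv_mul, le_div_iff₀ hx0]
    rw [hset, measureReal_def, hρ.measure_preimage_smul hx0 (hmeas ε), ENNReal.toReal_div,
      ENNReal.toReal_ofReal (Real.rpow_nonneg hx0.le _), Real.rpow_neg hx0.le, div_eq_mul_inv]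
    rfl
  have hle : ∀ᶠ x : ℝ in 𝓝[>] 1, ρ.real {w | ‖w‖ = ε} ≤
      ρ.real {w | ε ≤ ‖w‖} - ρ.real {w | ε ≤ ‖w‖} * x ^ (-lam) := by
    filter_upwards [self_mem_nhdsWithin] with x hx
    have hx1 : 1 < x := hx
    have hεx : ε < ε * x := by nlinarith
    have hfin1 : ρ {w | ‖w‖ = ε} ≠ ∞ := ne_top_of_le_ne_top (hρ.finite_away ε hε).ne
      (measure_mono fun w hw => le_of_eq (Eq.symm hw))
    have hfin2 : ρ {w | ε * x ≤ ‖w‖} ≠ ∞ := (hρ.finite_away _ (by positivity)).ne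
    have hdis : Disjoint {w : EuclideanSpace ℝ (Fin d) | ‖w‖ = ε} {w | ε * x ≤ ‖w‖} := by
      refine disjoint_left.2 fun w hw hw' => ?_
      have h1 : ‖w‖ = ε := hw
      have h2 : ε * x ≤ ‖w‖ := hw'
      linarith
    rw [← hscale x hx1.le, le_sub_iff_add_le, ← measureReal_union hdis (hmeas _) hfin1 hfin2]
    refine measureReal_mono (fun w hw => ?_) (hρ.finite_away ε hε).ne
    rcases hw with hw | hw
    · exact le_of_eq (Eq.symm hw)
    · exact hεx.le.trans hw
  have hlim : Tendsto (fun x : ℝ => ρ.real {w | ε ≤ ‖w‖} - ρ.real {w | ε ≤ ‖w‖} * x ^ (-lam))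
      (𝓝[>] 1) (𝓝 0) := by
    have h1 : Tendsto (fun x : ℝ => x ^ (-lam)) (𝓝[>] 1) (𝓝 1) := by
      have := (Real.continuousAt_rpow_const 1 (-lam) (Or.inl one_ne_zero)).tendsto
      rw [Real.one_rpow] at this
      exact this.mono_left nhdsWithin_le_nhds
    simpa using (h1.const_mul (ρ.real {w | ε ≤ ‖w‖})).const_sub (ρ.real {w | ε ≤ ‖w‖})
  have h0 : ρ.real {w | ‖w‖ = ε} ≤ 0 := ge_of_tendsto hlim hle
  have h1 := le_antisymm h0 measureReal_nonneg
  rw [measureReal_def, ENNReal.toReal_eq_zero_iff] at h1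
  exact h1.resolve_right (ne_top_of_le_ne_top (hρ.finite_away ε hε).ne
    (measure_mono fun w hw => le_of_eq (Eq.symm hw)))

/-- The mean measures of the scaled heavy-tailed sample clouds converge weakly away from the
origin. -/
lemma tendsto_setIntegral_heavyLaw (hlam : 0 < lam) (hρ : IsExcessMeasure lam ρ)
    (hm : ∀ i, ρ {w | 1 ≤ |w i|} = 2) (hd : 1 ≤ d) (hplanes : ∀ i, ρ {w | w i = 0} = 0)
    (hF : IsSymmCDF F) {c : ℕ → ℝ} (hc : ∀ n, 0 < c n)
    (hrv : ∀ x : ℝ, 0 < x → Tendsto (fun n : ℕ => n * (1 - F (c n * x))) atTop (𝓝 (x ^ (-lam))))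
    {ε : ℝ} (hε : 0 < ε) (φ : EuclideanSpace ℝ (Fin d) →ᵇ ℝ) :
    Tendsto (fun n : ℕ => (n : ℝ) * ∫ x in {w | ε ≤ ‖w‖}, φ x
      ∂(((perturbedLaw lam ρ).map (metaMap F (paretoCDF lam))).map fun z => (c n)⁻¹ • z)) atTop
      (𝓝 (∫ x in {w | ε ≤ ‖w‖}, φ x ∂ρ)) := by
  have hP := isSymmCDF_paretoCDF hlam
  set T : EuclideanSpace ℝ (Fin d) → EuclideanSpace ℝ (Fin d) := metaMap F (paretoCDF lam) with hT
  have hTm : Measurable T := hF.measurable_metaMap hP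
  set A : Set (EuclideanSpace ℝ (Fin d)) := {w | ε ≤ ‖w‖} with hA
  have hAm : MeasurableSet A := measurableSet_le measurable_const measurable_norm
  set g : EuclideanSpace ℝ (Fin d) → ℝ := A.indicator φ with hg
  have hgm : Measurable g := φ.continuous.measurable.indicator hAm
  have hscaled : ∀ n : ℕ, ∀ w : EuclideanSpace ℝ (Fin d), ∀ j,
      ((c n)⁻¹ • T (((n : ℝ) ^ lam⁻¹) • w)) j =
      (c n)⁻¹ * metaComponent F (paretoCDF lam) ((n : ℝ) ^ lam⁻¹ * w j) := fun n w j => rfl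
  -- If all `|w j| < δ`, the rescaled image eventually has coordinates below `2 δ`, hence norm at
  -- most `2 d δ < ε`.
  set δ : ℝ := ε / (2 * (d + 1)) with hδ
  have hδ0 : 0 < δ := by positivity
  have key := tendsto_integral_perturbedLaw hlam hρ hm hd hplanes
    (tendsto_natCast_rpow_inv hlam)
    (φ := fun n w => g ((c n)⁻¹ • T (((n : ℝ) ^ lam⁻¹) • w))) (φ₀ := g) (M := ‖φ‖) (δ := δ)
    (fun n => hgm.comp ((measurable_const_smul (c n)⁻¹).comp
      (hTm.comp (measurable_const_smul ((n : ℝ) ^ lam⁻¹)))))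
    (fun n w => by
      by_cases h : (c n)⁻¹ • T (((n : ℝ) ^ lam⁻¹) • w) ∈ A
      · rw [hg, indicator_of_mem h]; exact φ.norm_coe_le_norm _
      · rw [hg, indicator_of_notMem h, abs_zero]; exact norm_nonneg _) hδ0 ?_ ?_
  · rw [hg, integral_indicator hAm] at key
    refine key.congr' ?_
    filter_upwards [eventually_ne_atTop 0] with n hn
    have hn' : (n : ℝ) ^ lam⁻¹ ≠ 0 := by
      have : (0 : ℝ) < n := by exact_mod_cast Nat.pos_of_ne_zero hn
      exact (Real.rpow_pos_of_pos this _).ne'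
    rw [natCast_rpow_inv_rpow hlam, ← integral_indicator hAm,
      integral_map (by fun_prop) hgm.aestronglyMeasurable,
      integral_map hTm.aemeasurable (f := fun x => g ((c n)⁻¹ • x))
        (hgm.comp (measurable_const_smul _)).aestronglyMeasurable]
    congr 2 with w
    rw [smul_inv_smul₀ hn']
  · filter_upwards [(tendsto_scaled_metaComponent hlam hF hc hrv hδ0).eventually
      (gt_mem_nhds (show δ < 2 * δ by linarith))] with n hn w hw
    refine indicator_of_notMem (fun h => ?_) _
    have h1 : ‖(c n)⁻¹ • T (((n : ℝ) ^ lam⁻¹) • w)‖ ≤ d * (2 * δ) := by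
      refine norm_le_of_abs_coord_le (by positivity) fun j => ?_
      rw [hscaled, abs_mul, abs_of_pos (inv_pos.2 (hc n)), hF.abs_metaComponent hP, abs_mul,
        abs_of_nonneg (show (0 : ℝ) ≤ (n : ℝ) ^ lam⁻¹ by positivity)]
      refine le_trans (mul_le_mul_of_nonneg_left ?_ (inv_pos.2 (hc n)).le) hn.le
      exact (hF.metaComponent_strictMono hP).monotone
        (mul_le_mul_of_nonneg_left (hw j).le (by positivity))
    have h2 : (d : ℝ) * (2 * δ) < ε := by
      rw [hδ]
      have : (0 : ℝ) < d + 1 := by positivity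
      rw [show (d : ℝ) * (2 * (ε / (2 * (d + 1)))) = ε * d / (d + 1) by field_simp,
        div_lt_iff₀ this]
      linarith
    have h3 : ε ≤ ‖(c n)⁻¹ • T (((n : ℝ) ^ lam⁻¹) • w)‖ := h
    linarith
  -- Coordinatewise convergence of the rescaled map is known off the planes, and `g` can jump only
  -- on the sphere `‖w‖ = ε`; both sets are null.
  · have hne : ∀ᵐ w ∂ρ, ∀ i, w i ≠ 0 := by
      refine ae_all_iff.2 fun i => ?_
      rw [ae_iff]
      simpa using hplanes i
    have hsph : ∀ᵐ w ∂ρ, ‖w‖ ≠ ε := by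
      rw [ae_iff]
      simpa using hρ.measure_sphere hε
    filter_upwards [hne, hsph] with w hw1 hw2
    have hconv : Tendsto (fun n : ℕ => (c n)⁻¹ • T (((n : ℝ) ^ lam⁻¹) • w)) atTop (𝓝 w) := by
      have h1 : Tendsto (fun n : ℕ => WithLp.ofLp ((c n)⁻¹ • T (((n : ℝ) ^ lam⁻¹) • w))) atTop
          (𝓝 (WithLp.ofLp w)) :=
        tendsto_pi_nhds.2 fun j => tendsto_scaled_metaComponent_of_ne hlam hF hc hrv (hw1 j)
      exact ((PiLp.continuous_toLp 2 _).tendsto _).comp h1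
    have hcont : ContinuousAt g w := by
      rcases hw2.lt_or_gt with h | h
      · have : g =ᶠ[𝓝 w] fun _ => 0 := by
          filter_upwards [(continuous_norm.tendsto w).eventually (gt_mem_nhds h)] with v hv
          exact indicator_of_notMem (s := A) (fun h' => absurd h' (not_le.2 hv)) _
        exact continuousAt_const.congr this.symm
      · have : g =ᶠ[𝓝 w] φ := by
          filter_upwards [(continuous_norm.tendsto w).eventually (lt_mem_nhds h)] with v hv
          exact indicator_of_mem (show v ∈ A from le_of_lt hv) _
        exact φ.continuous.continuousAt.congr this.symm
    exact hcont.tendsto.comp hconv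

lemma integral_sampleLaw_smul {π : Measure (EuclideanSpace ℝ (Fin d))} [IsProbabilityMeasure π]
    {a : ℝ} (ha : a ≠ 0) (n : ℕ) (f : (Fin n → EuclideanSpace ℝ (Fin d)) → ℝ) :
    ∫ z, f (fun i => a • z i) ∂(Measure.pi fun _ : Fin n => π) =
      ∫ z, f z ∂(Measure.pi fun _ : Fin n => π.map fun z => a • z) := by
  have : ∀ _ : Fin n, SigmaFinite (π.map fun z => a • z) := fun _ => by
    have := Measure.isProbabilityMeasure_map (μ := π) (f := fun z => a • z) (by fun_prop)
    infer_instance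
  have h := Measure.pi_map_pi (μ := fun _ : Fin n => π) (f := fun _ z => a • z)
    (fun _ => by fun_prop)
  rw [← h]
  exact (((MeasurableEquiv.piCongrRight fun _ : Fin n =>
    (Homeomorph.smulOfNeZero a ha).toMeasurableEquiv).measurableEmbedding).integral_map _).symm

/-- The heavy-tailed sample clouds converge to the Poisson point process. -/
theorem sampleCloudsConvergeToPoisson_heavyLaw (hlam : 0 < lam) (hρ : IsExcessMeasure lam ρ)
    (hm : ∀ i, ρ {w | 1 ≤ |w i|} = 2) (hd : 1 ≤ d) (hplanes : ∀ i, ρ {w | w i = 0} = 0)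
    (hF : IsSymmCDF F) {c : ℕ → ℝ} (hc : ∀ n, 0 < c n)
    (hrv : ∀ x : ℝ, 0 < x →
      Tendsto (fun n : ℕ => n * (1 - F (c n * x))) atTop (𝓝 (x ^ (-lam)))) :
    SampleCloudsConvergeToPoisson ((perturbedLaw lam ρ).map (metaMap F (paretoCDF lam))) c ρ := by
  intro ε hε
  have hP := isSymmCDF_paretoCDF hlam
  have hprob := isProbabilityMeasure_perturbedLaw hlam hρ hm hd
  have hprob1 : IsProbabilityMeasure ((perturbedLaw lam ρ).map (metaMap F (paretoCDF lam))) :=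
    Measure.isProbabilityMeasure_map (hF.measurable_metaMap hP).aemeasurable
  have hprob2 : ∀ n, IsProbabilityMeasure
      (((perturbedLaw lam ρ).map (metaMap F (paretoCDF lam))).map fun z => (c n)⁻¹ • z) := fun n =>
    Measure.isProbabilityMeasure_map (by fun_prop)
  have hAm : MeasurableSet {w : EuclideanSpace ℝ (Fin d) | ε ≤ ‖w‖} :=
    measurableSet_le measurable_const measurable_norm
  have hfin : IsFiniteMeasure (ρ.restrict {w | ε ≤ ‖w‖}) :=
    ⟨by rw [Measure.restrict_apply_univ]; exact hρ.finite_away ε hε⟩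
  obtain ⟨σ, hσ⟩ : ∃ σ : FiniteMeasure (EuclideanSpace ℝ (Fin d)),
    (σ : Measure (EuclideanSpace ℝ (Fin d))) = ρ.restrict {w | ε ≤ ‖w‖} := ⟨⟨_, hfin⟩, rfl⟩
  -- A nonzero mean measure is needed in order to normalise it; here it contains a slab of positive
  -- mass.
  have hσ0 : σ ≠ 0 := by
    intro h0
    have h1 : ρ {w | ε ≤ ‖w‖} = 0 := by
      rw [← Measure.restrict_apply_univ, ← hσ, h0]
      simp
    have i : Fin d := ⟨0, hd⟩
    have h2 : ρ.real {w | ε ≤ |w i|} = 0 := by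
      have hsub : {w : EuclideanSpace ℝ (Fin d) | ε ≤ |w i|} ⊆ {w | ε ≤ ‖w‖} :=
        fun w hw => le_trans hw (abs_coord_le_norm w i)
      rw [measureReal_def, measure_mono_null hsub h1, ENNReal.toReal_zero]
    rw [hρ.real_abs_coord i hε, measureReal_def, hm] at h2
    have := Real.rpow_pos_of_pos hε (-lam)
    norm_num at h2
    exact this.ne' h2
  refine ⟨_, inferInstance, poissonLaw σ.mass (σ.normalize : Measure _),
    fun ω => pointCloud ω.2, inferInstance, ?_, fun Φ => ?_⟩
  · have h := isPoissonProcess_poissonLaw (r := σ.mass)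
      (κ := (σ.normalize : Measure (EuclideanSpace ℝ (Fin d))))
    have h2 := congrArg (fun μ : FiniteMeasure _ => (μ : Measure (EuclideanSpace ℝ (Fin d))))
      σ.self_eq_mass_smul_normalize
    simp only [FiniteMeasure.toMeasure_smul] at h2
    rw [← hσ, h2]
    exact h
  · have h := tendsto_integral_cloud (π := fun n =>
      ((perturbedLaw lam ρ).map (metaMap F (paretoCDF lam))).map fun z => (c n)⁻¹ • z) hAm hσ0
      (fun φ => by
        rw [hσ]
        exact tendsto_setIntegral_heavyLaw hlam hρ hm hd hplanes hF hc hrv hε φ) Φ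
    refine h.congr fun n => ?_
    rw [sampleLaw]
    exact (integral_sampleLaw_smul (inv_pos.2 (hc n)).ne' n
      (fun z => Φ ((pointCloud z).restrict {w | ε ≤ ‖w‖}))).symm

end HeavyClouds

/-! ### Convergence of the light-tailed sample clouds -/

section Levels

variable {G : ℝ → ℝ} {lam θ : ℝ}

/-- The level of the symmetric Pareto distribution corresponding to the level `y` of `G`. -/
noncomputable def paretoLevel (lam : ℝ) (G : ℝ → ℝ) (y : ℝ) : ℝ :=
  Real.exp (tailExponent G y / lam)

lemma IsSymmCDF.paretoLevel_strictMono (hG : IsSymmCDF G) (hlam : 0 < lam) :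
    StrictMono (paretoLevel lam G) := fun _ _ h =>
  Real.exp_lt_exp.2 (div_lt_div_of_pos_right (hG.tailExponent_strictMono h) hlam)

/-- The Pareto tail is an exact power of `2 ^ (1/λ) + t`. Conditions on the coordinates of the
light-tailed cloud thus become exact inequalities for `|w i|`, with bounds that are powers of `n` up
to `n ^ o(1)`. -/
lemma IsSymmCDF.paretoLevel_metaComponent (hG : IsSymmCDF G) (hlam : 0 < lam) {t : ℝ}
    (ht : 0 ≤ t) : paretoLevel lam G (metaComponent G (paretoCDF lam) t) = 2 ^ lam⁻¹ + t := by
  have hk : (0 : ℝ) < 2 ^ lam⁻¹ + t := add_pos_of_pos_of_nonneg (two_rpow_pos _) ht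
  rw [paretoLevel, tailExponent, hG.apply_metaComponent (isSymmCDF_paretoCDF hlam),
    one_sub_paretoCDF ht, Real.log_rpow hk, neg_mul, neg_neg, mul_div_cancel_left₀ _ hlam.ne',
    Real.exp_log hk]

lemma IsSymmCDF.le_metaComponent_iff_level (hG : IsSymmCDF G) (hlam : 0 < lam) {t y : ℝ}
    (ht : 0 ≤ t) :
    y ≤ metaComponent G (paretoCDF lam) t ↔ paretoLevel lam G y ≤ 2 ^ lam⁻¹ + t := by
  rw [← hG.paretoLevel_metaComponent hlam ht, (hG.paretoLevel_strictMono hlam).le_iff_le]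

lemma IsSymmCDF.metaComponent_le_iff_level (hG : IsSymmCDF G) (hlam : 0 < lam) {t y : ℝ}
    (ht : 0 ≤ t) :
    metaComponent G (paretoCDF lam) t ≤ y ↔ 2 ^ lam⁻¹ + t ≤ paretoLevel lam G y := by
  rw [← hG.paretoLevel_metaComponent hlam ht, (hG.paretoLevel_strictMono hlam).le_iff_le]

lemma tendsto_log_natCast : Tendsto (fun n : ℕ => Real.log n) atTop atTop :=
  Real.tendsto_log_atTop.comp tendsto_natCast_atTop_atTop

lemma tendsto_of_div_log_pos {y : ℕ → ℝ} {c : ℝ} (hc : 0 < c)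
    (h : Tendsto (fun n : ℕ => y n / Real.log n) atTop (𝓝 c)) : Tendsto y atTop atTop := by
  refine (tendsto_log_natCast.atTop_mul_pos hc h).congr' ?_
  filter_upwards [tendsto_log_natCast.eventually_ne_atTop 0] with n hn
  field_simp

lemma tendsto_of_div_log_neg {y : ℕ → ℝ} {c : ℝ} (hc : c < 0)
    (h : Tendsto (fun n : ℕ => y n / Real.log n) atTop (𝓝 c)) : Tendsto y atTop atBot := by
  refine (tendsto_log_natCast.atTop_mul_neg hc h).congr' ?_
  filter_upwards [tendsto_log_natCast.eventually_ne_atTop 0] with n hn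
  field_simp

lemma tendsto_log_div_log : Tendsto (fun n : ℕ => Real.log n / Real.log n) atTop (𝓝 1) := by
  refine tendsto_const_nhds.congr' ?_
  filter_upwards [tendsto_log_natCast.eventually_ne_atTop 0] with n hn
  exact (div_self hn).symm

lemma eventually_exp_log_natCast : ∀ᶠ n : ℕ in atTop, Real.exp (Real.log n) = n := by
  filter_upwards [eventually_gt_atTop 0] with n hn
  exact Real.exp_log (by exact_mod_cast hn)

end Levels

/-! ### Masses of slabs and boxes under the cube laws -/

section Boxes

variable {d : ℕ} {lam : ℝ}

lemma cubeLaw_slab_le (j : Fin d) {R : ℝ} (hR : 0 < R) {t : Fin d → ℝ} (ht : ∀ i, 0 ≤ t i) :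
    cubeLaw d R {w | ∀ i, i ≠ j → |w i| ≤ t i} ≤
      ENNReal.ofReal (∏ i ∈ Finset.univ.erase j, t i / R) := by
  have hset : {w : EuclideanSpace ℝ (Fin d) | ∀ i, i ≠ j → |w i| ≤ t i} =
      {w | ∀ i, w i ∈ if i = j then (univ : Set ℝ) else Icc (-t i) (t i)} := by
    ext w
    refine forall_congr' fun i => ?_
    by_cases h : i = j <;> simp [h, abs_le]
  have hinv : ∀ x : ℝ, 0 ≤ x → (ENNReal.ofReal (2 * R))⁻¹ * ENNReal.ofReal (2 * x) =
      ENNReal.ofReal (x / R) := by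
    intro x hx
    rw [← ENNReal.ofReal_inv_of_pos (by positivity), ← ENNReal.ofReal_mul (by positivity)]
    congr 1
    field_simp
  rw [hset, cubeLaw_box hR fun i => by split_ifs <;> measurability,
    ← Finset.mul_prod_erase _ _ (Finset.mem_univ j),
    ENNReal.ofReal_prod_of_nonneg fun i _ => div_nonneg (ht i) hR.le]
  have h1 : (ENNReal.ofReal (2 * R))⁻¹ *
      volume ((if j = j then (univ : Set ℝ) else Icc (-t j) (t j)) ∩ Icc (-R) R) = 1 := by
    rw [if_pos rfl, univ_inter, Real.volume_Icc, show R - -R = 2 * R by ring, hinv R hR.le,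
      div_self hR.ne', ENNReal.ofReal_one]
  rw [h1, one_mul]
  refine Finset.prod_le_prod' fun i hi => ?_
  rw [if_neg (Finset.ne_of_mem_erase hi), ← hinv _ (ht i)]
  refine mul_le_mul_right ?_ _
  refine (measure_mono inter_subset_left).trans_eq ?_
  rw [Real.volume_Icc]
  congr 1
  ring

/-- Only cubes with `eᵐ ≥ s` meet the slab. There the weight `e^(-λm)` and the `d - 1` constrained
coordinates, each costing `t i / eᵐ`, combine to `e^(-(λ+d-1)m) ≤ s ^ (-(λ+d-1))`. The coordinate
`j` is left free. -/
lemma cubeMix_slab_le (hlam : 0 < lam) (j : Fin d) {s : ℝ} (hs : 0 < s) {t : Fin d → ℝ}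
    (ht : ∀ i, 0 ≤ t i) :
    cubeMix d lam {w | s ≤ |w j| ∧ ∀ i, i ≠ j → |w i| ≤ t i} ≤
      ENNReal.ofReal (s ^ (-(lam + d - 1)) * (∏ i ∈ Finset.univ.erase j, t i) *
        inverseSquareSum) := by
  have hd : 1 ≤ d := Fin.pos j
  have hd' : (1 : ℝ) ≤ d := by exact_mod_cast hd
  have hprod : 0 ≤ ∏ i ∈ Finset.univ.erase j, t i := Finset.prod_nonneg fun i _ => ht i
  have hmeas : MeasurableSet
      {w : EuclideanSpace ℝ (Fin d) | s ≤ |w j| ∧ ∀ i, i ≠ j → |w i| ≤ t i} := by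
    have : {w : EuclideanSpace ℝ (Fin d) | s ≤ |w j| ∧ ∀ i, i ≠ j → |w i| ≤ t i} =
        {w | s ≤ |w j|} ∩ ⋂ i, ⋂ (_ : i ≠ j), {w | |w i| ≤ t i} := by
      ext w; simp
    rw [this]
    exact (measurableSet_le_abs_coord j s).inter (MeasurableSet.iInter fun i =>
      MeasurableSet.iInter fun _ => measurableSet_le (measurable_coord i).abs measurable_const)
  refine cubeMix_le hmeas (by positivity) fun m => ?_
  rcases lt_or_ge (Real.exp m) s with h | h
  · have hsub : {w : EuclideanSpace ℝ (Fin d) | s ≤ |w j| ∧ ∀ i, i ≠ j → |w i| ≤ t i} ⊆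
        {w | ∃ j, s ≤ |w j|} := fun w hw => ⟨j, hw.1⟩
    rw [measure_mono_null hsub (cubeLaw_eq_zero (Real.exp_pos m) h), mul_zero]
    exact bot_le
  · have hlog : Real.log s ≤ m := by rw [← Real.log_exp m]; exact Real.log_le_log hs h
    have h1 : cubeLaw d (Real.exp m) {w | s ≤ |w j| ∧ ∀ i, i ≠ j → |w i| ≤ t i} ≤
        ENNReal.ofReal (∏ i ∈ Finset.univ.erase j, t i / Real.exp m) :=
      (measure_mono fun w hw => hw.2).trans (cubeLaw_slab_le j (Real.exp_pos m) ht)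
    refine (mul_le_mul_right h1 _).trans ?_
    rw [← ENNReal.ofReal_mul (cubeWeight_pos lam m).le]
    refine ENNReal.ofReal_le_ofReal ?_
    rw [Finset.prod_div_distrib, Finset.prod_const, Finset.card_erase_of_mem (Finset.mem_univ j),
      Finset.card_univ, Fintype.card_fin, ← Real.exp_nat_mul, Nat.cast_sub hd, Nat.cast_one]
    have hexp : Real.exp (-(lam * m)) / Real.exp (((d : ℝ) - 1) * m) ≤ s ^ (-(lam + d - 1)) := by
      rw [← Real.exp_sub, Real.rpow_def_of_pos hs, Real.exp_le_exp]
      have : 0 ≤ (lam + d - 1) * (m - Real.log s) :=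
        mul_nonneg (by linarith) (by linarith)
      linarith
    have hm : (0 : ℝ) ≤ m := Nat.cast_nonneg m
    have hpow : 1 / ((m : ℝ) + 1) ^ 3 ≤ 1 / ((m : ℝ) + 1) ^ 2 :=
      one_div_le_one_div_of_le (by positivity) (pow_le_pow_right₀ (by linarith) (by norm_num))
    calc cubeWeight lam m * ((∏ i ∈ Finset.univ.erase j, t i) / Real.exp (((d : ℝ) - 1) * m))
        = (Real.exp (-(lam * m)) / Real.exp (((d : ℝ) - 1) * m)) *
          (∏ i ∈ Finset.univ.erase j, t i) * (1 / ((m : ℝ) + 1) ^ 3) := by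
          unfold cubeWeight; ring
      _ ≤ s ^ (-(lam + d - 1)) * (∏ i ∈ Finset.univ.erase j, t i) *
          (1 / ((m : ℝ) + 1) ^ 2) := by gcongr

lemma prod_le_cubeLaw_box {R : ℝ} (hR : 0 < R) {B : Fin d → Set ℝ}
    (hB : ∀ i, MeasurableSet (B i)) (hBR : ∀ i, B i ⊆ Icc (-R) R) {ℓ : Fin d → ℝ}
    (hℓ0 : ∀ i, 0 ≤ ℓ i) (hℓ : ∀ i, ENNReal.ofReal (ℓ i) ≤ volume (B i)) :
    ENNReal.ofReal (∏ i, ℓ i / (2 * R)) ≤ cubeLaw d R {w | ∀ i, w i ∈ B i} := by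
  rw [cubeLaw_box hR hB, ENNReal.ofReal_prod_of_nonneg fun i _ =>
    div_nonneg (hℓ0 i) (by positivity)]
  refine Finset.prod_le_prod' fun i _ => ?_
  rw [inter_eq_left.2 (hBR i), div_eq_inv_mul, ENNReal.ofReal_mul (by positivity),
    ENNReal.ofReal_inv_of_pos (by positivity)]
  exact mul_le_mul_right (hℓ i) _

end Boxes

/-! ### Upper bounds for expected counts on the logarithmic scale -/

section UpperBounds

variable {d : ℕ} {lam θ : ℝ} {ρ : Measure (EuclideanSpace ℝ (Fin d))} {G : ℝ → ℝ}

lemma IsSymmCDF.abs_scaled_metaMap (hG : IsSymmCDF G) (hlam : 0 < lam) {b : ℝ} (hb : 0 < b)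
    (w : EuclideanSpace ℝ (Fin d)) (i : Fin d) :
    |(b⁻¹ • metaMap G (paretoCDF lam) w) i| =
      b⁻¹ * metaComponent G (paretoCDF lam) |w i| := by
  rw [PiLp.smul_apply, smul_eq_mul, abs_mul, abs_of_pos (inv_pos.2 hb), metaMap_apply,
    hG.abs_metaComponent (isSymmCDF_paretoCDF hlam)]

lemma IsSymmCDF.le_abs_scaled_metaMap_iff (hG : IsSymmCDF G) (hlam : 0 < lam) {b : ℝ}
    (hb : 0 < b) (w : EuclideanSpace ℝ (Fin d)) (i : Fin d) (y : ℝ) :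
    y ≤ |(b⁻¹ • metaMap G (paretoCDF lam) w) i| ↔
      paretoLevel lam G (b * y) ≤ 2 ^ lam⁻¹ + |w i| := by
  rw [hG.abs_scaled_metaMap hlam hb, le_inv_mul_iff₀ hb,
    hG.le_metaComponent_iff_level hlam (abs_nonneg _)]

lemma IsSymmCDF.abs_scaled_metaMap_le_iff (hG : IsSymmCDF G) (hlam : 0 < lam) {b : ℝ}
    (hb : 0 < b) (w : EuclideanSpace ℝ (Fin d)) (i : Fin d) (y : ℝ) :
    |(b⁻¹ • metaMap G (paretoCDF lam) w) i| ≤ y ↔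
      2 ^ lam⁻¹ + |w i| ≤ paretoLevel lam G (b * y) := by
  rw [hG.abs_scaled_metaMap hlam hb, inv_mul_le_iff₀ hb,
    hG.metaComponent_le_iff_level hlam (abs_nonneg _)]

lemma tendsto_natCast_mul_exp_zero {y : ℕ → ℝ} {c : ℝ} (hc : 1 + c < 0)
    (h : Tendsto (fun n : ℕ => y n / Real.log n) atTop (𝓝 c)) :
    Tendsto (fun n : ℕ => n * Real.exp (y n)) atTop (𝓝 0) := by
  have h1 := tendsto_log_div_log.add h
  have h2 := tendsto_of_div_log_neg (y := fun n => Real.log n + y n) hc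
    (h1.congr fun n => (add_div _ _ _).symm)
  refine (Real.tendsto_exp_atBot.comp h2).congr' ?_
  filter_upwards [eventually_exp_log_natCast] with n hn
  rw [Function.comp_apply, Real.exp_add, hn]

lemma tendsto_natCast_mul_exp_atTop {y : ℕ → ℝ} {c : ℝ} (hc : 0 < 1 + c)
    (h : Tendsto (fun n : ℕ => y n / Real.log n) atTop (𝓝 c)) :
    Tendsto (fun n : ℕ => n * Real.exp (y n)) atTop atTop := by
  have h1 := tendsto_log_div_log.add h
  have h2 := tendsto_of_div_log_pos (y := fun n => Real.log n + y n) hc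
    (h1.congr fun n => (add_div _ _ _).symm)
  refine (Real.tendsto_exp_atTop.comp h2).congr' ?_
  filter_upwards [eventually_exp_log_natCast] with n hn
  rw [Function.comp_apply, Real.exp_add, hn]

/-- In powers of `n`: `nᵖ log n` is negligible against `n^q` when `p < q`. Hence the logarithmic
width of the balanced cone is invisible on the light scale. -/
lemma eventually_add_mul_exp_lt_exp {x y : ℕ → ℝ} {p q : ℝ} (hp : 0 < p) (hpq : p < q)
    (hx : Tendsto (fun n : ℕ => x n / Real.log n) atTop (𝓝 p))
    (hy : Tendsto (fun n : ℕ => y n / Real.log n) atTop (𝓝 q)) {k : ℝ} (hk : 0 ≤ k) :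
    ∀ᶠ n in atTop, k + Real.exp (x n) * x n < Real.exp (y n) := by
  have hz : Tendsto (fun n : ℕ => (y n - x n) / Real.log n) atTop (𝓝 (q - p)) :=
    (hy.sub hx).congr fun n => (sub_div _ _ _).symm
  have hzt := tendsto_of_div_log_pos (sub_pos.2 hpq) hz
  have hxt := tendsto_of_div_log_pos hp hx
  have hxk : Tendsto (fun n : ℕ => (x n + k) / Real.log n) atTop (𝓝 p) := by
    have := hx.add (tendsto_log_natCast.const_div_atTop k)
    rw [add_zero] at this
    exact this.congr fun n => (add_div _ _ _).symm
  have h1 := (hxk.div hz (sub_pos.2 hpq).ne').mul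
    ((Real.tendsto_pow_mul_exp_neg_atTop_nhds_zero 1).comp hzt)
  rw [mul_zero] at h1
  filter_upwards [h1.eventually_lt_const one_pos, tendsto_log_natCast.eventually_gt_atTop 0,
    hzt.eventually_gt_atTop 0, hxt.eventually_ge_atTop 0] with n hn hlog hz0 hx0
  have h2 : ((x n + k) / Real.log n) / ((y n - x n) / Real.log n) *
      ((y n - x n) ^ 1 * Real.exp (-(y n - x n))) = (x n + k) * Real.exp (x n) / Real.exp (y n) := by
    rw [neg_sub, Real.exp_sub]
    field_simp
  have h3 : (x n + k) * Real.exp (x n) / Real.exp (y n) < 1 := by rw [← h2]; exact hn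
  rw [div_lt_one (Real.exp_pos _)] at h3
  nlinarith [Real.add_one_le_exp (x n), mul_le_mul_of_nonneg_left (Real.one_le_exp hx0) hk]

/-- The two-sided marginal tail of `ν` at `s` is of order `s ^ (-λ)`; at level `e^{y/λ}` it is about
`e^{-y} = n^{-c + o(1)}` with `c > 1`. -/
lemma tendsto_natCast_mul_perturbedLaw_tail (hlam : 0 < lam) (hρ : IsExcessMeasure lam ρ)
    (hm : ∀ i, ρ {w | 1 ≤ |w i|} = 2) (hd : 1 ≤ d) (hplanes : ∀ i, ρ {w | w i = 0} = 0)
    (j : Fin d) (k : ℝ) {y : ℕ → ℝ} {c : ℝ} (hc : 1 < c)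
    (hy : Tendsto (fun n : ℕ => y n / Real.log n) atTop (𝓝 c)) :
    Tendsto (fun n : ℕ => n * (perturbedLaw lam ρ).real
      {w | Real.exp (y n / lam) ≤ k + |w j|}) atTop (𝓝 0) := by
  have hprob := isProbabilityMeasure_perturbedLaw hlam hρ hm hd
  have hR : Tendsto (fun n => Real.exp (y n / lam)) atTop atTop :=
    Real.tendsto_exp_atTop.comp
      ((tendsto_of_div_log_pos (by linarith) hy).atTop_div_const hlam)
  -- Halving the level absorbs the bounded shift `k`, at the cost of the factor `2 ^ λ`.
  have hs : Tendsto (fun n => Real.exp (y n / lam) / 2) atTop atTop :=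
    hR.atTop_div_const two_pos
  have h1 := (tendsto_perturbedLaw_coord hlam hρ hm hd hplanes j
    (measurableSet_le measurable_const measurable_abs : MeasurableSet {t : ℝ | 1 ≤ |t|})
    (fun t ht => ht)).comp hs
  have h2 := tendsto_natCast_mul_exp_zero (y := fun n => -y n) (c := -c) (by linarith)
    (hy.neg.congr fun n => (neg_div _ _).symm)
  have h3 := (h2.const_mul ((2 : ℝ) ^ lam)).mul h1
  rw [mul_zero, zero_mul] at h3
  refine squeeze_zero' (Eventually.of_forall fun n => by positivity) ?_ h3
  filter_upwards [hs.eventually_ge_atTop k] with n hn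
  have hpos := Real.exp_pos (y n / lam)
  have hsub : {w : EuclideanSpace ℝ (Fin d) | Real.exp (y n / lam) ≤ k + |w j|} ⊆
      {w | (Real.exp (y n / lam) / 2)⁻¹ * w j ∈ {t : ℝ | 1 ≤ |t|}} := by
    intro w hw
    have hw' : Real.exp (y n / lam) ≤ k + |w j| := hw
    change 1 ≤ |(Real.exp (y n / lam) / 2)⁻¹ * w j|
    rw [abs_mul, abs_of_pos (by positivity), le_inv_mul_iff₀ (by positivity)]
    linarith
  have hpow : (2 : ℝ) ^ lam * Real.exp (-y n) * (Real.exp (y n / lam) / 2) ^ lam = 1 := by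
    rw [Real.div_rpow hpos.le two_pos.le, ← Real.exp_mul, div_mul_cancel₀ _ hlam.ne', Real.exp_neg]
    field_simp
  have hring : ∀ p q r s t : ℝ, p * (q * r * s) * t = q * (p * r) * (s * t) := by intros; ring
  calc (n : ℝ) * (perturbedLaw lam ρ).real {w | Real.exp (y n / lam) ≤ k + |w j|}
      ≤ n * (perturbedLaw lam ρ).real
          {w | (Real.exp (y n / lam) / 2)⁻¹ * w j ∈ {t : ℝ | 1 ≤ |t|}} := by
        gcongr
        exact measure_ne_top _ _
    _ = n * ((2 : ℝ) ^ lam * Real.exp (-y n) * (Real.exp (y n / lam) / 2) ^ lam) *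
          (perturbedLaw lam ρ).real
          {w | (Real.exp (y n / lam) / 2)⁻¹ * w j ∈ {t : ℝ | 1 ≤ |t|}} := by rw [hpow, mul_one]
    _ = _ := hring _ _ _ _ _

lemma perturbedLaw_real_le (hlam : 0 < lam) (hρ : IsExcessMeasure lam ρ)
    (hm : ∀ i, ρ {w | 1 ≤ |w i|} = 2) (hd : 1 ≤ d) {A : Set (EuclideanSpace ℝ (Fin d))}
    (hA : A ∩ balancedCone d (4 ^ lam⁻¹) = ∅) {B : ℝ} (hB : 0 ≤ B)
    (h : cubeMix d lam A ≤ ENNReal.ofReal B) :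
    (perturbedLaw lam ρ).real A ≤
      ((1 - ρ (balancedCone d (4 ^ lam⁻¹))) / cubeMix d lam univ).toReal * B := by
  have hw := (perturbedLaw_weight hlam hρ hm hd).2
  have h1 : perturbedLaw lam ρ A ≤
      (1 - ρ (balancedCone d (4 ^ lam⁻¹))) / cubeMix d lam univ * ENNReal.ofReal B := by
    rw [perturbedLaw, Measure.add_apply, Measure.restrict_apply' (measurableSet_balancedCone _), hA,
      measure_empty, zero_add, Measure.smul_apply, smul_eq_mul]
    exact mul_le_mul_right h _
  have h2 := ENNReal.toReal_mono (ENNReal.mul_ne_top hw ENNReal.ofReal_ne_top) h1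
  rwa [ENNReal.toReal_mul, ENNReal.toReal_ofReal hB] at h2

/-- As `p i₀ < q`, coordinate `j` is larger than coordinate `i₀` by a power of `n`, so the slab
misses the balanced cone and only the cubes count. By `cubeMix_slab_le` their expected count has
exponent `1 + (∑_{i ≠ j} p i - (λ+d-1) q) / λ`, and `hsum` says that this is negative. -/
lemma tendsto_natCast_mul_perturbedLaw_slab (hlam : 0 < lam) (hρ : IsExcessMeasure lam ρ)
    (hm : ∀ i, ρ {w | 1 ≤ |w i|} = 2) (j i₀ : Fin d) (hi₀ : i₀ ≠ j)
    {k : ℝ} (hk : 0 ≤ k) {y : ℕ → ℝ} {x : Fin d → ℕ → ℝ} {q : ℝ} {p : Fin d → ℝ}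
    (hy : Tendsto (fun n : ℕ => y n / Real.log n) atTop (𝓝 q))
    (hx : ∀ i, Tendsto (fun n : ℕ => x i n / Real.log n) atTop (𝓝 (p i)))
    (hp : 0 < p i₀) (hpq : p i₀ < q)
    (hsum : ∑ i ∈ Finset.univ.erase j, p i + lam < (lam + d - 1) * q) :
    Tendsto (fun n : ℕ => n * (perturbedLaw lam ρ).real
      {w | Real.exp (y n / lam) ≤ k + |w j| ∧ ∀ i, i ≠ j → k + |w i| ≤ Real.exp (x i n / lam)})
      atTop (𝓝 0) := by
  have hd : 1 ≤ d := Fin.pos j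
  have hprob := isProbabilityMeasure_perturbedLaw hlam hρ hm hd
  set a := ((1 - ρ (balancedCone d (4 ^ lam⁻¹))) / cubeMix d lam univ).toReal
  have hdiv : ∀ {z : ℕ → ℝ} {c : ℝ}, Tendsto (fun n : ℕ => z n / Real.log n) atTop (𝓝 c) →
      Tendsto (fun n : ℕ => z n / lam / Real.log n) atTop (𝓝 (c / lam)) := fun h =>
    (h.div_const lam).congr fun n => div_right_comm _ _ _
  have hR : Tendsto (fun n => Real.exp (y n / lam)) atTop atTop :=
    Real.tendsto_exp_atTop.comp
      ((tendsto_of_div_log_pos (hp.trans hpq) hy).atTop_div_const hlam)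
  have hE : Tendsto (fun n : ℕ => (∑ i ∈ Finset.univ.erase j, x i n / lam -
      (lam + d - 1) * (y n / lam)) / Real.log n) atTop
      (𝓝 (∑ i ∈ Finset.univ.erase j, p i / lam - (lam + d - 1) * (q / lam))) := by
    refine ((tendsto_finsetSum _ fun i _ => hdiv (hx i)).sub
      ((hdiv hy).const_mul (lam + d - 1))).congr fun n => ?_
    rw [sub_div, Finset.sum_div, mul_div_assoc]
  have hneg : 1 + (∑ i ∈ Finset.univ.erase j, p i / lam - (lam + d - 1) * (q / lam)) < 0 := by
    rw [← Finset.sum_div]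
    have : 1 + ((∑ i ∈ Finset.univ.erase j, p i) / lam - (lam + d - 1) * (q / lam)) =
        (∑ i ∈ Finset.univ.erase j, p i + lam - (lam + d - 1) * q) / lam := by
      field_simp
      ring
    rw [this]
    exact div_neg_of_neg_of_pos (by linarith) hlam
  have h0 := (tendsto_natCast_mul_exp_zero hneg hE).const_mul
    (a * ((2 : ℝ) ^ (lam + d - 1) * inverseSquareSum))
  rw [mul_zero] at h0
  refine squeeze_zero' (Eventually.of_forall fun n => by positivity) ?_ h0
  filter_upwards [hR.eventually_ge_atTop (2 * k), eventually_add_mul_exp_lt_exp (div_pos hp hlam)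
    (div_lt_div_of_pos_right hpq hlam) (hdiv (hx i₀)) (hdiv hy) hk] with n hn hlt
  set A := {w : EuclideanSpace ℝ (Fin d) | Real.exp (y n / lam) ≤ k + |w j| ∧
    ∀ i, i ≠ j → k + |w i| ≤ Real.exp (x i n / lam)}
  have hempty : A ∩ balancedCone d (4 ^ lam⁻¹) = ∅ := by
    refine eq_empty_of_forall_notMem fun w hw => ?_
    obtain ⟨⟨hwj, hwi⟩, hw1, hw2⟩ := hw
    have h1 : 1 ≤ |w i₀| := (one_le_four_rpow hlam).trans (hw1 i₀)
    have h2 : |w i₀| ≤ Real.exp (x i₀ n / lam) := by linarith [hwi i₀ hi₀]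
    have h3 : Real.log |w i₀| ≤ x i₀ n / lam := by
      rw [← Real.log_exp (x i₀ n / lam)]
      exact Real.log_le_log (by linarith) h2
    have h4 := mul_le_mul h2 h3 (Real.log_nonneg h1) (Real.exp_pos _).le
    linarith [hw2 i₀ j]
  have hsub : A ⊆ {w | Real.exp (y n / lam) / 2 ≤ |w j| ∧
      ∀ i, i ≠ j → |w i| ≤ Real.exp (x i n / lam)} := fun w hw =>
    ⟨by linarith [hw.1], fun i hi => by linarith [hw.2 i hi]⟩
  have hcube := (measure_mono hsub).trans (cubeMix_slab_le hlam j (by positivity)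
    (t := fun i => Real.exp (x i n / lam)) fun i => (Real.exp_pos _).le)
  have hsum0 : 0 ≤ inverseSquareSum := tsum_nonneg fun m => by positivity
  have hB : 0 ≤ (Real.exp (y n / lam) / 2) ^ (-(lam + d - 1)) *
      (∏ i ∈ Finset.univ.erase j, Real.exp (x i n / lam)) * inverseSquareSum :=
    mul_nonneg (mul_nonneg (by positivity) (Finset.prod_nonneg fun i _ => (Real.exp_pos _).le))
      hsum0
  have h5 := mul_le_mul_of_nonneg_left (perturbedLaw_real_le hlam hρ hm hd hempty hB hcube)
    (Nat.cast_nonneg (α := ℝ) n)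
  refine h5.trans_eq ?_
  rw [← Real.exp_sum, Real.div_rpow (Real.exp_pos _).le two_pos.le, ← Real.exp_mul,
    Real.rpow_neg two_pos.le, div_inv_eq_mul,
    show y n / lam * -(lam + d - 1) = -((lam + d - 1) * (y n / lam)) by ring, Real.exp_sub,
    Real.exp_neg]
  ring

end UpperBounds

/-! ### The limit set -/

section LimitSet

variable {d : ℕ} {lam θ : ℝ}

lemma abs_coord_le_supNorm (u : EuclideanSpace ℝ (Fin d)) (i : Fin d) :
    |u i| ≤ ‖WithLp.ofLp u‖ :=
  norm_le_pi_norm (WithLp.ofLp u) i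

lemma exists_supNorm_eq (hd : 1 ≤ d) (u : EuclideanSpace ℝ (Fin d)) :
    ∃ j, ‖WithLp.ofLp u‖ = |u j| := by
  have : Nonempty (Fin d) := ⟨⟨0, hd⟩⟩
  obtain ⟨j, hj⟩ := Finite.exists_max fun i => ‖WithLp.ofLp u i‖
  exact ⟨j, le_antisymm ((pi_norm_le_iff_of_nonempty _).2 hj) (abs_coord_le_supNorm u j)⟩

/-- Bounding every `|u i|ᶿ` by the largest one leaves `λ ‖u‖_∞ᶿ ≤ λ` in the defining inequality. -/
lemma supNorm_le_one_of_mem_limitSet (hlam : 0 < lam) (hθ : 0 < θ)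
    {u : EuclideanSpace ℝ (Fin d)} (hu : u ∈ limitSet d lam θ) : ‖WithLp.ofLp u‖ ≤ 1 := by
  have h1 : ∑ i, |u i| ^ θ ≤ ∑ _i : Fin d, ‖WithLp.ofLp u‖ ^ θ := Finset.sum_le_sum fun i _ =>
    Real.rpow_le_rpow (abs_nonneg _) (abs_coord_le_supNorm u i) hθ.le
  rw [Finset.sum_const, Finset.card_univ, Fintype.card_fin, nsmul_eq_mul] at h1
  have h2 : (lam + d) * ‖WithLp.ofLp u‖ ^ θ ≤ (∑ i, |u i| ^ θ) + lam := hu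
  have h3 : ‖WithLp.ofLp u‖ ^ θ ≤ 1 := by nlinarith
  by_contra! h
  exact absurd h3 (not_le.2 (Real.one_lt_rpow h hθ))

lemma isCompact_limitSet (hlam : 0 < lam) (hθ : 0 < θ) : IsCompact (limitSet d lam θ) := by
  refine Metric.isCompact_of_isClosed_isBounded ?_ ?_
  · refine isClosed_le ?_ ?_
    · exact continuous_const.mul ((PiLp.continuous_ofLp 2 _).norm.rpow_const fun _ => Or.inr hθ.le)
    · exact (continuous_finsetSum _ fun i _ => ((PiLp.continuous_apply 2 _ i).abs.rpow_const
        fun _ => Or.inr hθ.le)).add continuous_const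
  · refine (isBounded_iff_forall_norm_le).2 ⟨d * 1, fun u hu =>
      norm_le_of_abs_coord_le zero_le_one fun j =>
        (abs_coord_le_supNorm u j).trans (supNorm_le_one_of_mem_limitSet hlam hθ hu)⟩

end LimitSet

/-! ### No sample points away from the limit set -/

section UpperBound

variable {d : ℕ} {lam θ : ℝ} {ρ : Measure (EuclideanSpace ℝ (Fin d))} {G : ℝ → ℝ} {b : ℕ → ℝ}

lemma tendsto_cloud_tail (hlam : 0 < lam) (hρ : IsExcessMeasure lam ρ)
    (hm : ∀ i, ρ {w | 1 ≤ |w i|} = 2) (hd : 1 ≤ d) (hplanes : ∀ i, ρ {w | w i = 0} = 0)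
    (hθ : 0 < θ) (hG : IsSymmCDF G) (hb : ∀ n, 0 < b n)
    (hΛ : ∀ u : ℝ, 0 < u →
      Tendsto (fun n : ℕ => tailExponent G (b n * u) / Real.log n) atTop (𝓝 (u ^ θ)))
    (j : Fin d) {α : ℝ} (hα : 1 < α) :
    Tendsto (fun n : ℕ => n * (perturbedLaw lam ρ).real
      {w | (b n)⁻¹ • metaMap G (paretoCDF lam) w ∈ {u | α ≤ |u j|}}) atTop (𝓝 0) := by
  refine (tendsto_natCast_mul_perturbedLaw_tail hlam hρ hm hd hplanes j (2 ^ lam⁻¹)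
    (Real.one_lt_rpow hα hθ) (hΛ α (by linarith))).congr fun n => ?_
  congr 2
  ext w
  exact (hG.le_abs_scaled_metaMap_iff hlam (hb n) w j α).symm

lemma tendsto_cloud_slab (hlam : 0 < lam) (hρ : IsExcessMeasure lam ρ)
    (hm : ∀ i, ρ {w | 1 ≤ |w i|} = 2) (hθ : 0 < θ) (hG : IsSymmCDF G) (hb : ∀ n, 0 < b n)
    (hΛ : ∀ u : ℝ, 0 < u →
      Tendsto (fun n : ℕ => tailExponent G (b n * u) / Real.log n) atTop (𝓝 (u ^ θ)))
    (j i₀ : Fin d) (hi₀ : i₀ ≠ j) {α : ℝ} {β : Fin d → ℝ} (hβ : ∀ i, 0 < β i) (hβα : β i₀ < α)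
    (hsum : ∑ i ∈ Finset.univ.erase j, β i ^ θ + lam < (lam + d - 1) * α ^ θ) :
    Tendsto (fun n : ℕ => n * (perturbedLaw lam ρ).real
      {w | (b n)⁻¹ • metaMap G (paretoCDF lam) w ∈ {u | α ≤ |u j| ∧ ∀ i, i ≠ j → |u i| ≤ β i}})
      atTop (𝓝 0) := by
  refine (tendsto_natCast_mul_perturbedLaw_slab hlam hρ hm j i₀ hi₀ (two_rpow_pos lam⁻¹).le
    (hΛ α ((hβ i₀).trans hβα)) (fun i => hΛ (β i) (hβ i)) (Real.rpow_pos_of_pos (hβ i₀) θ)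
    (Real.rpow_lt_rpow (hβ i₀).le hβα hθ) hsum).congr fun n => ?_
  congr 2
  ext w
  exact and_congr (hG.le_abs_scaled_metaMap_iff hlam (hb n) w j α).symm
    (forall₂_congr fun i _ => (hG.abs_scaled_metaMap_le_iff hlam (hb n) w i (β i)).symm)

/-- If `‖p‖_∞ > 1`, the marginal tail suffices. Otherwise the moduli of the coordinates of `p`
cannot all be equal, since such a point lies in `E`. This supplies the `i₀` for the slab bound,
whose exponent condition at `p` is the strict failure of the inequality defining `E`. -/
lemma exists_nhds_tendsto_cloud_zero (hlam : 0 < lam) (hρ : IsExcessMeasure lam ρ)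
    (hm : ∀ i, ρ {w | 1 ≤ |w i|} = 2) (hd : 1 ≤ d) (hplanes : ∀ i, ρ {w | w i = 0} = 0)
    (hθ : 0 < θ) (hG : IsSymmCDF G) (hb : ∀ n, 0 < b n)
    (hΛ : ∀ u : ℝ, 0 < u →
      Tendsto (fun n : ℕ => tailExponent G (b n * u) / Real.log n) atTop (𝓝 (u ^ θ)))
    {p : EuclideanSpace ℝ (Fin d)} (hp : p ∉ limitSet d lam θ) :
    ∃ V ∈ 𝓝 p, Tendsto (fun n : ℕ => n * (perturbedLaw lam ρ).real
      {w | (b n)⁻¹ • metaMap G (paretoCDF lam) w ∈ V}) atTop (𝓝 0) := by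
  obtain ⟨j, hj⟩ := exists_supNorm_eq hd p
  have hp' : (∑ i, |p i| ^ θ) + lam < (lam + d) * |p j| ^ θ := by
    rw [← hj]
    exact not_le.1 hp
  have hmax : ∀ i, |p i| ≤ |p j| := fun i => hj ▸ abs_coord_le_supNorm p i
  have hcont : ∀ i : Fin d, Continuous fun u : EuclideanSpace ℝ (Fin d) => |u i| :=
    fun i => (PiLp.continuous_apply 2 _ i).abs
  by_cases h1 : 1 < |p j|
  · obtain ⟨α, hα, hαp⟩ := exists_between h1
    exact ⟨{u | α ≤ |u j|}, Filter.mem_of_superset ((hcont j).continuousAt.eventually_const_lt hαp)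
      fun u hu => (le_of_lt hu : α ≤ |u j|),
      tendsto_cloud_tail hlam hρ hm hd hplanes hθ hG hb hΛ j hα⟩
  · obtain ⟨i₀, hi₀⟩ : ∃ i₀, |p i₀| < |p j| := by
      by_contra! hcon
      have hsum : ∑ i, |p i| ^ θ = d * |p j| ^ θ := by
        rw [Finset.sum_congr rfl fun i _ => by rw [le_antisymm (hmax i) (hcon i)],
          Finset.sum_const, Finset.card_univ, Fintype.card_fin, nsmul_eq_mul]
      rw [hsum] at hp'
      have := Real.rpow_le_one (abs_nonneg (p j)) (not_lt.1 h1) hθ.le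
      nlinarith
    have hne : i₀ ≠ j := fun h => by simp [h] at hi₀
    have hlim1 : Tendsto (fun η : ℝ => ∑ i ∈ Finset.univ.erase j, (|p i| + η) ^ θ + lam)
        (𝓝[>] 0) (𝓝 (∑ i ∈ Finset.univ.erase j, |p i| ^ θ + lam)) := by
      have : Continuous fun η : ℝ => ∑ i ∈ Finset.univ.erase j, (|p i| + η) ^ θ + lam :=
        (continuous_finsetSum _ fun i _ => (continuous_const.add continuous_id).rpow_const
          fun _ => Or.inr hθ.le).add continuous_const
      simpa using (this.tendsto 0).mono_left nhdsWithin_le_nhds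
    have hlim2 : Tendsto (fun η : ℝ => (lam + d - 1) * (|p j| - η) ^ θ) (𝓝[>] 0)
        (𝓝 ((lam + d - 1) * |p j| ^ θ)) := by
      have : Continuous fun η : ℝ => (lam + d - 1) * (|p j| - η) ^ θ :=
        continuous_const.mul ((continuous_const.sub continuous_id).rpow_const
          fun _ => Or.inr hθ.le)
      simpa using (this.tendsto 0).mono_left nhdsWithin_le_nhds
    have hlt : ∑ i ∈ Finset.univ.erase j, |p i| ^ θ + lam < (lam + d - 1) * |p j| ^ θ := by
      rw [← Finset.add_sum_erase _ _ (Finset.mem_univ j)] at hp'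
      linarith
    have hsmall : ∀ᶠ η : ℝ in 𝓝[>] 0, |p i₀| + η < |p j| - η := by
      have : Ioo 0 ((|p j| - |p i₀|) / 2) ∈ 𝓝[>] (0 : ℝ) := Ioo_mem_nhdsGT (by linarith)
      filter_upwards [this] with η hη
      linarith [hη.2]
    obtain ⟨η, ⟨hη1, hη2⟩, hη0⟩ := (((hlim1.eventually_lt hlim2 hlt).and hsmall).and
      self_mem_nhdsWithin).exists
    have hη0 : 0 < η := hη0
    have hβ : ∀ i, 0 < |p i| + η := fun i => add_pos_of_nonneg_of_pos (abs_nonneg _) hη0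
    refine ⟨_, ?_, tendsto_cloud_slab hlam hρ hm hθ hG hb hΛ j i₀ hne hβ hη2 hη1⟩
    have hV1 : ∀ᶠ u in 𝓝 p, |p j| - η < |u j| :=
      (hcont j).continuousAt.eventually_const_lt (by linarith)
    have hV2 : ∀ᶠ u in 𝓝 p, ∀ i, |u i| < |p i| + η := eventually_all.2 fun i =>
      (hcont i).continuousAt.eventually_lt_const (by linarith)
    filter_upwards [hV1, hV2] with u hu1 hu2
    exact ⟨hu1.le, fun i _ => (hu2 i).le⟩

theorem tendsto_cloud_compl (hlam : 0 < lam) (hρ : IsExcessMeasure lam ρ)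
    (hm : ∀ i, ρ {w | 1 ≤ |w i|} = 2) (hd : 1 ≤ d) (hplanes : ∀ i, ρ {w | w i = 0} = 0)
    (hθ : 0 < θ) (hG : IsSymmCDF G) (hb : ∀ n, 0 < b n)
    (hΛ : ∀ u : ℝ, 0 < u →
      Tendsto (fun n : ℕ => tailExponent G (b n * u) / Real.log n) atTop (𝓝 (u ^ θ)))
    {U : Set (EuclideanSpace ℝ (Fin d))} (hU : IsOpen U) (hEU : limitSet d lam θ ⊆ U) :
    Tendsto (fun n : ℕ => n * (perturbedLaw lam ρ).real
      {w | (b n)⁻¹ • metaMap G (paretoCDF lam) w ∈ Uᶜ}) atTop (𝓝 0) := by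
  have hprob := isProbabilityMeasure_perturbedLaw hlam hρ hm hd
  have hmono : ∀ {A B : Set (EuclideanSpace ℝ (Fin d))}, A ⊆ B → ∀ n : ℕ,
      (perturbedLaw lam ρ).real {w | (b n)⁻¹ • metaMap G (paretoCDF lam) w ∈ A} ≤
      (perturbedLaw lam ρ).real {w | (b n)⁻¹ • metaMap G (paretoCDF lam) w ∈ B} := by
    intro A B h n
    have hsub : {w | (b n)⁻¹ • metaMap G (paretoCDF lam) w ∈ A} ⊆
      {w | (b n)⁻¹ • metaMap G (paretoCDF lam) w ∈ B} := fun w hw => h hw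
    exact measureReal_mono hsub
  have hsubset : ∀ {A B : Set (EuclideanSpace ℝ (Fin d))}, A ⊆ B →
      Tendsto (fun n : ℕ => n * (perturbedLaw lam ρ).real
        {w | (b n)⁻¹ • metaMap G (paretoCDF lam) w ∈ B}) atTop (𝓝 0) →
      Tendsto (fun n : ℕ => n * (perturbedLaw lam ρ).real
        {w | (b n)⁻¹ • metaMap G (paretoCDF lam) w ∈ A}) atTop (𝓝 0) := fun h hB =>
    squeeze_zero (fun n => by positivity)
      (fun n => mul_le_mul_of_nonneg_left (hmono h n) (Nat.cast_nonneg n)) hB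
  have hunion : ∀ {A B : Set (EuclideanSpace ℝ (Fin d))},
      Tendsto (fun n : ℕ => n * (perturbedLaw lam ρ).real
        {w | (b n)⁻¹ • metaMap G (paretoCDF lam) w ∈ A}) atTop (𝓝 0) →
      Tendsto (fun n : ℕ => n * (perturbedLaw lam ρ).real
        {w | (b n)⁻¹ • metaMap G (paretoCDF lam) w ∈ B}) atTop (𝓝 0) →
      Tendsto (fun n : ℕ => n * (perturbedLaw lam ρ).real
        {w | (b n)⁻¹ • metaMap G (paretoCDF lam) w ∈ A ∪ B}) atTop (𝓝 0) := by
    intro A B hA hB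
    have h := hA.add hB
    rw [add_zero] at h
    refine squeeze_zero (fun n => by positivity) (fun n => ?_) h
    rw [← mul_add]
    exact mul_le_mul_of_nonneg_left (measureReal_union_le _ _) (Nat.cast_nonneg n)
  have hempty : Tendsto (fun n : ℕ => n * (perturbedLaw lam ρ).real
      {w | (b n)⁻¹ • metaMap G (paretoCDF lam) w ∈ (∅ : Set (EuclideanSpace ℝ (Fin d)))})
      atTop (𝓝 0) := by simp
  -- The complement of `U` is unbounded: compactness treats its bounded part, the marginal tails
  -- treat the rest. Any cutoff above `1` would serve in place of `2`.
  have hcompact : IsCompact (Uᶜ ∩ {u | ∀ j, |u j| ≤ 2}) := by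
    refine Metric.isCompact_of_isClosed_isBounded (hU.isClosed_compl.inter ?_) ?_
    · rw [ofPred_forall]
      exact isClosed_iInter fun j => isClosed_le (PiLp.continuous_apply 2 _ j).abs continuous_const
    · exact isBounded_iff_forall_norm_le.2 ⟨d * 2, fun u hu =>
        norm_le_of_abs_coord_le zero_le_two hu.2⟩
  have hmain := hcompact.induction_on
    (p := fun A => Tendsto (fun n : ℕ => n * (perturbedLaw lam ρ).real
      {w | (b n)⁻¹ • metaMap G (paretoCDF lam) w ∈ A}) atTop (𝓝 0))
    hempty (fun _ _ h hB => hsubset h hB) (fun _ _ hA hB => hunion hA hB) fun p hp => by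
      obtain ⟨V, hV, h⟩ := exists_nhds_tendsto_cloud_zero hlam hρ hm hd hplanes hθ hG hb hΛ
        fun hpE => hp.1 (hEU hpE)
      exact ⟨V, mem_nhdsWithin_of_mem_nhds hV, h⟩
  have htail : ∀ s : Finset (Fin d), Tendsto (fun n : ℕ => n * (perturbedLaw lam ρ).real
      {w | (b n)⁻¹ • metaMap G (paretoCDF lam) w ∈
        {u : EuclideanSpace ℝ (Fin d) | ∃ j ∈ s, 2 ≤ |u j|}}) atTop (𝓝 0) := by
    intro s
    induction s using Finset.induction_on with
    | empty => simp
    | insert j s _ ih =>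
      refine hsubset (fun u hu => ?_) (hunion
        (tendsto_cloud_tail hlam hρ hm hd hplanes hθ hG hb hΛ j one_lt_two) ih)
      obtain ⟨i, hi, h⟩ := hu
      rcases Finset.mem_insert.1 hi with rfl | hi
      · exact Or.inl h
      · exact Or.inr ⟨i, hi, h⟩
  refine hsubset (fun u hu => ?_) (hunion hmain (htail Finset.univ))
  by_cases h : ∀ j, |u j| ≤ 2
  · exact Or.inl ⟨hu, h⟩
  · push Not at h
    obtain ⟨j, hj⟩ := h
    exact Or.inr ⟨j, Finset.mem_univ j, hj.le⟩

end UpperBound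

/-! ### Many sample points near every point of the limit set -/

section LowerBound

variable {d : ℕ} {lam θ : ℝ} {ρ : Measure (EuclideanSpace ℝ (Fin d))} {G : ℝ → ℝ} {b : ℕ → ℝ}

lemma le_perturbedLaw_real (hlam : 0 < lam) (hρ : IsExcessMeasure lam ρ)
    (hm : ∀ i, ρ {w | 1 ≤ |w i|} = 2) (hd : 1 ≤ d) {A : Set (EuclideanSpace ℝ (Fin d))} {m : ℕ}
    {B : ℝ} (hB : 0 ≤ B) (h : ENNReal.ofReal B ≤ cubeLaw d (Real.exp m) A) :
    ((1 - ρ (balancedCone d (4 ^ lam⁻¹))) / cubeMix d lam univ).toReal * (cubeWeight lam m * B) ≤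
      (perturbedLaw lam ρ).real A := by
  have hprob := isProbabilityMeasure_perturbedLaw hlam hρ hm hd
  have h1 : (1 - ρ (balancedCone d (4 ^ lam⁻¹))) / cubeMix d lam univ *
      ENNReal.ofReal (cubeWeight lam m * B) ≤ perturbedLaw lam ρ A := by
    rw [perturbedLaw, Measure.add_apply, Measure.smul_apply, smul_eq_mul,
      ENNReal.ofReal_mul (cubeWeight_pos lam m).le]
    exact le_add_left (mul_le_mul_right ((mul_le_mul_right h _).trans (le_cubeMix A m)) _)
  have h2 := ENNReal.toReal_mono (measure_ne_top _ _) h1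
  rwa [ENNReal.toReal_mul, ENNReal.toReal_ofReal
    (mul_nonneg (cubeWeight_pos lam m).le hB)] at h2

/-- The polynomial factor in the weights costs less than any exponential rate `τ`, which the strict
inequality from `exists_perturbation` can absorb. -/
lemma eventually_exp_le_cubeWeight (lam : ℝ) {τ : ℝ} (hτ : 0 < τ) :
    ∀ᶠ m : ℕ in atTop, Real.exp (-((lam + τ) * m)) ≤ cubeWeight lam m := by
  have h := ((isLittleO_pow_exp_pos_mul_atTop 3 hτ).comp_tendsto
    (tendsto_atTop_add_const_right atTop (1 : ℝ) tendsto_natCast_atTop_atTop)).bound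
    (Real.exp_pos (-τ))
  filter_upwards [h] with m hm
  have hm0 : (0 : ℝ) ≤ m := Nat.cast_nonneg m
  simp only [Function.comp_apply, Real.norm_eq_abs, Real.abs_exp] at hm
  rw [← Real.exp_add, abs_of_nonneg (by positivity), show -τ + τ * (m + 1 : ℝ) = τ * m by ring] at hm
  rw [cubeWeight, le_div_iff₀ (by positivity)]
  refine (mul_le_mul_of_nonneg_left hm (Real.exp_pos _).le).trans_eq ?_
  rw [← Real.exp_add]
  congr 1
  ring

/-- A single cube suffices, with `m = ⌈z / λ⌉`, roughly the smallest exponent for which the cube is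
guaranteed to contain the box. Its weight and the relative volume of the box give an expected count
of exponent at least `1 + (∑ p i - (λ+τ+d) q) / λ`, positive by `hsum`; rounding up costs only the
constant `e^(-(λ+τ+d))`. -/
lemma tendsto_natCast_mul_perturbedLaw_box (hlam : 0 < lam) (hρ : IsExcessMeasure lam ρ)
    (hm : ∀ i, ρ {w | 1 ≤ |w i|} = 2) (hd : 1 ≤ d) {τ : ℝ} (hτ : 0 < τ) {z : ℕ → ℝ}
    {x : Fin d → ℕ → ℝ} {q : ℝ} {p : Fin d → ℝ} (hq : 0 < q)
    (hz : Tendsto (fun n : ℕ => z n / Real.log n) atTop (𝓝 q))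
    (hx : ∀ i, Tendsto (fun n : ℕ => x i n / Real.log n) atTop (𝓝 (p i)))
    (hsum : (lam + τ + d) * q < ∑ i, p i + lam) {B : ℕ → Fin d → Set ℝ}
    (hB : ∀ n i, MeasurableSet (B n i))
    (hBR : ∀ᶠ n in atTop, ∀ i, B n i ⊆ Icc (-Real.exp (z n / lam)) (Real.exp (z n / lam)))
    (hvol : ∀ᶠ n in atTop, ∀ i, ENNReal.ofReal (Real.exp (x i n / lam) / 2) ≤ volume (B n i)) :
    Tendsto (fun n : ℕ => n * (perturbedLaw lam ρ).real {w | ∀ i, w i ∈ B n i}) atTop atTop := by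
  have hw := perturbedLaw_weight hlam hρ hm hd
  set a := ((1 - ρ (balancedCone d (4 ^ lam⁻¹))) / cubeMix d lam univ).toReal with ha_def
  have ha : 0 < a := ENNReal.toReal_pos hw.1 hw.2
  have hdiv : ∀ {z : ℕ → ℝ} {c : ℝ}, Tendsto (fun n : ℕ => z n / Real.log n) atTop (𝓝 c) →
      Tendsto (fun n : ℕ => z n / lam / Real.log n) atTop (𝓝 (c / lam)) := fun h =>
    (h.div_const lam).congr fun n => div_right_comm _ _ _
  have hzt : Tendsto (fun n => z n / lam) atTop atTop :=
    (tendsto_of_div_log_pos hq hz).atTop_div_const hlam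
  have hE : Tendsto (fun n : ℕ => (∑ i, x i n / lam - (lam + τ + d) * (z n / lam)) / Real.log n)
      atTop (𝓝 (∑ i, p i / lam - (lam + τ + d) * (q / lam))) := by
    refine ((tendsto_finsetSum _ fun i _ => hdiv (hx i)).sub
      ((hdiv hz).const_mul (lam + τ + d))).congr fun n => ?_
    rw [sub_div, Finset.sum_div, mul_div_assoc]
  have hpos : 0 < 1 + (∑ i, p i / lam - (lam + τ + d) * (q / lam)) := by
    rw [← Finset.sum_div]
    have : 1 + ((∑ i, p i) / lam - (lam + τ + d) * (q / lam)) =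
        (∑ i, p i + lam - (lam + τ + d) * q) / lam := by
      field_simp
      ring
    rw [this]
    exact div_pos (by linarith) hlam
  have h0 := (tendsto_natCast_mul_exp_atTop hpos hE).const_mul_atTop
    (show 0 < a * (Real.exp (-(lam + τ + d)) * (4⁻¹ : ℝ) ^ d) by positivity)
  refine tendsto_atTop_mono' _ ?_ h0
  filter_upwards [hBR, hvol, hzt.eventually_ge_atTop 0, (tendsto_nat_ceil_atTop.comp hzt).eventually
    (eventually_exp_le_cubeWeight lam hτ)] with n hn1 hn2 hn3 hn4
  simp only [Function.comp_apply] at hn4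
  set m := ⌈z n / lam⌉₊
  have hm1 : z n / lam ≤ m := Nat.le_ceil _
  have hm2 : (m : ℝ) ≤ z n / lam + 1 := (Nat.ceil_lt_add_one hn3).le
  have hexp := Real.exp_le_exp.2 hm1
  have hbox := prod_le_cubeLaw_box (Real.exp_pos m) (hB n)
    (fun i => (hn1 i).trans (Icc_subset_Icc (neg_le_neg hexp) hexp))
    (ℓ := fun i => Real.exp (x i n / lam) / 2) (fun i => by positivity) hn2
  have h1 := le_perturbedLaw_real hlam hρ hm hd
    (Finset.prod_nonneg fun i _ => by positivity) hbox
  have h2 : ∏ i, Real.exp (x i n / lam) / 2 / (2 * Real.exp m) =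
      Real.exp (∑ i, x i n / lam - d * m) * (4⁻¹ : ℝ) ^ d := by
    have : ∀ i, Real.exp (x i n / lam) / 2 / (2 * Real.exp m) =
        Real.exp (x i n / lam) * (Real.exp (-m) * 4⁻¹) := fun i => by
      rw [Real.exp_neg]
      field_simp
      norm_num
    rw [Finset.prod_congr rfl fun i _ => this i, Finset.prod_mul_distrib, ← Real.exp_sum,
      Finset.prod_const, Finset.card_univ, Fintype.card_fin, mul_pow, ← Real.exp_nat_mul,
      ← mul_assoc, ← Real.exp_add]
    congr 3
    ring
  rw [h2, ← ha_def] at h1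
  have h3 : Real.exp (-(lam + τ + d)) *
      Real.exp (∑ i, x i n / lam - (lam + τ + d) * (z n / lam)) ≤
      cubeWeight lam m * Real.exp (∑ i, x i n / lam - d * m) := by
    refine le_trans ?_ (mul_le_mul_of_nonneg_right hn4 (Real.exp_pos _).le)
    rw [← Real.exp_add, ← Real.exp_add, Real.exp_le_exp]
    have : (lam + τ + d) * m ≤ (lam + τ + d) * (z n / lam + 1) :=
      mul_le_mul_of_nonneg_left hm2 (by positivity)
    linarith
  calc a * (Real.exp (-(lam + τ + d)) * (4⁻¹ : ℝ) ^ d) *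
        (n * Real.exp (∑ i, x i n / lam - (lam + τ + d) * (z n / lam)))
      = n * (a * ((Real.exp (-(lam + τ + d)) *
        Real.exp (∑ i, x i n / lam - (lam + τ + d) * (z n / lam))) * (4⁻¹ : ℝ) ^ d)) := by ring
    _ ≤ n * (a * ((cubeWeight lam m * Real.exp (∑ i, x i n / lam - d * m)) * (4⁻¹ : ℝ) ^ d)) := by
        gcongr
    _ = n * (a * (cubeWeight lam m * (Real.exp (∑ i, x i n / lam - d * m) * (4⁻¹ : ℝ) ^ d))) := by
        ring
    _ ≤ _ := mul_le_mul_of_nonneg_left h1 (Nat.cast_nonneg n)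

/-- Contracting `p` by `1 - δ` multiplies the homogeneous terms by `(1 - δ)ᶿ < 1` but not the
summand `λ`, so the inequality becomes strict. By continuity there is then room for a small `η`,
serving both as box width and as loss in the weights. -/
lemma exists_perturbation (hlam : 0 < lam) (hθ : 0 < θ) {p : EuclideanSpace ℝ (Fin d)}
    (hp : p ∈ limitSet d lam θ) {ε : ℝ} (hε : 0 < ε) :
    ∃ δ η : ℝ, 0 < δ ∧ δ < 1 ∧ 0 < η ∧ d * (δ * ‖WithLp.ofLp p‖ + η) < ε ∧
      (lam + η + d) * ((1 - δ) * ‖WithLp.ofLp p‖ + η) ^ θ <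
        ∑ i, ((1 - δ) * |p i| + η) ^ θ + lam := by
  set N := ‖WithLp.ofLp p‖ with hN
  have hN0 : 0 ≤ N := norm_nonneg _
  have hδ : ∀ᶠ δ : ℝ in 𝓝[>] 0, d * (δ * N) < ε := by
    have : Continuous fun δ : ℝ => d * (δ * N) := by fun_prop
    have h := (this.tendsto 0).mono_left (nhdsWithin_le_nhds (s := Ioi 0))
    rw [zero_mul, mul_zero] at h
    exact h.eventually_lt_const hε
  obtain ⟨δ, hδε, hδ0, hδ1⟩ := (hδ.and (Ioo_mem_nhdsGT (zero_lt_one (α := ℝ)))).exists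
  have hpow : (1 - δ) ^ θ < 1 := Real.rpow_lt_one (by linarith) (by linarith) hθ
  have hpow0 : 0 ≤ (1 - δ) ^ θ := Real.rpow_nonneg (by linarith) _
  have hp' : (lam + d) * N ^ θ ≤ (∑ i, |p i| ^ θ) + lam := hp
  have hlt : (lam + 0 + d) * ((1 - δ) * N + 0) ^ θ <
      ∑ i, ((1 - δ) * |p i| + 0) ^ θ + lam := by
    have hsum : ∑ i, ((1 - δ) * |p i| + 0) ^ θ = (1 - δ) ^ θ * ∑ i, |p i| ^ θ := by
      rw [Finset.mul_sum]
      exact Finset.sum_congr rfl fun i _ => by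
        rw [add_zero, Real.mul_rpow (by linarith) (abs_nonneg _)]
    rw [hsum, add_zero, add_zero, Real.mul_rpow (by linarith) hN0]
    nlinarith [mul_le_mul_of_nonneg_left hp' hpow0]
  have h1 : Continuous fun η : ℝ => (lam + η + d) * ((1 - δ) * N + η) ^ θ :=
    (by fun_prop : Continuous fun η : ℝ => lam + η + d).mul
      ((continuous_const.add continuous_id).rpow_const fun _ => Or.inr hθ.le)
  have h2 : Continuous fun η : ℝ => ∑ i, ((1 - δ) * |p i| + η) ^ θ + lam :=
    (continuous_finsetSum _ fun i _ => (continuous_const.add continuous_id).rpow_const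
      fun _ => Or.inr hθ.le).add continuous_const
  have h3 : Continuous fun η : ℝ => d * (δ * N + η) := by fun_prop
  have h4 : ∀ᶠ η in 𝓝 (0 : ℝ), d * (δ * N + η) < ε :=
    (h3.tendsto 0).eventually_lt_const (by simpa using hδε)
  have h5 := ((h1.tendsto 0).eventually_lt (h2.tendsto 0) hlt).and h4
  obtain ⟨η, ⟨hη1, hη2⟩, hη0⟩ := ((h5.filter_mono (nhdsWithin_le_nhds (s := Ioi 0))).and
    self_mem_nhdsWithin).exists
  exact ⟨δ, η, hδ0, hδ1, hη0, hη2, hη1⟩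

/-- A box whose coordinates have the signs of `p`, and whose moduli on the light scale lie between
`(1-δ)|p i| + η/2` and `(1-δ)|p i| + η`, is mapped into the ball. Its expected count is unbounded by
the strict inequality from `exists_perturbation`. -/
theorem tendsto_cloud_ball (hlam : 0 < lam) (hρ : IsExcessMeasure lam ρ)
    (hm : ∀ i, ρ {w | 1 ≤ |w i|} = 2) (hd : 1 ≤ d) (hθ : 0 < θ) (hG : IsSymmCDF G)
    (hb : ∀ n, 0 < b n)
    (hΛ : ∀ u : ℝ, 0 < u →
      Tendsto (fun n : ℕ => tailExponent G (b n * u) / Real.log n) atTop (𝓝 (u ^ θ)))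
    {p : EuclideanSpace ℝ (Fin d)} (hp : p ∈ limitSet d lam θ) {ε : ℝ} (hε : 0 < ε) :
    Tendsto (fun n : ℕ => n * (perturbedLaw lam ρ).real
      {w | (b n)⁻¹ • metaMap G (paretoCDF lam) w ∈ Metric.ball p ε}) atTop atTop := by
  have hprob := isProbabilityMeasure_perturbedLaw hlam hρ hm hd
  have hP := isSymmCDF_paretoCDF hlam
  obtain ⟨δ, η, hδ0, hδ1, hη0, hηε, hsum⟩ := exists_perturbation hlam hθ hp hε
  set N := ‖WithLp.ofLp p‖
  have hN0 : 0 ≤ N := norm_nonneg _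
  have hδ1' : 0 ≤ 1 - δ := by linarith
  -- A sign `±1` is chosen even where `p i = 0`, so that `t ↦ σ i * t` preserves lengths in every
  -- coordinate.
  obtain ⟨σ, hσ, hσp⟩ : ∃ σ : Fin d → ℝ, (∀ i, σ i = 1 ∨ σ i = -1) ∧ ∀ i, p i = σ i * |p i| := by
    refine ⟨fun i => if 0 ≤ p i then 1 else -1, fun i => ?_, fun i => ?_⟩
    · dsimp only
      split_ifs <;> simp
    · dsimp only
      split_ifs with h
      · rw [abs_of_nonneg h, one_mul]
      · rw [abs_of_neg (not_le.1 h)]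
        ring
  set α : Fin d → ℝ := fun i => (1 - δ) * |p i| + η / 2 with hα
  set β : Fin d → ℝ := fun i => (1 - δ) * |p i| + η with hβ
  have hp0 : ∀ i, 0 ≤ (1 - δ) * |p i| := fun i => mul_nonneg hδ1' (abs_nonneg _)
  have hα0 : ∀ i, 0 < α i := fun i => by have := hp0 i; simp only [hα]; linarith
  have hαβ : ∀ i, α i < β i := fun i => by simp only [hα, hβ]; linarith
  have hβ0 : ∀ i, 0 < β i := fun i => (hα0 i).trans (hαβ i)
  have hq0 : 0 < (1 - δ) * N + η := by positivity
  set k : ℝ := 2 ^ lam⁻¹ with hk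
  have hk0 : 0 < k := two_rpow_pos _
  set R : ℝ → ℕ → ℝ := fun u n => paretoLevel lam G (b n * u) with hR
  set B : ℕ → Fin d → Set ℝ := fun n i =>
    (fun t => σ i * t) ⁻¹' Icc (R (α i) n - k) (R (β i) n - k) with hBdef
  have hσabs : ∀ i, |σ i| = 1 := fun i => by rcases hσ i with h | h <;> simp [h]
  have hRtop : ∀ u, 0 < u → Tendsto (R u) atTop atTop := fun u hu =>
    Real.tendsto_exp_atTop.comp ((tendsto_of_div_log_pos (Real.rpow_pos_of_pos hu θ)
      (hΛ u hu)).atTop_div_const hlam)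
  have hge : ∀ᶠ n in atTop, ∀ i, k ≤ R (α i) n := eventually_all.2 fun i =>
    (hRtop _ (hα0 i)).eventually_ge_atTop k
  -- The levels behave like `n ^ (uᶿ/λ)`, so the larger one dominates and each side of the box has
  -- length at least half of it.
  have hgap : ∀ᶠ n in atTop, ∀ i, 2 * R (α i) n ≤ R (β i) n := eventually_all.2 fun i => by
    have h := ((hΛ _ (hβ0 i)).sub (hΛ _ (hα0 i))).congr fun n => (sub_div _ _ _).symm
    have h' := (tendsto_of_div_log_pos
      (sub_pos.2 (Real.rpow_lt_rpow (hα0 i).le (hαβ i) hθ)) h).atTop_div_const hlam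
    filter_upwards [h'.eventually_ge_atTop (Real.log 2)] with n hn
    have h2 := Real.exp_le_exp.2 hn
    rw [Real.exp_log two_pos, sub_div, Real.exp_sub, le_div_iff₀ (Real.exp_pos _)] at h2
    exact h2
  have hB : ∀ n i, MeasurableSet (B n i) := fun n i =>
    (measurable_const_mul (σ i)) measurableSet_Icc
  have hBR : ∀ᶠ n in atTop, ∀ i, B n i ⊆
      Icc (-R ((1 - δ) * N + η) n) (R ((1 - δ) * N + η) n) := by
    filter_upwards [hge] with n hn i t ht
    have ht1 : R (α i) n - k ≤ σ i * t := ht.1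
    have ht2 : σ i * t ≤ R (β i) n - k := ht.2
    have h1 : |t| = σ i * t := by
      rw [← abs_of_nonneg (by linarith [hn i] : 0 ≤ σ i * t), abs_mul, hσabs, one_mul]
    have h2 : R (β i) n ≤ R ((1 - δ) * N + η) n := by
      refine (hG.paretoLevel_strictMono hlam).monotone (mul_le_mul_of_nonneg_left ?_ (hb n).le)
      have := mul_le_mul_of_nonneg_left (abs_coord_le_supNorm p i) hδ1'
      simp only [hβ]
      linarith
    exact abs_le.1 (by linarith)
  have hvol : ∀ᶠ n in atTop, ∀ i, ENNReal.ofReal (R (β i) n / 2) ≤ volume (B n i) := by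
    filter_upwards [hgap] with n hn i
    have hσ0 : σ i ≠ 0 := fun h => by simpa [h] using hσabs i
    rw [hBdef, Real.volume_preimage_mul_left hσ0, abs_inv, hσabs, inv_one, ENNReal.ofReal_one,
      one_mul, Real.volume_Icc]
    exact ENNReal.ofReal_le_ofReal (by linarith [hn i])
  refine tendsto_atTop_mono' _ ?_ (tendsto_natCast_mul_perturbedLaw_box hlam hρ hm hd hη0
    (Real.rpow_pos_of_pos hq0 θ) (hΛ _ hq0) (fun i => hΛ _ (hβ0 i)) hsum hB hBR hvol)
  filter_upwards [hge] with n hn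
  have hsub : {w : EuclideanSpace ℝ (Fin d) | ∀ i, w i ∈ B n i} ⊆
      {w | (b n)⁻¹ • metaMap G (paretoCDF lam) w ∈ Metric.ball p ε} := by
    intro w hw
    have hcoord : ∀ i, |((b n)⁻¹ • metaMap G (paretoCDF lam) w - p) i| ≤ δ * N + η := by
      intro i
      have ht1 : R (α i) n - k ≤ σ i * w i := (hw i).1
      have ht2 : σ i * w i ≤ R (β i) n - k := (hw i).2
      have habs : |w i| = σ i * w i := by
        rw [← abs_of_nonneg (by linarith [hn i] : 0 ≤ σ i * w i), abs_mul, hσabs, one_mul]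
      have h1 := (hG.le_abs_scaled_metaMap_iff hlam (hb n) w i (α i)).2
        (show R (α i) n ≤ k + |w i| by linarith)
      have h2 := (hG.abs_scaled_metaMap_le_iff hlam (hb n) w i (β i)).2
        (show k + |w i| ≤ R (β i) n by linarith)
      have hsgn : ((b n)⁻¹ • metaMap G (paretoCDF lam) w) i =
          σ i * |((b n)⁻¹ • metaMap G (paretoCDF lam) w) i| := by
        rw [hG.abs_scaled_metaMap hlam (hb n), PiLp.smul_apply, smul_eq_mul, metaMap_apply, habs]
        rcases hσ i with h | h
        · rw [h, one_mul, one_mul]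
        · rw [h, neg_one_mul, neg_one_mul, hG.metaComponent_neg hP]
          ring
      have h3 := mul_le_mul_of_nonneg_left (abs_coord_le_supNorm p i) hδ0.le
      have h4 : |(|((b n)⁻¹ • metaMap G (paretoCDF lam) w) i| - |p i|)| ≤ δ * N + η := by
        simp only [hα, hβ] at h1 h2
        have := mul_nonneg hδ0.le (abs_nonneg (p i))
        rw [abs_le]
        constructor <;> linarith
      rw [PiLp.sub_apply, hsgn, hσp i, ← mul_sub, abs_mul, hσabs, one_mul]
      exact h4
    change dist _ _ < ε
    rw [dist_eq_norm]
    exact (norm_le_of_abs_coord_le (by positivity) hcoord).trans_lt hηε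
  exact mul_le_mul_of_nonneg_left (measureReal_mono hsub) (Nat.cast_nonneg n)

theorem sampleCloudsConvergeOnto_lightLaw (hlam : 0 < lam) (hρ : IsExcessMeasure lam ρ)
    (hm : ∀ i, ρ {w | 1 ≤ |w i|} = 2) (hd : 1 ≤ d) (hplanes : ∀ i, ρ {w | w i = 0} = 0)
    (hθ : 0 < θ) (hG : IsSymmCDF G) (hb : ∀ n, 0 < b n)
    (hΛ : ∀ u : ℝ, 0 < u →
      Tendsto (fun n : ℕ => tailExponent G (b n * u) / Real.log n) atTop (𝓝 (u ^ θ))) :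
    SampleCloudsConvergeOnto ((perturbedLaw lam ρ).map (metaMap G (paretoCDF lam))) b
      (limitSet d lam θ) := by
  have hprob := isProbabilityMeasure_perturbedLaw hlam hρ hm hd
  have hT := hG.measurable_metaMap (d := d) (isSymmCDF_paretoCDF hlam)
  have hprob' := Measure.isProbabilityMeasure_map (μ := perturbedLaw lam ρ) hT.aemeasurable
  have hreal : ∀ {A : Set (EuclideanSpace ℝ (Fin d))}, MeasurableSet A → ∀ n : ℕ,
      ((perturbedLaw lam ρ).map (metaMap G (paretoCDF lam))).real {z | (b n)⁻¹ • z ∈ A} =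
        (perturbedLaw lam ρ).real {w | (b n)⁻¹ • metaMap G (paretoCDF lam) w ∈ A} :=
    fun hA n => map_measureReal_apply hT (measurable_const_smul (b n)⁻¹ hA)
  refine ⟨isCompact_limitSet hlam hθ, fun U hU hEU => ?_, fun m _ ε hε p hp => ?_⟩
  · have hA := hU.isClosed_compl.measurableSet
    refine tendsto_sampleLaw_zero hA ?_
    simp only [hreal hA]
    exact tendsto_cloud_compl hlam hρ hm hd hplanes hθ hG hb hΛ hU hEU
  · have hA := (Metric.isOpen_ball (x := p) (ε := ε)).measurableSet
    refine tendsto_sampleLaw_one hA ?_ m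
    simp only [hreal hA]
    exact tendsto_cloud_ball hlam hρ hm hd hθ hG hb hΛ hp hε

end LowerBound

/-! ### The theorem: both laws as images of one measure -/

theorem mainTheorem3 {d : ℕ} (hd : 1 ≤ d) {lam θ : ℝ}
    {f : EuclideanSpace ℝ (Fin d) → ℝ} {f₀ g₀ ψ : ℝ → ℝ}
    (hsetup : StandardSetup d lam θ f f₀ g₀ ψ)
    (ρ : Measure (EuclideanSpace ℝ (Fin d)))
    (hρ : IsExcessMeasureOf lam (cdf (densityLaw f₀)) (densityLaw f) ρ)
    (hρ_planes : ∀ i, ρ {w | w i = 0} = 0)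
    (ρ' : Measure (EuclideanSpace ℝ (Fin d)))
    (hρ' : IsExcessMeasure lam ρ')
    (hρ'_marg : HasParetoMarginals lam ρ')
    (hρ'_orth : SameOrthantMarginals ρ' ρ) :
    ∃ π' μ' : Measure (EuclideanSpace ℝ (Fin d)),
      IsProbabilityMeasure π' ∧ IsProbabilityMeasure μ' ∧
      (∀ i, Continuous (cdf (marginal π' i)) ∧ StrictMono (cdf (marginal π' i)) ∧
        TailAsymptotic (cdf (marginal π' i)) (cdf (densityLaw f₀))) ∧
      jointCDF μ' = jointCDF π' ∘ metaMap (cdf (densityLaw f₀)) (cdf (densityLaw g₀)) ∧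
      (∀ c, IsHeavyScaling (cdf (densityLaw f₀)) c → SampleCloudsConvergeToPoisson π' c ρ') ∧
      (∀ b, IsLightScaling (cdf (densityLaw g₀)) b →
        SampleCloudsConvergeOnto μ' b (limitSet d lam θ)) := by
  have hlam := hsetup.lam_pos
  have hθ := hsetup.theta_pos
  have hF := hsetup.f₀_density.isSymmCDF hsetup.f₀_symm
  have hG := hsetup.g₀_density.isSymmCDF hsetup.g₀_symm
  have hP := isSymmCDF_paretoCDF hlam
  have hm := hρ'_marg.measure_one_le_abs hlam
  -- Both masses are `2`: for `ρ'` by its Pareto marginals, for `ρ` by the normalisation of `c_n`.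
  -- Infinite mass for `ρ` is excluded since `Measure.real` would then be `0`.
  have htot : ∀ i, ρ' {w | 1 ≤ |w i|} = ρ {w | 1 ≤ |w i|} := fun i => by
    have h := hρ.real_one_le_abs_coord hsetup.heavy.1 hsetup.f₀_density hsetup.f₀_symm
      hsetup.marginals i
    have hne : ρ {w | 1 ≤ |w i|} ≠ ∞ := fun htop => by
      simp [Measure.real, htop] at h
    rw [hm i, ← ENNReal.ofReal_toReal hne]
    change _ = ENNReal.ofReal (ρ.real {w | 1 ≤ |w i|})
    rw [h, ENNReal.ofReal_ofNat]
  have hplanes := hρ'.measure_coord_eq_zero hρ_planes hρ'_orth htot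
  have hprob := isProbabilityMeasure_perturbedLaw hlam hρ' hm hd
  refine ⟨(perturbedLaw lam ρ').map (metaMap (cdf (densityLaw f₀)) (paretoCDF lam)),
    (perturbedLaw lam ρ').map (metaMap (cdf (densityLaw g₀)) (paretoCDF lam)),
    Measure.isProbabilityMeasure_map (hF.measurable_metaMap hP).aemeasurable,
    Measure.isProbabilityMeasure_map (hG.measurable_metaMap hP).aemeasurable,
    fun i => marginal_heavyLaw hlam hρ' hρ'_marg hd hplanes hF i,
    jointCDF_map_metaMap hF hG hP _, fun c hc => ?_, fun b hb => ?_⟩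
  · exact sampleCloudsConvergeToPoisson_heavyLaw hlam hρ' hm hd hplanes hF hc.1 fun x hx =>
      hρ.tendsto_tail hsetup.heavy.1 hsetup.f₀_density hsetup.f₀_symm hsetup.marginals ⟨0, hd⟩
        hc hx
  · exact sampleCloudsConvergeOnto_lightLaw hlam hρ' hm hd hplanes hθ hG hb.1 fun u hu =>
      tendsto_tailExponent_mul hθ hsetup.g₀_density hsetup.g₀_symm hsetup.vonMises
        hsetup.g₀_asymp hsetup.psi_rv hb hu
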